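/- **Setting.** Let $\{W(s,x)\}_{s\ge 0,\,x\in[0,1]}$ be a centred real process with finite eighth moments such that $W(s,\cdot)$, $s\ge0$, are independent, and whose mixed moments do not depend on $s$: $\mathbb E[W(s,x_1)W(s,x_2)]=A(x_1,x_2)$, $\mathbb E[\prod_{k=1}^4W(s,x_k)]=B(x_1,\dots,x_4)$, $\mathbb E[\prod_{k=1}^8W(s,x_k)]=E(x_1,\dots,x_8)$. Assume that $A(x,\cdot)\in C^1([0,1])$ for every $x$ and that there are constants $C_2,\dots,C_9$ such that for all points of $[0,1]$ * $|A(x,y)|\le C_2$, $|A(x,z)-A(y,z)|\le C_3|x-y|$, $|A(x,x)+A(y,y)-2A(x,y)|\le C_4^2|x-y|^2$; * $|B|\le C_5$, $|B(x,z,x,z)+B(y,z,y,z)-2B(x,z,y,z)|\le C_6^2|x-y|^2$, and $|B(x,x,x,x)+B(y,y,y,y)+6B(x,x,y,y)-4B(x,x,x,y)-4B(x,y,y,y)|\le C_7^4|x-y|^4$; * $E\le C_8$, and, writing $E(\cdot\,;z)$ for $E$ with its last four arguments equal to $z\in[0,1]^4$, $|E(x,x,x,x;z)+E(y,y,y,y;z)+6E(x,x,y,y;z)-4E(x,x,x,y;z)-4E(x,y,y,y;z)|\le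 C_9^4|x-y|^4$. For all integers $d,T\ge1$ let $\sigma=\sigma_{d,T}\ge0$, $\gamma=\gamma_{d,T}\ge0$, let $(\Delta\theta^0_i)_{1\le i\le d}$ be initial values in $L^4$ and $(\varepsilon^t)_{t\ge0}$ noises with $\mathbb E[\varepsilon^t]=0$, $\mathbb E|\varepsilon^t|^2\le\sigma^2$, $\mathbb E|\varepsilon^t|^4\le C_1\sigma^4$ with $C_1$ independent of $d,T,t$ (all depending on $d,T$), such that $W$ is independent of the pair (initial values, noises). Fix $\alpha>0$, put $\eta=\frac{\alpha}{dT}$, $x^t_i=W(\frac tT,\frac id)$, and define the centred online SGD iterates $$\Delta\theta^{t+1}_i=\Delta\theta^t_i-\eta\sum_{j=1}^dx^t_ix^t_j\Delta\theta^t_j+\eta x^t_i\varepsilon^t,\qquad 1\le i\le d,\ t\ge0,$$ with the convention $\Delta\theta^t_0:=\Delta\theta^t_1$. Fix $\tau>0$. Let $\overline\Theta^{d,T}\in C([0,\tau];C([0,1]))$ be the interpolation of $\overline\Theta^{d,T}(\frac tT,\frac id)=\Delta\theta^t_i$ that is piecewise linear in time (mesh $1/T$) and in space (mesh $1/d$).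 Let $\Theta\in C([0,\tau];C([0,1]))$ be a (deterministic) solution of $$\partial_s\Theta(s,x)=-\alpha\int_0^1A(x,y)\Theta(s,y)\,dy,\qquad \Theta(0,\cdot)\in C^1([0,1]),$$ and let $U^{d,T}=\gamma\,(\overline\Theta^{d,T}-\Theta)$. Assume that there are constants $R,L,D,M$ with, for all $d,T\ge 1$, $$\mathbb E|\Delta\theta^0_i|^4\le R^4,\quad \mathbb E|U^{d,T}(0,\tfrac id)|^4\le D^4\qquad(1\le i\le d),$$ $$\mathbb E|\Delta\theta^0_i-\Delta\theta^0_{i-1}|^4\le L^4d^{-4},\quad \mathbb E|U^{d,T}(0,\tfrac id)-U^{d,T}(0,\tfrac{i-1}d)|^4\le M^4d^{-4}\qquad(2\le i\le d),$$ that $\sigma=o(dT^{1/2})$ as $d,T\to\infty$, and that $\max(\gamma T^{-1/2},\gamma d^{-1},\gamma\sigma d^{-1}T^{-1/2})\le C_{s,2}$ for all $d,T\ge1$, with $C_{s,2}$ independent of $d,T$. **Theorem.** 1. The family of processes $(s,x)\mapsto U^{d,T}(s,\max(x,\tfrac1d))$, $d,T\ge1$ (which equal $U^{d,T}$ for $x\ge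 \frac1d$ and are constant in $x$ on the boundary cell $[0,\frac1d]$, where the values of $\overline\Theta^{d,T}$ come from the convention $\Delta\theta_0^t:=\Delta\theta_1^t$) is tight in $C([0,\tau];C([0,1]))$; hence every sequence in it has a weakly convergent subsequence with limit in $C([0,\tau];C([0,1]))$. 2. The family $\{U^{d,T}\}_{d,T\ge1}$ itself is tight in $C([0,\tau];C([0,1]))$ if and only if $\gamma\,\sup_{s\in[0,\tau]}|\Theta(s,\tfrac1d)-\Theta(s,0)|\to0$ as $d,T\to\infty$; in that case every sequence in it has a weakly convergent subsequence with limit in $C([0,\tau];C([0,1]))$. 3. In particular, if $\gamma d^{-1}\to0$ as $d,T\to\infty$, then $\{U^{d,T}\}_{d,T\ge1}$ is tight in $C([0,\tau];C([0,1]))$, and every sequence in it has a weakly convergent subsequence with limit in $C([0,\tau];C([0,1]))$. -/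

import Mathlib

open MeasureTheory ProbabilityTheory Filter Topology
open scoped NNReal

noncomputable section

namespace SGDFluctuation

/-! ### Data, noise and moment assumptions -/

/-- A space-time process `W(s, x)`, `s ≥ 0`, `x ∈ [0, 1]`, centred, white in time (its values at
distinct times are independent), with finite eighth moments and with second, fourth and eighth
mixed spatial moments `A`, `B`, `E` at every time. -/
structure IsDataProcess {Ω : Type*} [MeasurableSpace Ω] (P : Measure Ω)
    (W : ℝ≥0 → unitInterval → Ω → ℝ) (A : unitInterval → unitInterval → ℝ)
    (B : (Fin 4 → unitInterval) → ℝ) (E : (Fin 8 → unitInterval) → ℝ) : Prop where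
  measurable : ∀ s x, Measurable (W s x)
  memLp : ∀ s x, MemLp (W s x) 8 P
  white : iIndepFun (fun (s : ℝ≥0) (ω : Ω) (x : unitInterval) => W s x ω) P
  mean : ∀ s x, ∫ ω, W s x ω ∂P = 0
  second : ∀ s x y, ∫ ω, W s x ω * W s y ω ∂P = A x y
  fourth : ∀ s (x : Fin 4 → unitInterval), ∫ ω, ∏ k, W s (x k) ω ∂P = B x
  eighth : ∀ s (x : Fin 8 → unitInterval), ∫ ω, ∏ k, W s (x k) ω ∂P = E x

/-- The smoothness conditions on the moment functions `A`, `B`, `E`. -/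
structure SmoothMoments (A : unitInterval → unitInterval → ℝ)
    (B : (Fin 4 → unitInterval) → ℝ) (E : (Fin 8 → unitInterval) → ℝ) : Prop where
  A_contDiff : ∀ x, ContDiffOn ℝ 1 (Set.IccExtend (zero_le_one (α := ℝ)) (A x)) (Set.Icc 0 1)
  A_bound : ∃ C₂ : ℝ, ∀ x y, |A x y| ≤ C₂
  A_lip : ∃ C₃ : ℝ, ∀ x y z, |A x z - A y z| ≤ C₃ * |(x : ℝ) - y|
  A_diag : ∃ C₄ : ℝ, ∀ x y, |A x x + A y y - 2 * A x y| ≤ C₄ ^ 2 * |(x : ℝ) - y| ^ 2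
  B_bound : ∃ C₅ : ℝ, ∀ x, |B x| ≤ C₅
  B_second : ∃ C₆ : ℝ, ∀ x y z,
    |B ![x, z, x, z] + B ![y, z, y, z] - 2 * B ![x, z, y, z]| ≤ C₆ ^ 2 * |(x : ℝ) - y| ^ 2
  B_fourth : ∃ C₇ : ℝ, ∀ x y,
    |B ![x, x, x, x] + B ![y, y, y, y] + 6 * B ![x, x, y, y] - 4 * B ![x, x, x, y]
      - 4 * B ![x, y, y, y]| ≤ C₇ ^ 4 * |(x : ℝ) - y| ^ 4
  E_bound : ∃ C₈ : ℝ, ∀ x, E x ≤ C₈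
  E_fourth : ∃ C₉ : ℝ, ∀ x y a b c e,
    |E ![x, x, x, x, a, b, c, e] + E ![y, y, y, y, a, b, c, e] + 6 * E ![x, x, y, y, a, b, c, e]
      - 4 * E ![x, x, x, y, a, b, c, e] - 4 * E ![x, y, y, y, a, b, c, e]|
      ≤ C₉ ^ 4 * |(x : ℝ) - y| ^ 4

/-- A centred noise sequence with variances at most `σ²` and fourth moments at most `C₁ σ⁴`. -/
structure IsNoise {Ω : Type*} [MeasurableSpace Ω] (P : Measure Ω) (C₁ σ : ℝ)
    (ε : ℕ → Ω → ℝ) : Prop where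
  measurable : ∀ t, Measurable (ε t)
  memLp : ∀ t, MemLp (ε t) 4 P
  mean : ∀ t, ∫ ω, ε t ω ∂P = 0
  second : ∀ t, ∫ ω, |ε t ω| ^ 2 ∂P ≤ σ ^ 2
  fourth : ∀ t, ∫ ω, |ε t ω| ^ 4 ∂P ≤ C₁ * σ ^ 4

/-! ### The particle system -/

/-- The grid point `i / d` of `[0, 1]` (clamped to `[0, 1]` when `i > d`). -/
def gridPoint (d i : ℕ) : unitInterval := Set.projIcc (0 : ℝ) 1 zero_le_one ((i : ℝ) / d)

/-- The centred online SGD iterates `Δθ^t_i`, `1 ≤ i ≤ d`, with step size `η`, samples `x^t_i`,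
noises `ε^t` and initial values `Δθ^0_i = Δ₀ i`. -/
def centredSGD (d : ℕ) (η : ℝ) (x : ℕ → ℕ → ℝ) (ε : ℕ → ℝ) (Δ₀ : ℕ → ℝ) : ℕ → ℕ → ℝ
  | 0, i => Δ₀ i
  | t + 1, i =>
      centredSGD d η x ε Δ₀ t i
        - η * ∑ j ∈ Finset.Icc 1 d, x t i * x t j * centredSGD d η x ε Δ₀ t j
        + η * x t i * ε t

/-- Node values, with the convention that the node `0` carries the value of particle `1`. -/
def nodeValue (v : ℕ → ℝ) (i : ℕ) : ℝ := if i = 0 then v 1 else v i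

/-! ### Piecewise linear interpolation -/

/-- Piecewise linear interpolation of a sequence: `(⌊r⌋ + 1 - r) v_⌊r⌋ + (r - ⌊r⌋) v_{⌊r⌋ + 1}`. -/
def linInterp {F : Type*} [AddCommGroup F] [Module ℝ F] (v : ℕ → F) (r : ℝ) : F :=
  ((⌊r⌋₊ : ℝ) + 1 - r) • v ⌊r⌋₊ + (r - ⌊r⌋₊) • v (⌊r⌋₊ + 1)

theorem linInterp_eq {F : Type*} [AddCommGroup F] [Module ℝ F] (v : ℕ → F) (n : ℕ) {r : ℝ}
    (h₀ : (n : ℝ) ≤ r) (h₁ : r ≤ n + 1) :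
    linInterp v r = ((n : ℝ) + 1 - r) • v n + (r - n) • v (n + 1) := by
  rcases h₁.lt_or_eq with h | h
  · have hf : ⌊r⌋₊ = n := (Nat.floor_eq_iff ((Nat.cast_nonneg n).trans h₀)).2 ⟨h₀, h⟩
    simp [linInterp, hf]
  · have hf : ⌊r⌋₊ = n + 1 := by
      rw [h]; exact_mod_cast Nat.floor_natCast (R := ℝ) (n + 1)
    rw [linInterp, hf, h]
    simp

theorem linInterp_eq_of_le {F : Type*} [AddCommGroup F] [Module ℝ F] (v : ℕ → F) {r : ℝ}
    (h : r ≤ 0) : linInterp v r = (1 - r) • v 0 + r • v 1 := by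
  simp [linInterp, Nat.floor_of_nonpos h]

theorem continuous_linInterp {F : Type*} [AddCommGroup F] [Module ℝ F] [TopologicalSpace F]
    [IsTopologicalAddGroup F] [ContinuousSMul ℝ F] (v : ℕ → F) : Continuous (linInterp v) := by
  have key : ∀ N : ℕ, ContinuousOn (linInterp v) (Set.Iic (N : ℝ)) := by
    intro N
    induction N with
    | zero =>
      have hc : Continuous (fun r : ℝ => (1 - r) • v 0 + r • v 1) := by fun_prop
      refine hc.continuousOn.congr fun r hr => linInterp_eq_of_le v ?_
      simpa using hr
    | succ N ih =>
      have hc : Continuous (fun r : ℝ => ((N : ℝ) + 1 - r) • v N + (r - N) • v (N + 1)) := by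
        fun_prop
      have h₂ : ContinuousOn (linInterp v) (Set.Icc (N : ℝ) (N + 1)) :=
        hc.continuousOn.congr fun r hr => linInterp_eq v N hr.1 hr.2
      have hu := ih.union_of_isClosed h₂ isClosed_Iic isClosed_Icc
      refine hu.mono fun r hr => ?_
      have hr' : r ≤ (N : ℝ) + 1 := by simpa using hr
      rcases le_total r (N : ℝ) with h | h
      · exact Or.inl h
      · exact Or.inr ⟨h, hr'⟩
  refine continuous_iff_continuousAt.2 fun r => ?_
  obtain ⟨N, hN⟩ := exists_nat_gt r
  exact (key N).continuousAt (Iic_mem_nhds hN)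

/-- The path space `C([0, τ]; C([0, 1]))`, with the topology of uniform convergence. -/
abbrev PathSpace (τ : ℝ) : Type := C(Set.Icc (0 : ℝ) τ, C(unitInterval, ℝ))

instance instMeasurableSpacePathSpace (τ : ℝ) : MeasurableSpace (PathSpace τ) := borel _

instance instBorelSpacePathSpace (τ : ℝ) : BorelSpace (PathSpace τ) := ⟨rfl⟩

/-- Spatial interpolation of the values of the particles at a given time: the continuous function
`x ↦ (⌊dx⌋ + 1 - dx) v_⌊dx⌋ + (dx - ⌊dx⌋) v_{⌊dx⌋ + 1}` with `v_0 = v_1`. -/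
def spaceInterp (d : ℕ) (v : ℕ → ℝ) : C(unitInterval, ℝ) where
  toFun x := linInterp (nodeValue v) ((d : ℝ) * x)
  continuous_toFun := (continuous_linInterp _).comp (by fun_prop)

/-- The space-time interpolation of an array `Δ t i`, linear in time on the grid of width `1 / T`
and linear in space on the grid of width `1 / d`. -/
def spaceTimeInterp (τ : ℝ) (d T : ℕ) (Δ : ℕ → ℕ → ℝ) : PathSpace τ where
  toFun s := linInterp (fun t => spaceInterp d (Δ t)) ((s : ℝ) * T)
  continuous_toFun := (continuous_linInterp _).comp (by fun_prop)

/-! ### The limit and the fluctuations -/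

/-- `Θ` solves `∂_s Θ(s, x) = -α ∫₀¹ A(x, y) Θ(s, y) dy` on `[0, τ] × [0, 1]`, with an initial
value `Θ(0, ·)` of class `C¹`. -/
structure IsScalingLimit {τ : ℝ} (hτ : 0 ≤ τ) (α : ℝ) (A : unitInterval → unitInterval → ℝ)
    (Θ : PathSpace τ) : Prop where
  ode : ∀ (s : Set.Icc (0 : ℝ) τ) (x : unitInterval),
    HasDerivWithinAt (fun r : ℝ => Θ (Set.projIcc 0 τ hτ r) x)
      (-α * ∫ y : unitInterval, A x y * Θ s y) (Set.Icc 0 τ) s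
  initial : ContDiffOn ℝ 1
    (Set.IccExtend (zero_le_one (α := ℝ)) (fun x : unitInterval => Θ ⟨0, le_rfl, hτ⟩ x))
    (Set.Icc 0 1)

/-- The fluctuation process `U^{d,T} = γ (Θ̄^{d,T} - Θ)`, where `Θ̄^{d,T}` is the space-time
interpolation of the SGD iterates with step size `α / (d T)` and samples
`x^t_i = W(t / T, i / d)`. -/
def fluctuation {Ω : Type*} {τ : ℝ} (W : ℝ≥0 → unitInterval → Ω → ℝ) (Θ : PathSpace τ)
    (α : ℝ) (d T : ℕ) (γ : ℝ) (ε : ℕ → Ω → ℝ) (Δ₀ : ℕ → Ω → ℝ) (ω : Ω) : PathSpace τ :=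
  γ • (spaceTimeInterp τ d T
    (centredSGD d (α / ((d : ℝ) * T)) (fun t i => W ((t : ℝ≥0) / (T : ℝ≥0)) (gridPoint d i) ω)
      (fun t => ε t ω) (fun i => Δ₀ i ω)) - Θ)

/-- The path `(s, x) ↦ u(s, max(x, 1/d))`: it agrees with `u` for `x ≥ 1/d` and is constant in `x`
on the boundary cell `[0, 1/d]`. -/
def freezeBoundary {τ : ℝ} (d : ℕ) (u : PathSpace τ) : PathSpace τ where
  toFun s := (u s).comp ⟨fun x => x ⊔ gridPoint d 1, by fun_prop⟩
  continuous_toFun := by fun_prop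

/-! ### Tightness and relative compactness in law -/

/-- A tight family of random elements. -/
def IsTightFamily {Ω ι S : Type*} [MeasurableSpace Ω] [TopologicalSpace S] [MeasurableSpace S]
    (P : Measure Ω) (X : ι → Ω → S) : Prop :=
  (∀ i, Measurable (X i)) ∧ IsTightMeasureSet (Set.range fun i => P.map (X i))

/-- Every sequence of members of the family has a subsequence that converges weakly to a random
element of `S`, represented by its law `ν`. -/
def HasWeakSubsequentialLimits {Ω ι S : Type*} [MeasurableSpace Ω] [TopologicalSpace S]
    [MeasurableSpace S] [OpensMeasurableSpace S] (P : Measure Ω) [IsProbabilityMeasure P]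
    (X : ι → Ω → S) : Prop :=
  ∀ p : ℕ → ι, ∃ φ : ℕ → ℕ, StrictMono φ ∧ ∃ ν : ProbabilityMeasure S,
    TendstoInDistribution (fun k => X (p (φ k))) atTop (id : S → S) (fun _ => P) (ν : Measure S)

end SGDFluctuation

end

/-! Interpolating `U` again on the spatial grid, with the boundary convention, leaves the
interpolated iterates unchanged and alters only `Θ`. Hence `U` is the sum of a random part
`gridInterp ∘ U` and the deterministic path `γ • gridError d Θ` (`fluctuation_eq_add`). The random
part is always tight, so all the statements reduce to relative compactness of the deterministic
part.

Random part. Consider the discrete derivatives `d (U_i - U_{i-1})`, together with `U_1`. Over one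
time step each changes by a linear drift of order `1/T`, a martingale increment whose fourth moment
is of order `1/T²`, and a deterministic consistency error of order `γ (1/d + 1/T) / T`
(`discFluct_sub`, `exists_residual_le`). The increments are centred because the current sample is
centred and independent of the earlier samples, the initial values and all noises; no independence
between the noises is needed. Smoothness of the moment functions makes the bounds uniform in the
particle, and the bounds on `γ / √T`, `γ / d` and `γ σ / (d √T)` make them uniform in `d` and `T`
(`exists_isIncrementScheme`). A discrete Gronwall argument bounds the fourth moments, and a
fourth-moment martingale inequality then gives increments in time with `E |D_i(s) - D_i(s')|⁴ ≤ K'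
|s - s'|²` (`IsIncrementScheme.exists_moment_bound`). Averaged over the particles, this is a
Kolmogorov condition for the path in a discrete Sobolev space `H¹`. Chaining gives Hölder continuity
in time with values in `H¹`, the Sobolev norm controls the `1/2`-Hölder norm in space, and
Arzelà–Ascoli gives compact sets of paths (`isTightFamily_of_sob_moments`).

Deterministic part. Away from the boundary cell the interpolation error of `Θ(s, ·)` is `o(1/d)`
uniformly in `s`, because the initial value and the sections of `A` are `C¹`. Since `γ ≤ C d`, this
contribution vanishes as `d → ∞`, while for fixed `d` it stays on a bounded segment; this settles
the frozen processes. On the boundary cell the convention adds `(1 - d x) (Θ(s, 1/d) - Θ(s, 0))`,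
which drops from the full jump to zero over a distance `1/d`. Equicontinuity therefore holds exactly
when `γ` times the jump tends to zero (`exists_isCompact_gridError`,
`tendsto_boundaryJump_of_isCompact`). The jump is `O(1/d)`, hence `γ = o(d)` suffices. Weak
subsequential limits come from Prokhorov's theorem. -/

namespace SGDFluctuation

/-! ### Estimates from cells and nodes -/

/-- Cut `[x, y]` at its first and last integers: two partial cells and a stretch between nodes
remain, and two uses of the relaxed triangle inequality cost at most `c²`. The lemma serves squared
increments in space (`c = 2`) and fourth moments in time (`c = 8`). -/
theorem le_of_cells {ψ : ℝ → ℝ → ℝ} {G : ℝ → ℝ} {b c : ℝ} (hc : 1 ≤ c)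
    (hG : MonotoneOn G (Set.Ici 0)) (hG0 : ∀ x, 0 ≤ x → 0 ≤ G x)
    (tri : ∀ x y z, 0 ≤ x → x ≤ y → y ≤ z → z ≤ b → ψ x z ≤ c * (ψ x y + ψ y z))
    (cell : ∀ (n : ℕ) (x y : ℝ), (n : ℝ) ≤ x → x ≤ y → y ≤ n + 1 → y ≤ b → ψ x y ≤ G (y - x))
    (nodes : ∀ m n : ℕ, m ≤ n → (n : ℝ) ≤ b → ψ m n ≤ G ((n : ℝ) - m))
    (x y : ℝ) (hx : 0 ≤ x) (hxy : x ≤ y) (hy : y ≤ b) :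
    ψ x y ≤ 3 * c ^ 2 * G (y - x) := by
  have hGn : 0 ≤ G (y - x) := hG0 _ (by linarith)
  have mono : ∀ u, 0 ≤ u → u ≤ y - x → G u ≤ G (y - x) := fun u hu huy =>
    hG (Set.mem_Ici.2 hu) (Set.mem_Ici.2 (by linarith)) huy
  have hf := Nat.floor_le hx
  have hf' := Nat.lt_floor_add_one x
  have hg := Nat.floor_le (hx.trans hxy)
  have hg' := Nat.lt_floor_add_one y
  have hcl := Nat.le_ceil x
  by_cases h : ⌈x⌉₊ ≤ ⌊y⌋₊
  · have hce : ((⌈x⌉₊ : ℕ) : ℝ) ≤ ⌊x⌋₊ + 1 := by exact_mod_cast Nat.ceil_le_floor_add_one x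
    have h' : ((⌈x⌉₊ : ℕ) : ℝ) ≤ ⌊y⌋₊ := by exact_mod_cast h
    have h1 := cell ⌊x⌋₊ x ⌈x⌉₊ hf hcl hce (by linarith)
    have h2 := nodes ⌈x⌉₊ ⌊y⌋₊ h (by linarith)
    have h3 := cell ⌊y⌋₊ ⌊y⌋₊ y le_rfl hg hg'.le hy
    have t1 := tri x ⌈x⌉₊ y hx hcl (by linarith) hy
    have t2 := tri ⌈x⌉₊ ⌊y⌋₊ y (by linarith) h' hg hy
    have m1 := mono (⌈x⌉₊ - x) (by linarith) (by linarith)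
    have m2 := mono ((⌊y⌋₊ : ℝ) - ⌈x⌉₊) (by linarith) (by linarith)
    have m3 := mono (y - ⌊y⌋₊) (by linarith) (by linarith)
    have t3 : ψ ⌈x⌉₊ y ≤ c * (2 * G (y - x)) :=
      t2.trans (mul_le_mul_of_nonneg_left (by linarith) (by linarith))
    have t4 : ψ x y ≤ c * (G (y - x) + c * (2 * G (y - x))) :=
      t1.trans (mul_le_mul_of_nonneg_left (by linarith) (by linarith))
    nlinarith [mul_nonneg (sub_nonneg.2 hc) hGn, mul_nonneg (mul_nonneg (sub_nonneg.2 hc)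
      (zero_le_one.trans hc)) hGn]
  · have hlt : ((⌊y⌋₊ : ℕ) : ℝ) < x := Nat.lt_ceil.1 (not_le.1 h)
    have h1 := cell ⌊y⌋₊ x y hlt.le hxy hg'.le hy
    have : (1 : ℝ) ≤ 3 * c ^ 2 := by nlinarith
    nlinarith

/-! ### Discrete derivatives -/

/-- The discrete derivative `d (v_i - v_{i-1})` of a grid function, with the value `v_1` at the
first node. -/
def disc (d : ℕ) (v : ℕ → ℝ) (i : ℕ) : ℝ := if i ≤ 1 then v 1 else (d : ℝ) * (v i - v (i - 1))

theorem disc_one (d : ℕ) (v : ℕ → ℝ) : disc d v 1 = v 1 := by simp [disc]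

theorem disc_succ (d : ℕ) (v : ℕ → ℝ) {i : ℕ} (hi : 1 ≤ i) :
    disc d v (i + 1) = (d : ℝ) * (v (i + 1) - v i) := by
  have : ¬ (i + 1 ≤ 1) := by omega
  simp [disc, this]

theorem disc_sub (d : ℕ) (v w : ℕ → ℝ) (i : ℕ) :
    disc d (fun j => v j - w j) i = disc d v i - disc d w i := by
  unfold disc; split_ifs <;> ring

theorem disc_const_mul (d : ℕ) (c : ℝ) (v : ℕ → ℝ) (i : ℕ) :
    disc d (fun j => c * v j) i = c * disc d v i := by
  unfold disc; split_ifs <;> ring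

theorem disc_mul_const (d : ℕ) (c : ℝ) (v : ℕ → ℝ) (i : ℕ) :
    disc d (fun j => v j * c) i = disc d v i * c := by
  unfold disc; split_ifs <;> ring

theorem disc_congr {d : ℕ} {v w : ℕ → ℝ} (h : ∀ i ∈ Finset.Icc 1 d, v i = w i) {i : ℕ}
    (hi : i ∈ Finset.Icc 1 d) : disc d v i = disc d w i := by
  rw [Finset.mem_Icc] at hi
  have h1 := h 1 (Finset.mem_Icc.2 ⟨le_rfl, by omega⟩)
  have h2 := h i (Finset.mem_Icc.2 hi)
  unfold disc
  split_ifs with hle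
  · exact h1
  · rw [h2, h (i - 1) (Finset.mem_Icc.2 ⟨by omega, by omega⟩)]

theorem eq_sum_disc {d : ℕ} (hd : 1 ≤ d) (v : ℕ → ℝ) {j : ℕ} (hj : 1 ≤ j) :
    v j = disc d v 1 + (1 / (d : ℝ)) * ∑ i ∈ Finset.Ico 1 j, disc d v (i + 1) := by
  have hd' : (d : ℝ) ≠ 0 := by positivity
  induction j, hj using Nat.le_induction with
  | base => simp [disc_one]
  | succ n hn ih =>
    rw [Finset.sum_Ico_succ_top hn, disc_succ d v hn, mul_add, ← add_assoc, ← ih]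
    field_simp
    ring

/-- The vector `(v_1, √d (v_2 - v_1), …, √d (v_d - v_{d-1}))`, whose Euclidean norm is a discrete
Sobolev norm. -/
noncomputable def sob (d : ℕ) : (ℕ → ℝ) →ₗ[ℝ] EuclideanSpace ℝ (Fin d) where
  toFun v := WithLp.toLp 2 fun i => if (i : ℕ) = 0 then v 1 else √(d : ℝ) * (v (i + 1) - v i)
  map_add' v w := by ext i; simp only [PiLp.add_apply, Pi.add_apply]; split_ifs <;> ring
  map_smul' c v := by
    ext i
    simp only [PiLp.smul_apply, Pi.smul_apply, smul_eq_mul, RingHom.id_apply]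
    split_ifs <;> ring

theorem sob_norm_sq {d : ℕ} (v : ℕ → ℝ) :
    ‖sob d v‖ ^ 2 = ∑ i ∈ Finset.range d,
      if i = 0 then v 1 ^ 2 else (d : ℝ) * (v (i + 1) - v i) ^ 2 := by
  rw [EuclideanSpace.real_norm_sq_eq, ← Fin.sum_univ_eq_sum_range]
  refine Finset.sum_congr rfl fun i _ => ?_
  simp only [sob, LinearMap.coe_mk, AddHom.coe_mk]
  split_ifs
  · rfl
  · rw [mul_pow, Real.sq_sqrt (by positivity)]

theorem abs_one_le_sob {d : ℕ} (hd : 1 ≤ d) (v : ℕ → ℝ) : |v 1| ≤ ‖sob d v‖ := by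
  refine abs_le_of_sq_le_sq ?_ (norm_nonneg _)
  rw [sob_norm_sq]
  refine le_trans (by simp) (Finset.single_le_sum (f := fun i : ℕ =>
      if i = 0 then v 1 ^ 2 else (d : ℝ) * (v (i + 1) - v i) ^ 2) ?_
      (Finset.mem_range.2 (show 0 < d by omega)))
  intro i _
  split_ifs <;> positivity

theorem sum_sq_diff_le_sob {d : ℕ} (v : ℕ → ℝ) {m n : ℕ} (hm : 1 ≤ m) (hn : n ≤ d) :
    (d : ℝ) * ∑ i ∈ Finset.Ico m n, (v (i + 1) - v i) ^ 2 ≤ ‖sob d v‖ ^ 2 := by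
  rw [sob_norm_sq, Finset.mul_sum]
  calc _ = ∑ i ∈ Finset.Ico m n, if i = 0 then v 1 ^ 2 else (d : ℝ) * (v (i + 1) - v i) ^ 2 := by
        refine Finset.sum_congr rfl fun i hi => ?_
        have := (Finset.mem_Ico.1 hi).1
        rw [if_neg (by omega)]
    _ ≤ _ := by
        refine Finset.sum_le_sum_of_subset_of_nonneg (fun i hi => ?_) fun i _ _ => ?_
        · have := (Finset.mem_Ico.1 hi).2
          exact Finset.mem_range.2 (by omega)
        · split_ifs <;> positivity

/-- Cauchy–Schwarz on the telescoping sum: the discrete form of the embedding of `H¹` into the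
`1/2`-Hölder functions. -/
theorem sq_diff_le_sob {d : ℕ} (hd : 1 ≤ d) (v : ℕ → ℝ) {m n : ℕ} (hm : 1 ≤ m) (hmn : m ≤ n)
    (hn : n ≤ d) :
    (v n - v m) ^ 2 ≤ ((n : ℝ) - m) / d * ‖sob d v‖ ^ 2 := by
  have hd' : (0 : ℝ) < d := by positivity
  have h1 := sum_sq_diff_le_sob v hm hn
  have h2 : (v n - v m) ^ 2 ≤ ((n : ℝ) - m) * ∑ i ∈ Finset.Ico m n, (v (i + 1) - v i) ^ 2 := by
    rw [← Finset.sum_Ico_sub v hmn]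
    refine (sq_sum_le_card_mul_sum_sq).trans (le_of_eq ?_)
    rw [Nat.card_Ico, Nat.cast_sub hmn]
  have hnm : (0 : ℝ) ≤ (n : ℝ) - m := by rw [sub_nonneg]; exact_mod_cast hmn
  calc _ ≤ _ := h2
    _ = ((n : ℝ) - m) / d * ((d : ℝ) * ∑ i ∈ Finset.Ico m n, (v (i + 1) - v i) ^ 2) := by
        field_simp
    _ ≤ _ := by gcongr

theorem nodeValue_sq_diff_le {d : ℕ} (hd : 1 ≤ d) (v : ℕ → ℝ) {m n : ℕ} (hmn : m ≤ n)
    (hn : n ≤ d) :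
    (nodeValue v n - nodeValue v m) ^ 2 ≤ ((n : ℝ) - m) / d * ‖sob d v‖ ^ 2 := by
  have hd' : (0 : ℝ) < d := by positivity
  have hnm : (0 : ℝ) ≤ (n : ℝ) - m := by rw [sub_nonneg]; exact_mod_cast hmn
  rcases Nat.eq_zero_or_pos n with rfl | hn0
  · obtain rfl : m = 0 := by omega
    simp
  rcases Nat.eq_zero_or_pos m with rfl | hm0
  · have := sq_diff_le_sob hd v le_rfl hn0 hn
    simp only [nodeValue, hn0.ne', if_false, if_true]
    refine this.trans ?_
    gcongr
    simp
  · simp only [nodeValue, hn0.ne', hm0.ne', if_false]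
    exact sq_diff_le_sob hd v hm0 hmn hn

theorem linInterp_sub_of_cell (v : ℕ → ℝ) (n : ℕ) {x y : ℝ} (hx : (n : ℝ) ≤ x) (hx' : x ≤ n + 1)
    (hy : (n : ℝ) ≤ y) (hy' : y ≤ n + 1) :
    linInterp v y - linInterp v x = (y - x) * (v (n + 1) - v n) := by
  rw [linInterp_eq v n hx hx', linInterp_eq v n hy hy']
  simp only [smul_eq_mul]; ring

theorem linInterp_natCast (v : ℕ → ℝ) (n : ℕ) : linInterp v n = v n := by
  rw [linInterp_eq v n le_rfl (by linarith)]; simp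

theorem linInterp_sq_diff_le {d : ℕ} (hd : 1 ≤ d) (v : ℕ → ℝ) {x y : ℝ} (hx : 0 ≤ x)
    (hxy : x ≤ y) (hy : y ≤ d) :
    (linInterp (nodeValue v) y - linInterp (nodeValue v) x) ^ 2 ≤
      12 * ((y - x) / d * ‖sob d v‖ ^ 2) := by
  have hd' : (0 : ℝ) < d := by positivity
  have := le_of_cells (ψ := fun x y => (linInterp (nodeValue v) y - linInterp (nodeValue v) x) ^ 2)
    (G := fun u => u / d * ‖sob d v‖ ^ 2) (b := d) (c := 2) (by norm_num)
    (fun a _ b _ hab => by dsimp only; gcongr) (fun u hu => by positivity)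
    (fun x y z _ _ _ _ => by
      nlinarith [sq_nonneg (linInterp (nodeValue v) x - 2 * linInterp (nodeValue v) y +
        linInterp (nodeValue v) z)])
    (fun n x y hnx hxy hyn hyd => ?_) (fun m n hmn hn => ?_) x y hx hxy hy
  · linarith
  · have key : (linInterp (nodeValue v) y - linInterp (nodeValue v) x) =
      (y - x) * (nodeValue v (n + 1) - nodeValue v n) :=
        linInterp_sub_of_cell _ n hnx (hxy.trans hyn) (hnx.trans hxy) hyn
    simp only [key, mul_pow]
    -- A nondegenerate interval forces `n + 1 ≤ d`. If `x = y = d`, the cell would start at the last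
    -- node, and node `d + 1` is not controlled by `sob`.
    rcases hxy.lt_or_eq with hlt | rfl
    · have hnd : n + 1 ≤ d := by
        have : (n : ℝ) < d := by linarith
        have : n < d := by exact_mod_cast this
        omega
      have h := nodeValue_sq_diff_le hd v (Nat.le_succ n) hnd
      have h' : ((n + 1 : ℕ) : ℝ) - n = 1 := by push_cast; ring
      rw [Nat.succ_eq_add_one, h'] at h
      have h0 : (y - x) ^ 2 ≤ y - x := by nlinarith
      calc _ ≤ (y - x) * (1 / d * ‖sob d v‖ ^ 2) := by
            apply mul_le_mul h0 h (sq_nonneg _) (by linarith)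
        _ = _ := by ring
    · simp
  · simp only [linInterp_natCast]
    exact nodeValue_sq_diff_le hd v hmn (by exact_mod_cast hn)

theorem spaceInterp_sq_diff_le {d : ℕ} (hd : 1 ≤ d) (v : ℕ → ℝ) (x y : unitInterval) :
    (spaceInterp d v y - spaceInterp d v x) ^ 2 ≤ 12 * (|(y : ℝ) - x| * ‖sob d v‖ ^ 2) := by
  have hd' : (0 : ℝ) < d := by positivity
  have main : ∀ x y : unitInterval, (x : ℝ) ≤ y →
      (spaceInterp d v y - spaceInterp d v x) ^ 2 ≤ 12 * (|(y : ℝ) - x| * ‖sob d v‖ ^ 2) := by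
    intro x y hxy
    have := linInterp_sq_diff_le hd v (x := d * x) (y := d * y) (mul_nonneg hd'.le x.2.1)
      (by gcongr) (by nlinarith [y.2.2])
    rw [abs_of_nonneg (by linarith)]
    refine this.trans (le_of_eq ?_)
    field_simp
  rcases le_total (x : ℝ) y with h | h
  · exact main x y h
  · rw [abs_sub_comm, ← neg_sub (spaceInterp d v x), neg_sq]
    exact main y x h

theorem abs_spaceInterp_le {d : ℕ} (hd : 1 ≤ d) (v : ℕ → ℝ) (x : unitInterval) :
    |spaceInterp d v x| ≤ 5 * ‖sob d v‖ := by
  have h := spaceInterp_sq_diff_le hd v 0 x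
  have h0 : spaceInterp d v 0 = v 1 := by
    have : (d : ℝ) * ((0 : unitInterval) : ℝ) = ((0 : ℕ) : ℝ) := by simp
    change linInterp (nodeValue v) ((d : ℝ) * ((0 : unitInterval) : ℝ)) = _
    rw [this, linInterp_natCast]; simp [nodeValue]
  have h1 := abs_one_le_sob hd v
  -- The Hölder bound over a distance at most `1` has constant `12 ≤ 4²`.
  have h2 : |spaceInterp d v x - spaceInterp d v 0| ≤ 4 * ‖sob d v‖ := by
    refine abs_le_of_sq_le_sq ?_ (by positivity)
    refine h.trans ?_
    have : |(x : ℝ) - ((0 : unitInterval) : ℝ)| ≤ 1 := by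
      rw [show ((0 : unitInterval) : ℝ) = 0 from rfl, sub_zero]
      rw [abs_of_nonneg x.2.1]; exact x.2.2
    nlinarith [sq_nonneg ‖sob d v‖]
  have := abs_sub_abs_le_abs_sub (spaceInterp d v x) (spaceInterp d v 0)
  rw [h0] at this h2
  linarith

theorem spaceInterp_sub (d : ℕ) (v w : ℕ → ℝ) :
    spaceInterp d v - spaceInterp d w = spaceInterp d (v - w) := by
  ext x
  simp only [ContinuousMap.sub_apply]
  change linInterp _ _ - linInterp _ _ = linInterp _ _
  simp only [linInterp, nodeValue, smul_eq_mul, Pi.sub_apply]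
  split_ifs <;> ring

theorem norm_spaceInterp_sub_le {d : ℕ} (hd : 1 ≤ d) (v w : ℕ → ℝ) :
    ‖spaceInterp d v - spaceInterp d w‖ ≤ 5 * ‖sob d v - sob d w‖ := by
  rw [spaceInterp_sub, ← map_sub]
  refine (ContinuousMap.norm_le _ (by positivity)).2 fun x => ?_
  exact abs_spaceInterp_le hd _ x

/-! ### Chaining along dyadic points -/

/-- Replace both points by their dyadic approximations from below at level `m`. These are equal or
adjacent, which costs `M q^m`, and the two geometric tails of refinements cost `M q^m / (1 - q)`
each. Continuity is used only to pass from the dyadic points to their limit. -/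
theorem dist_le_of_dyadic {E : Type*} [PseudoMetricSpace E] {f : ℝ → E}
    (hf : ContinuousOn f (Set.Icc 0 1)) {M q : ℝ} (hM : 0 ≤ M) (hq0 : 0 < q) (hq : q < 1)
    (h : ∀ n k : ℕ, k < 2 ^ n →
      dist (f ((k : ℝ) / 2 ^ n)) (f (((k : ℝ) + 1) / 2 ^ n)) ≤ M * q ^ n)
    {s s' : ℝ} (hs : s ∈ Set.Icc (0 : ℝ) 1) (hs' : s' ∈ Set.Icc (0 : ℝ) 1) {m : ℕ}
    (hss : |s - s'| ≤ 1 / 2 ^ m) :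
    dist (f s) (f s') ≤ (1 + 2 / (1 - q)) * M * q ^ m := by
  have hq1 : 0 < 1 - q := by linarith
  let a : ℝ → ℕ → ℝ := fun s n => (⌊(2 : ℝ) ^ n * s⌋₊ : ℝ) / 2 ^ n
  have ha_le : ∀ s : ℝ, 0 ≤ s → ∀ n, a s n ≤ s := fun s hs n => by
    simp only [a]
    rw [div_le_iff₀ (by positivity), mul_comm s]
    exact Nat.floor_le (by positivity)
  have ha_ge : ∀ s : ℝ, ∀ n, s - 1 / 2 ^ n ≤ a s n := fun s n => by
    have := Nat.lt_floor_add_one ((2 : ℝ) ^ n * s)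
    simp only [a]
    rw [le_div_iff₀ (by positivity), sub_mul, one_div, inv_mul_cancel₀ (by positivity), mul_comm s]
    linarith
  have ha_mem : ∀ s ∈ Set.Icc (0 : ℝ) 1, ∀ n, a s n ∈ Set.Icc (0 : ℝ) 1 := fun s hs n =>
    ⟨by simp only [a]; positivity, (ha_le s hs.1 n).trans hs.2⟩
  have ha_tend : ∀ s ∈ Set.Icc (0 : ℝ) 1, Tendsto (fun n => f (a s n)) atTop (𝓝 (f s)) := by
    intro s hs
    have h1 : Tendsto (a s) atTop (𝓝 s) := by
      refine tendsto_of_tendsto_of_tendsto_of_le_of_le (g := fun n : ℕ => s - 1 / 2 ^ n) ?_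
        tendsto_const_nhds (ha_ge s) (ha_le s hs.1)
      have : Tendsto (fun n : ℕ => (1 / 2 : ℝ) ^ n) atTop (𝓝 0) :=
        tendsto_pow_atTop_nhds_zero_of_lt_one (by norm_num) (by norm_num)
      simpa [one_div] using tendsto_const_nhds.sub this
    refine (hf s hs).tendsto.comp (tendsto_nhdsWithin_iff.2 ⟨h1, ?_⟩)
    exact Eventually.of_forall (ha_mem s hs)
  have step : ∀ s ∈ Set.Icc (0 : ℝ) 1, ∀ n,
      dist (f (a s n)) (f (a s (n + 1))) ≤ M * q ^ n := by
    intro s hs n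
    set k := ⌊(2 : ℝ) ^ n * s⌋₊ with hk
    set l := ⌊(2 : ℝ) ^ (n + 1) * s⌋₊ with hl
    have hk1 : (k : ℝ) ≤ 2 ^ n * s := Nat.floor_le (by have := hs.1; positivity)
    have hk2 := Nat.lt_floor_add_one ((2 : ℝ) ^ n * s)
    have hl1 : (l : ℝ) ≤ 2 ^ (n + 1) * s := Nat.floor_le (by have := hs.1; positivity)
    have hl2 := Nat.lt_floor_add_one ((2 : ℝ) ^ (n + 1) * s)
    rw [← hk] at hk2
    rw [← hl] at hl2
    rw [pow_succ] at hl1 hl2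
    have e1 : 2 * k < l + 1 := by
      have : (2 * k : ℝ) < l + 1 := by linarith
      exact_mod_cast this
    have e2 : l < 2 * k + 2 := by
      have : (l : ℝ) < 2 * k + 2 := by linarith
      exact_mod_cast this
    have hak : a s n = ((2 * k : ℕ) : ℝ) / 2 ^ (n + 1) := by
      simp only [a, ← hk]; push_cast; rw [pow_succ]; field_simp
    have hal : a s (n + 1) = (l : ℝ) / 2 ^ (n + 1) := rfl
    -- Refining by one level appends a binary digit: the point stays or moves by one cell of the
    -- finer level.
    obtain hlk | hlk : l = 2 * k ∨ l = 2 * k + 1 := by omega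
    · rw [hak, hal, hlk, dist_self]; positivity
    · have hlt : 2 * k < 2 ^ (n + 1) := by
        have h5 : (l : ℝ) ≤ 2 ^ (n + 1) := by
          rw [pow_succ]; nlinarith [hs.2, pow_pos (two_pos (α := ℝ)) n]
        have h6 : l ≤ 2 ^ (n + 1) := by exact_mod_cast h5
        omega
      have h7 := h (n + 1) (2 * k) hlt
      rw [hak, hal, hlk]
      push_cast at h7 ⊢
      refine h7.trans ?_
      rw [pow_succ]
      have := pow_pos hq0 n
      nlinarith [mul_nonneg hM this.le]
  have tail : ∀ s ∈ Set.Icc (0 : ℝ) 1, dist (f (a s m)) (f s) ≤ M * q ^ m / (1 - q) := by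
    intro s hs
    have := dist_le_of_le_geometric_of_tendsto₀ q (M * q ^ m) hq (f := fun n => f (a s (n + m)))
      (fun n => ?_) ((tendsto_add_atTop_iff_nat m).2 (ha_tend s hs))
    · simpa using this
    · have := step s hs (n + m)
      rw [show n + 1 + m = n + m + 1 by ring]
      refine this.trans (le_of_eq ?_)
      rw [pow_add]; ring
  have mid : ∀ s s' : ℝ, s ∈ Set.Icc (0 : ℝ) 1 → s' ∈ Set.Icc (0 : ℝ) 1 → s ≤ s' →
      s' - s ≤ 1 / 2 ^ m → dist (f (a s m)) (f (a s' m)) ≤ M * q ^ m := by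
    intro s s' hs hs' hle hd
    set k := ⌊(2 : ℝ) ^ m * s⌋₊ with hk
    set l := ⌊(2 : ℝ) ^ m * s'⌋₊ with hl
    have hp : (0 : ℝ) < 2 ^ m := by positivity
    have hkl : k ≤ l := Nat.floor_le_floor (by gcongr)
    have hk2 := Nat.lt_floor_add_one ((2 : ℝ) ^ m * s)
    have hl1 : (l : ℝ) ≤ 2 ^ m * s' := Nat.floor_le (by have := hs'.1; positivity)
    rw [← hk] at hk2
    have hd' : 2 ^ m * (s' - s) ≤ 1 := by
      rw [le_div_iff₀ hp] at hd; linarith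
    have e2 : l < k + 2 := by
      have : (l : ℝ) < k + 2 := by nlinarith
      exact_mod_cast this
    have hak : a s m = (k : ℝ) / 2 ^ m := rfl
    have hal : a s' m = (l : ℝ) / 2 ^ m := rfl
    obtain hlk | hlk : l = k ∨ l = k + 1 := by omega
    · rw [hak, hal, hlk, dist_self]; positivity
    · have hlt : k < 2 ^ m := by
        have h5 : (l : ℝ) ≤ 2 ^ m := by nlinarith [hs'.2]
        have h6 : l ≤ 2 ^ m := by exact_mod_cast h5
        omega
      have h7 := h m k hlt
      rw [hak, hal, hlk]
      push_cast
      exact h7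
  have hmid : dist (f (a s m)) (f (a s' m)) ≤ M * q ^ m := by
    rcases le_total s s' with hle | hle
    · refine mid s s' hs hs' hle ?_
      rwa [abs_sub_comm, abs_of_nonneg (by linarith)] at hss
    · rw [dist_comm]
      refine mid s' s hs' hs hle ?_
      rwa [abs_of_nonneg (by linarith)] at hss
  calc dist (f s) (f s') ≤ dist (f s) (f (a s m)) + dist (f (a s m)) (f (a s' m)) +
        dist (f (a s' m)) (f s') := dist_triangle4 _ _ _ _
    _ ≤ M * q ^ m / (1 - q) + M * q ^ m + M * q ^ m / (1 - q) := by
        gcongr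
        · rw [dist_comm]; exact tail s hs
        · exact tail s' hs'
    _ = _ := by field_simp; ring


/-! ### Compact sets of paths -/

theorem isCompact_of_equicontinuous {X β : Type*} [TopologicalSpace X] [CompactSpace X]
    [PseudoMetricSpace β] {s : Set β} (hs : IsCompact s) {S : Set C(X, β)} (hS : IsClosed S)
    (in_s : ∀ f ∈ S, ∀ x, f x ∈ s)
    (H : ∀ x : X, ∀ ε > 0, ∃ V ∈ 𝓝 x, ∀ y ∈ V, ∀ f ∈ S, dist (f x) (f y) < ε) : IsCompact S := by
  let e := ContinuousMap.isometryEquivBoundedOfCompact X β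
  have h1 : IsCompact (e.symm ⁻¹' S) := by
    refine BoundedContinuousFunction.arzela_ascoli₂ s hs _
      (hS.preimage e.symm.continuous) (fun f x hf => in_s _ hf x) ?_
    intro x
    rw [Metric.equicontinuousAt_iff_right]
    intro ε hε
    obtain ⟨V, hV, h⟩ := H x ε hε
    filter_upwards [hV] with y hy f
    exact h y hy _ f.2
  have h2 : e.symm '' (e.symm ⁻¹' S) = S := Set.image_preimage_eq _ e.symm.surjective
  rw [← h2]
  exact h1.image e.symm.continuous

/-- A ball of the space of `1/2`-Hölder functions. -/
def holderBall (a b : ℝ) : Set C(unitInterval, ℝ) :=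
  {f | (∀ x, |f x| ≤ a) ∧ ∀ x y, (f y - f x) ^ 2 ≤ b * |(y : ℝ) - x|}

theorem isCompact_holderBall (a b : ℝ) : IsCompact (holderBall a b) := by
  refine isCompact_of_equicontinuous (s := Set.Icc (-a) a) isCompact_Icc ?_
    (fun f hf x => abs_le.1 (hf.1 x)) ?_
  · have : holderBall a b = (⋂ x, {f | |f x| ≤ a}) ∩
        ⋂ x : unitInterval, ⋂ y : unitInterval,
          {f : C(unitInterval, ℝ) | (f y - f x) ^ 2 ≤ b * |(y : ℝ) - x|} := by
      ext f; simp only [holderBall, Set.mem_inter_iff, Set.mem_iInter, Set.mem_ofPred_eq]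
    rw [this]
    refine IsClosed.inter (isClosed_iInter fun x => ?_)
      (isClosed_iInter fun x => isClosed_iInter fun y => ?_)
    · exact isClosed_le (by fun_prop) continuous_const
    · exact isClosed_le (by fun_prop) continuous_const
  · intro x ε hε
    have hc : ContinuousAt (fun y : unitInterval => b * |(y : ℝ) - x|) x := by fun_prop
    refine ⟨{y | b * |(y : ℝ) - x| < ε ^ 2}, ?_, fun y hy f hf => ?_⟩
    · refine hc.eventually_lt_const ?_
      simpa using pow_pos hε 2
    · rw [dist_comm, Real.dist_eq]
      exact abs_lt_of_sq_lt_sq ((hf.2 x y).trans_lt hy) hε.le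

/-- The paths with values in a Hölder ball and with a prescribed dyadic modulus of continuity. -/
def pathBall (τ a b c q : ℝ) : Set (PathSpace τ) :=
  {y | (∀ s, y s ∈ holderBall a b) ∧ ∀ (m : ℕ) (s s' : Set.Icc (0 : ℝ) τ),
    |(s : ℝ) - s'| ≤ τ / 2 ^ m → ‖y s - y s'‖ ≤ c * q ^ m}

/-- Arzelà–Ascoli is applied twice: once in space, for the Hölder ball in which the paths take
values, and once in time, for the paths themselves. -/
theorem isCompact_pathBall {τ : ℝ} (hτ : 0 < τ) (a b c : ℝ) {q : ℝ} (hq0 : 0 ≤ q) (hq : q < 1) :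
    IsCompact (pathBall τ a b c q) := by
  refine isCompact_of_equicontinuous (isCompact_holderBall a b) ?_ (fun f hf x => hf.1 x) ?_
  · have : pathBall τ a b c q = (⋂ s, {y : PathSpace τ | y s ∈ holderBall a b}) ∩
        ⋂ m : ℕ, ⋂ s : Set.Icc (0 : ℝ) τ, ⋂ s' : Set.Icc (0 : ℝ) τ,
          ⋂ (_ : |(s : ℝ) - s'| ≤ τ / 2 ^ m), {y : PathSpace τ | ‖y s - y s'‖ ≤ c * q ^ m} := by
      ext f; simp only [pathBall, Set.mem_inter_iff, Set.mem_iInter, Set.mem_ofPred_eq]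
    rw [this]
    refine IsClosed.inter (isClosed_iInter fun s => ?_) ?_
    · exact (isCompact_holderBall a b).isClosed.preimage (continuous_eval_const s)
    · refine isClosed_iInter fun m => isClosed_iInter fun s => isClosed_iInter fun s' =>
        isClosed_iInter fun _ => isClosed_le (Continuous.norm ?_) continuous_const
      exact (continuous_eval_const s).sub (continuous_eval_const s')
  · intro x ε hε
    have h1 : Tendsto (fun m : ℕ => c * q ^ m) atTop (𝓝 0) := by
      simpa using (tendsto_pow_atTop_nhds_zero_of_lt_one hq0 hq).const_mul c
    obtain ⟨m, hm⟩ := (h1.eventually_lt_const hε).exists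
    refine ⟨{y | |(x : ℝ) - y| < τ / 2 ^ m}, ?_, fun y hy f hf => ?_⟩
    · have hc : ContinuousAt (fun y : Set.Icc (0 : ℝ) τ => |(x : ℝ) - y|) x := by fun_prop
      refine hc.eventually_lt_const ?_
      simp only [sub_self, abs_zero]
      positivity
    · rw [dist_eq_norm]
      exact (hf.2 m x y (le_of_lt hy)).trans_lt hm

/-! ### Probabilistic chaining -/

section Chaining

variable {Ω : Type*} [MeasurableSpace Ω] {P : Measure Ω} [IsProbabilityMeasure P]

theorem measure_gt_le_of_integral_le {f : Ω → ℝ} (hf0 : ∀ ω, 0 ≤ f ω) (hf : Integrable f P)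
    {K c : ℝ} (hK : ∫ ω, f ω ∂P ≤ K) (hc : 0 < c) :
    P {ω | c < f ω} ≤ ENNReal.ofReal (K / c) := by
  have h := mul_meas_ge_le_integral_of_nonneg (Eventually.of_forall hf0) hf c
  have h1 : P.real {ω | c ≤ f ω} ≤ K / c := by
    rw [le_div_iff₀ hc, mul_comm]; exact h.trans hK
  calc P {ω | c < f ω} ≤ P {ω | c ≤ f ω} := measure_mono fun ω (hω : c < f ω) => hω.le
    _ = ENNReal.ofReal (P.real {ω | c ≤ f ω}) := by simp
    _ ≤ _ := ENNReal.ofReal_le_ofReal h1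

/-- Kolmogorov's criterion. Markov's inequality and a union bound over the `2^n` dyadic cells of
level `n` give probability at most `K r^n / M⁴`, which is summed over the levels. -/
theorem measure_not_dyadic_le {E : Type*} [SeminormedAddCommGroup E] {X : ℝ → Ω → E} {K : ℝ}
    (hK : 0 ≤ K)
    (h0 : Integrable (fun ω => ‖X 0 ω‖ ^ 4) P) (h0' : ∫ ω, ‖X 0 ω‖ ^ 4 ∂P ≤ K)
    (h : ∀ s ∈ Set.Icc (0 : ℝ) 1, ∀ s' ∈ Set.Icc (0 : ℝ) 1,
      Integrable (fun ω => ‖X s ω - X s' ω‖ ^ 4) P ∧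
        ∫ ω, ‖X s ω - X s' ω‖ ^ 4 ∂P ≤ K * |s - s'| ^ 2)
    {M : ℝ} (hM : 0 < M) :
    P {ω | ¬ (‖X 0 ω‖ ≤ M ∧ ∀ n k : ℕ, k < 2 ^ n →
      dist (X ((k : ℝ) / 2 ^ n) ω) (X (((k : ℝ) + 1) / 2 ^ n) ω) ≤ M * (9 / 10) ^ n)} ≤
      ENNReal.ofReal (6 * K / M ^ 4) := by
  let c : ℕ → ℝ := fun n => (M * (9 / 10) ^ n) ^ 4
  -- The ratio `2^n · 4^{-n} / (9/10)^{4n} = r^n`; any base above `2^{-1/4}` makes it summable. Here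
  -- `1 / (1 - r) ≤ 5`, and the starting point contributes the sixth unit of the bound.
  let r : ℝ := 1 / (2 * (9 / 10) ^ 4)
  have hr : r < 1 := by norm_num [r]
  have hr0 : 0 ≤ r := by norm_num [r]
  have hc : ∀ n, 0 < c n := fun n => by positivity
  have hsub : {ω | ¬ (‖X 0 ω‖ ≤ M ∧ ∀ n k : ℕ, k < 2 ^ n →
      dist (X ((k : ℝ) / 2 ^ n) ω) (X (((k : ℝ) + 1) / 2 ^ n) ω) ≤ M * (9 / 10) ^ n)} ⊆
      {ω | M ^ 4 < ‖X 0 ω‖ ^ 4} ∪ ⋃ n : ℕ, ⋃ k ∈ Finset.range (2 ^ n),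
        {ω | c n < ‖X ((k : ℝ) / 2 ^ n) ω - X (((k : ℝ) + 1) / 2 ^ n) ω‖ ^ 4} := by
    intro ω hω
    simp only [Set.mem_ofPred_eq, not_and_or, not_forall, not_le] at hω
    rcases hω with hω | ⟨n, k, hk, hω⟩
    · exact Or.inl (pow_lt_pow_left₀ hω hM.le (by norm_num))
    · refine Or.inr (Set.mem_iUnion.2 ⟨n, Set.mem_iUnion₂.2 ⟨k, Finset.mem_range.2 hk, ?_⟩⟩)
      rw [dist_eq_norm] at hω
      exact pow_lt_pow_left₀ hω (by positivity) (by norm_num)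
  have hone : ∀ n k : ℕ, k ∈ Finset.range (2 ^ n) →
      P {ω | c n < ‖X ((k : ℝ) / 2 ^ n) ω - X (((k : ℝ) + 1) / 2 ^ n) ω‖ ^ 4} ≤
        ENNReal.ofReal (K * (1 / 2 ^ n) ^ 2 / c n) := by
    intro n k hk
    have hk' : (k : ℝ) + 1 ≤ 2 ^ n := by exact_mod_cast Finset.mem_range.1 hk
    have hp : (0 : ℝ) < 2 ^ n := by positivity
    obtain ⟨i1, i2⟩ := h ((k : ℝ) / 2 ^ n)
      ⟨by positivity, by rw [div_le_one hp]; linarith⟩ (((k : ℝ) + 1) / 2 ^ n)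
      ⟨by positivity, by rw [div_le_one hp]; linarith⟩
    refine measure_gt_le_of_integral_le (fun ω => by positivity) i1 (i2.trans (le_of_eq ?_)) (hc n)
    congr 2
    rw [← sub_div, show (k : ℝ) - (k + 1) = -1 by ring, neg_div, abs_neg, abs_of_pos (by positivity)]
  have hlevel : ∀ n : ℕ, P (⋃ k ∈ Finset.range (2 ^ n),
        {ω | c n < ‖X ((k : ℝ) / 2 ^ n) ω - X (((k : ℝ) + 1) / 2 ^ n) ω‖ ^ 4}) ≤
        ENNReal.ofReal (K / M ^ 4 * r ^ n) := by
    intro n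
    refine (measure_biUnion_finset_le _ _).trans ((Finset.sum_le_sum (hone n)).trans ?_)
    rw [Finset.sum_const, Finset.card_range, nsmul_eq_mul]
    have : ((2 ^ n : ℕ) : ENNReal) = ENNReal.ofReal (2 ^ n) := by
      rw [ENNReal.ofReal_pow (by norm_num)]; simp
    rw [this, ← ENNReal.ofReal_mul (by positivity)]
    refine ENNReal.ofReal_le_ofReal (le_of_eq ?_)
    simp only [c, r]
    have : ((9 / 10 : ℝ) ^ n) ^ 4 = ((9 / 10 : ℝ) ^ 4) ^ n := by rw [← pow_mul, ← pow_mul, mul_comm]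
    rw [mul_pow, this, one_div_pow, one_div_pow, mul_pow]
    field_simp
  refine (measure_mono hsub).trans ((measure_union_le _ _).trans ?_)
  have h1 := measure_gt_le_of_integral_le (fun ω => by positivity) h0 h0' (pow_pos hM 4)
  have h2 : P (⋃ n : ℕ, ⋃ k ∈ Finset.range (2 ^ n),
        {ω | c n < ‖X ((k : ℝ) / 2 ^ n) ω - X (((k : ℝ) + 1) / 2 ^ n) ω‖ ^ 4}) ≤
        ENNReal.ofReal (5 * K / M ^ 4) := by
    refine (measure_iUnion_le _).trans ((ENNReal.tsum_le_tsum hlevel).trans ?_)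
    rw [← ENNReal.ofReal_tsum_of_nonneg (fun n => by positivity)
      ((summable_geometric_of_lt_one hr0 hr).mul_left _), tsum_mul_left,
      tsum_geometric_of_lt_one hr0 hr]
    refine ENNReal.ofReal_le_ofReal ?_
    have : (1 - r)⁻¹ ≤ 5 := by norm_num [r]
    calc K / M ^ 4 * (1 - r)⁻¹ ≤ K / M ^ 4 * 5 := by gcongr
      _ = _ := by ring
  calc _ ≤ ENNReal.ofReal (K / M ^ 4) + ENNReal.ofReal (5 * K / M ^ 4) := add_le_add h1 h2
    _ = _ := by
      rw [← ENNReal.ofReal_add (by positivity) (by positivity)]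
      congr 1; ring

omit [IsProbabilityMeasure P] in
theorem isTightMeasureSet_range_map_iff {ι S : Type*} [TopologicalSpace S] [T2Space S]
    [MeasurableSpace S] [OpensMeasurableSpace S] {X : ι → Ω → S} (hX : ∀ i, Measurable (X i)) :
    IsTightMeasureSet (Set.range fun i => P.map (X i)) ↔
      ∀ ε : ENNReal, 0 < ε → ∃ K : Set S, IsCompact K ∧ ∀ i, P {ω | X i ω ∉ K} ≤ ε := by
  rw [isTightMeasureSet_iff_exists_isCompact_measure_compl_le]
  refine forall₂_congr fun ε _ => exists_congr fun K => and_congr_right fun hK => ?_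
  rw [Set.forall_mem_range]
  refine forall_congr' fun i => ?_
  rw [Measure.map_apply (hX i) hK.measurableSet.compl]
  rfl

theorem isTightFamily_of_sob_moments {ι : Type*} {τ : ℝ} (hτ : 0 < τ) {Y : ι → Ω → PathSpace τ}
    (hY : ∀ i, Measurable (Y i)) {d : ι → ℕ} (hd : ∀ i, 1 ≤ d i) {v : ι → ℝ → Ω → ℕ → ℝ}
    (hYv : ∀ i ω (s : Set.Icc (0 : ℝ) τ), Y i ω s = spaceInterp (d i) (v i s ω))
    (hv : ∀ i ω, Continuous fun s => sob (d i) (v i s ω)) {K : ℝ} (hK : 0 ≤ K)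
    (h0 : ∀ i, Integrable (fun ω => ‖sob (d i) (v i 0 ω)‖ ^ 4) P ∧
      ∫ ω, ‖sob (d i) (v i 0 ω)‖ ^ 4 ∂P ≤ K)
    (h : ∀ i, ∀ s ∈ Set.Icc (0 : ℝ) τ, ∀ s' ∈ Set.Icc (0 : ℝ) τ,
      Integrable (fun ω => ‖sob (d i) (v i s ω) - sob (d i) (v i s' ω)‖ ^ 4) P ∧
        ∫ ω, ‖sob (d i) (v i s ω) - sob (d i) (v i s' ω)‖ ^ 4 ∂P ≤ K * |s - s'| ^ 2) :
    IsTightFamily P Y := by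
  refine ⟨hY, (isTightMeasureSet_range_map_iff hY).2 fun ε hε => ?_⟩
  -- Rescaling time to `[0, 1]` multiplies the increment bound by `τ²`; the summand `1` keeps the
  -- bound at time `0`.
  set K' := K * (1 + τ ^ 2) with hK'
  have hK'0 : 0 ≤ K' := by positivity
  have hlim : Tendsto (fun M : ℝ => ENNReal.ofReal (6 * K' / M ^ 4)) atTop (𝓝 0) := by
    have h1 : Tendsto (fun M : ℝ => 6 * K' / M ^ 4) atTop (𝓝 0) :=
      tendsto_const_nhds.div_atTop (tendsto_pow_atTop (by norm_num))
    simpa using ENNReal.tendsto_ofReal h1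
  obtain ⟨M, hMε, hM⟩ := ((hlim.eventually_lt_const hε).and (eventually_gt_atTop 0)).exists
  -- With `q = 9/10` the chaining constant is `1 + 2 / (1 - q) = 21`, so the Sobolev norm stays
  -- below `M + 21 M = 22 M`. The factors `5` and `12` convert Sobolev bounds into uniform and
  -- Hölder bounds.
  refine ⟨pathBall τ (110 * M) (12 * (22 * M) ^ 2) (105 * M) (9 / 10),
    isCompact_pathBall hτ _ _ _ (by norm_num) (by norm_num), fun i => ?_⟩
  have key := measure_not_dyadic_le (P := P) (X := fun r ω => sob (d i) (v i (τ * r) ω)) hK'0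
    (by simpa using (h0 i).1) (by
      refine le_trans (by simpa using (h0 i).2) ?_
      rw [hK']; nlinarith [sq_nonneg τ, mul_nonneg hK (sq_nonneg τ)])
    (fun s hs s' hs' => by
      obtain ⟨i1, i2⟩ := h i (τ * s) ⟨mul_nonneg hτ.le hs.1, by nlinarith [hs.2]⟩ (τ * s')
        ⟨mul_nonneg hτ.le hs'.1, by nlinarith [hs'.2]⟩
      refine ⟨i1, i2.trans ?_⟩
      rw [← mul_sub, abs_mul, abs_of_pos hτ, hK']
      have : 0 ≤ K * |s - s'| ^ 2 := by positivity
      nlinarith) hM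
  refine (measure_mono ?_).trans (key.trans hMε.le)
  intro ω hω
  by_contra hcon
  simp only [Set.mem_ofPred_eq, not_not] at hcon
  refine hω ?_
  obtain ⟨hg0, hg⟩ := hcon
  simp only [mul_zero] at hg0
  have hcont : ContinuousOn (fun r => sob (d i) (v i (τ * r) ω)) (Set.Icc 0 1) :=
    ((hv i ω).comp (continuous_const.mul continuous_id)).continuousOn
  have hmod : ∀ (m : ℕ) (s s' : Set.Icc (0 : ℝ) τ), |(s : ℝ) - s'| ≤ τ / 2 ^ m →
      dist (sob (d i) (v i s ω)) (sob (d i) (v i s' ω)) ≤ 21 * M * (9 / 10) ^ m := by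
    intro m s s' hss
    have hmem : ∀ s : Set.Icc (0 : ℝ) τ, (s : ℝ) / τ ∈ Set.Icc (0 : ℝ) 1 := fun s =>
      ⟨div_nonneg s.2.1 hτ.le, (div_le_one hτ).2 s.2.2⟩
    have := dist_le_of_dyadic hcont hM.le (by norm_num) (by norm_num) hg (hmem s) (hmem s') (m := m)
      (by
        rw [← sub_div, abs_div, abs_of_pos hτ, div_le_iff₀ hτ]
        refine hss.trans (le_of_eq ?_); ring)
    simp only [mul_div_cancel₀ _ hτ.ne'] at this
    refine this.trans (le_of_eq ?_)
    norm_num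
  have hnorm : ∀ s : Set.Icc (0 : ℝ) τ, ‖sob (d i) (v i s ω)‖ ≤ 22 * M := by
    intro s
    have h1 := hmod 0 s ⟨0, le_rfl, hτ.le⟩ (by
      simp only [sub_zero, pow_zero, div_one]
      rw [abs_of_nonneg s.2.1]; exact s.2.2)
    rw [dist_eq_norm] at h1
    have h2 := norm_le_norm_add_norm_sub' (sob (d i) (v i s ω)) (sob (d i) (v i 0 ω))
    simp only [pow_zero, mul_one] at h1
    linarith
  refine ⟨fun s => ⟨fun x => ?_, fun x y => ?_⟩, fun m s s' hss => ?_⟩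
  · rw [hYv]
    have := abs_spaceInterp_le (hd i) (v i s ω) x
    linarith [hnorm s]
  · rw [hYv]
    refine (spaceInterp_sq_diff_le (hd i) (v i s ω) x y).trans ?_
    have : ‖sob (d i) (v i s ω)‖ ^ 2 ≤ (22 * M) ^ 2 := by gcongr; exact hnorm s
    nlinarith [abs_nonneg ((y : ℝ) - x)]
  · rw [hYv, hYv]
    refine (norm_spaceInterp_sub_le (hd i) _ _).trans ?_
    have := hmod m s s' hss
    rw [dist_eq_norm] at this
    linarith

end Chaining

/-! ### Weak subsequential limits -/

/-- Prokhorov's theorem: tightness makes the closure of the set of laws compact, and compactness is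
turned into convergence of a subsequence. -/
theorem hasWeakSubsequentialLimits_of_isTightFamily {Ω ι S : Type*} [MeasurableSpace Ω]
    {P : Measure Ω} [IsProbabilityMeasure P] [TopologicalSpace S] [TopologicalSpace.MetrizableSpace S]
    [TopologicalSpace.SeparableSpace S] [MeasurableSpace S] [BorelSpace S] {X : ι → Ω → S} (h : IsTightFamily P X) :
    HasWeakSubsequentialLimits P X := by
  let _ := TopologicalSpace.metrizableSpaceMetric S
  intro p
  obtain ⟨hX, ht⟩ := h
  let μ : ι → ProbabilityMeasure S := fun i =>
    ⟨P.map (X i), Measure.isProbabilityMeasure_map (hX i).aemeasurable⟩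
  have hc : IsCompact (closure (Set.range μ)) := by
    refine isCompact_closure_of_isTightMeasureSet ?_
    convert ht using 1
    ext ν
    constructor
    · rintro ⟨_, ⟨i, rfl⟩, rfl⟩
      exact ⟨i, rfl⟩
    · rintro ⟨i, rfl⟩
      exact ⟨μ i, ⟨i, rfl⟩, rfl⟩
  obtain ⟨ν, -, φ, hφ, hlim⟩ := hc.tendsto_subseq (x := fun n => μ (p n))
    fun n => subset_closure ⟨p n, rfl⟩
  refine ⟨φ, hφ, ν, ⟨fun k => (hX _).aemeasurable, aemeasurable_id, ?_⟩⟩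
  have hν : (⟨(ν : Measure S).map id, Measure.isProbabilityMeasure_map aemeasurable_id⟩ :
      ProbabilityMeasure S) = ν := Subtype.ext (Measure.map_id (μ := (ν : Measure S)))
  rw [hν]
  exact hlim

/-! ### Deterministic perturbations -/

open scoped Pointwise in
theorem IsTightFamily.add_const {Ω ι S : Type*} [MeasurableSpace Ω] {P : Measure Ω}
    [IsProbabilityMeasure P] [AddCommGroup S] [TopologicalSpace S] [IsTopologicalAddGroup S] [T2Space S]
    [SecondCountableTopology S] [MeasurableSpace S] [BorelSpace S] {X : ι → Ω → S} (h : IsTightFamily P X) {z : ι → S} {K : Set S}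
    (hK : IsCompact K) (hz : ∀ i, z i ∈ K) : IsTightFamily P fun i ω => X i ω + z i := by
  have hm : ∀ i, Measurable fun ω => X i ω + z i := fun i => (h.1 i).add_const _
  refine ⟨hm, (isTightMeasureSet_range_map_iff hm).2 fun ε hε => ?_⟩
  obtain ⟨K', hK', h'⟩ := (isTightMeasureSet_range_map_iff h.1).1 h.2 ε hε
  refine ⟨K' + K, hK'.add hK, fun i => (measure_mono ?_).trans (h' i)⟩
  exact fun ω hω hω' => hω (Set.add_mem_add hω' (hz i))

open scoped Pointwise in
-- Two exceptional events of probability at most `1/3` cannot cover `Ω`. Some `ω` therefore places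
-- `X i ω` and `Y i ω` in their compact sets at once, and the deterministic difference lies in the
-- difference set. This turns tightness of `U` into a statement about `Θ` alone.
theorem IsTightFamily.exists_isCompact_sub {Ω ι S : Type*} [MeasurableSpace Ω] {P : Measure Ω}
    [IsProbabilityMeasure P] [AddCommGroup S] [TopologicalSpace S] [IsTopologicalAddGroup S] [T2Space S]
    [SecondCountableTopology S] [MeasurableSpace S] [BorelSpace S] {X Y : ι → Ω → S} (hX : IsTightFamily P X) (hY : IsTightFamily P Y)
    {z : ι → S} (hz : ∀ i ω, Y i ω = X i ω + z i) : ∃ K : Set S, IsCompact K ∧ ∀ i, z i ∈ K := by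
  obtain ⟨K₁, hK₁, h₁⟩ := (isTightMeasureSet_range_map_iff hX.1).1 hX.2 (1 / 3) (by norm_num)
  obtain ⟨K₂, hK₂, h₂⟩ := (isTightMeasureSet_range_map_iff hY.1).1 hY.2 (1 / 3) (by norm_num)
  refine ⟨K₂ + -K₁, hK₂.add hK₁.neg, fun i => ?_⟩
  by_contra hi
  have huniv : (Set.univ : Set Ω) ⊆ {ω | X i ω ∉ K₁} ∪ {ω | Y i ω ∉ K₂} := by
    intro ω _
    by_contra hω
    simp only [Set.mem_union, Set.mem_ofPred_eq, not_or, not_not] at hω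
    refine hi ?_
    have := Set.add_mem_add hω.2 (Set.neg_mem_neg.2 hω.1)
    rwa [hz, show X i ω + z i + -X i ω = z i by abel] at this
  have h3 : (1 : ENNReal) ≤ 1 / 3 + 1 / 3 := by
    calc (1 : ENNReal) = P Set.univ := measure_univ.symm
      _ ≤ _ := measure_mono huniv
      _ ≤ _ := measure_union_le _ _
      _ ≤ _ := add_le_add (h₁ i) (h₂ i)
  have h4 : (1 / 3 + 1 / 3 : ENNReal) = ENNReal.ofReal (2 / 3) := by
    rw [show (2 / 3 : ℝ) = 1 / 3 + 1 / 3 by norm_num, ENNReal.ofReal_add (by norm_num) (by norm_num),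
      ENNReal.ofReal_div_of_pos (by norm_num)]
    simp
  rw [h4, ← ENNReal.ofReal_one, ENNReal.ofReal_le_ofReal_iff (by norm_num)] at h3
  norm_num at h3

/-- Multiples of a sequence of vectors that are small uniformly for large indices and have bounded
coefficients for each index stay in a compact set. -/
theorem exists_isCompact_of_smul {ι F : Type*} [NormedAddCommGroup F] [NormedSpace ℝ F]
    [CompleteSpace F] {c : ι → ℝ} {n : ι → ℕ} {b : ℕ → ℝ} {g : ℕ → F}
    (hc : ∀ i, |c i| ≤ b (n i))
    (hsmall : ∀ ε > 0, ∃ N : ℕ, ∀ i, N ≤ n i → ‖c i • g (n i)‖ ≤ ε) :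
    ∃ K : Set F, IsCompact K ∧ ∀ i, c i • g (n i) ∈ K := by
  refine ⟨closure (Set.range fun i => c i • g (n i)), ?_, fun i => subset_closure ⟨i, rfl⟩⟩
  refine TotallyBounded.isCompact_of_isClosed (TotallyBounded.closure ?_) isClosed_closure
  rw [Metric.totallyBounded_iff]
  intro ε hε
  obtain ⟨N, hN⟩ := hsmall (ε / 2) (by positivity)
  -- Infinitely many indices may share one value of `n`, but for `n < N` the vectors lie on finitely
  -- many compact segments. All remaining vectors are within `ε / 2` of `0`.
  have hcomp : IsCompact ({0} ∪ ⋃ k ∈ Finset.range N,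
      (fun r : ℝ => r • g k) '' Set.Icc (-(b k)) (b k)) := by
    refine isCompact_singleton.union ((Finset.range N).isCompact_biUnion fun k _ => ?_)
    exact isCompact_Icc.image (by fun_prop)
  obtain ⟨t, ht, hcov⟩ := Metric.totallyBounded_iff.1 hcomp.totallyBounded (ε / 2) (by positivity)
  refine ⟨t, ht, ?_⟩
  rintro _ ⟨i, rfl⟩
  by_cases hi : N ≤ n i
  · obtain ⟨y, hy, h0⟩ := Set.mem_iUnion₂.1 (hcov (Or.inl rfl : (0 : F) ∈ _))
    refine Set.mem_iUnion₂.2 ⟨y, hy, ?_⟩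
    rw [Metric.mem_ball] at h0 ⊢
    calc dist (c i • g (n i)) y ≤ dist (c i • g (n i)) 0 + dist 0 y := dist_triangle _ _ _
      _ < ε / 2 + ε / 2 := by
        refine add_lt_add_of_le_of_lt ?_ h0
        rw [dist_zero_right]; exact hN i hi
      _ = ε := by ring
  · have : c i • g (n i) ∈ ({0} ∪ ⋃ k ∈ Finset.range N,
      (fun r : ℝ => r • g k) '' Set.Icc (-(b k)) (b k)) :=
      Or.inr (Set.mem_iUnion₂.2 ⟨n i, Finset.mem_range.2 (not_le.1 hi), c i, abs_le.1 (hc i), rfl⟩)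
    obtain ⟨y, hy, h0⟩ := Set.mem_iUnion₂.1 (hcov this)
    exact Set.mem_iUnion₂.2 ⟨y, hy, Metric.ball_subset_ball (by linarith) h0⟩


/-! ### Grid points -/

theorem coe_gridPoint {d i : ℕ} (hd : 1 ≤ d) (hi : i ≤ d) : (gridPoint d i : ℝ) = (i : ℝ) / d := by
  have hd' : (0 : ℝ) < d := by positivity
  have : (i : ℝ) / d ∈ Set.Icc (0 : ℝ) 1 :=
    ⟨by positivity, by rw [div_le_one hd']; exact_mod_cast hi⟩
  rw [gridPoint, Set.projIcc_of_mem zero_le_one this]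

theorem abs_gridPoint_sub {d i : ℕ} (hd : 1 ≤ d) (hi : i + 1 ≤ d) :
    |(gridPoint d (i + 1) : ℝ) - gridPoint d i| = 1 / d := by
  rw [coe_gridPoint hd hi, coe_gridPoint hd (by omega), ← sub_div]
  push_cast
  rw [show (i : ℝ) + 1 - i = 1 by ring, abs_of_nonneg (by positivity)]

theorem abs_disc_le {d : ℕ} (hd : 1 ≤ d) {f : unitInterval → ℝ} {K : ℝ} (h0 : ∀ x, |f x| ≤ K)
    (h1 : ∀ x y, |f x - f y| ≤ K * |(x : ℝ) - y|) {i : ℕ} (hi : i ∈ Finset.Icc 1 d) :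
    |disc d (fun j => f (gridPoint d j)) i| ≤ K := by
  have hd' : (0 : ℝ) < d := by positivity
  rw [Finset.mem_Icc] at hi
  obtain ⟨i, rfl⟩ : ∃ k, i = k + 1 := ⟨i - 1, by omega⟩
  rcases Nat.eq_zero_or_pos i with rfl | h
  · rw [disc_one]; exact h0 _
  · rw [disc_succ _ _ h, abs_mul, abs_of_pos hd']
    have := h1 (gridPoint d (i + 1)) (gridPoint d i)
    rw [abs_gridPoint_sub hd hi.2] at this
    calc _ ≤ (d : ℝ) * (K * (1 / d)) := by gcongr
      _ = K := by field_simp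

/-! ### Riemann sums -/

theorem integrable_of_continuous_unitInterval {f : unitInterval → ℝ} (hf : Continuous f) :
    Integrable f := hf.integrable_of_hasCompactSupport (HasCompactSupport.of_compactSpace f)

theorem abs_integral_unitInterval_le {f : unitInterval → ℝ} {C : ℝ} (h : ∀ x, |f x| ≤ C) :
    |∫ x, f x| ≤ C := by
  have := norm_integral_le_of_norm_le_const (μ := (volume : Measure unitInterval)) (f := f) (C := C)
    (Eventually.of_forall h)
  simpa using this

theorem continuous_of_lipschitz {f : unitInterval → ℝ} {K : ℝ}
    (h : ∀ x y, |f x - f y| ≤ K * |(x : ℝ) - y|) : Continuous f := by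
  refine (LipschitzWith.of_dist_le_mul (K := K.toNNReal) fun x y => ?_).continuous
  rw [Real.dist_eq, Subtype.dist_eq, Real.dist_eq]
  exact (h x y).trans (mul_le_mul_of_nonneg_right (Real.le_coe_toNNReal K) (abs_nonneg _))

theorem abs_integral_sub_riemann_le {d : ℕ} (hd : 1 ≤ d) {f : unitInterval → ℝ} {K : ℝ}
    (h : ∀ x y, |f x - f y| ≤ K * |(x : ℝ) - y|) :
    |(∫ x, f x) - (1 / (d : ℝ)) * ∑ j ∈ Finset.Icc 1 d, f (gridPoint d j)| ≤ K / d := by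
  have hd' : (0 : ℝ) < d := by positivity
  have hK : 0 ≤ K := by
    have := (abs_nonneg _).trans (h 1 0)
    simpa using this
  let F : ℝ → ℝ := Set.IccExtend (zero_le_one (α := ℝ)) f
  have hF : Continuous F := (continuous_of_lipschitz h).Icc_extend'
  have hFint : ∀ a b : ℝ, IntervalIntegrable F volume a b := fun a b => hF.intervalIntegrable a b
  have e1 : ∫ x, f x = ∫ x in (0 : ℝ)..1, F x := by
    rw [intervalIntegral.integral_of_le zero_le_one, ← integral_Icc_eq_integral_Ioc,
      ← integral_subtype measurableSet_Icc]
    refine integral_congr_ae (Eventually.of_forall fun x => ?_)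
    exact (Set.IccExtend_val zero_le_one f x).symm
  have e2 : ∫ x in (0 : ℝ)..1, F x =
      ∑ k ∈ Finset.range d, ∫ x in ((k : ℝ) / d)..((k + 1 : ℕ) : ℝ) / d, F x := by
    rw [intervalIntegral.sum_integral_adjacent_intervals (a := fun k : ℕ => (k : ℝ) / d)
      fun k _ => hFint _ _]
    simp [hd'.ne']
  have e3 : (1 / (d : ℝ)) * ∑ j ∈ Finset.Icc 1 d, f (gridPoint d j) =
      ∑ k ∈ Finset.range d, ∫ _ in ((k : ℝ) / d)..((k + 1 : ℕ) : ℝ) / d, f (gridPoint d (k + 1)) := by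
    rw [Finset.mul_sum, ← Finset.Ico_add_one_right_eq_Icc, Finset.sum_Ico_eq_sum_range]
    simp only [Nat.add_sub_cancel]
    refine Finset.sum_congr rfl fun k _ => ?_
    rw [intervalIntegral.integral_const, smul_eq_mul, add_comm 1 k]
    push_cast
    ring
  rw [e1, e2, e3, ← Finset.sum_sub_distrib]
  refine (Finset.abs_sum_le_sum_abs _ _).trans ?_
  have hterm : ∀ k ∈ Finset.range d,
      |(∫ x in ((k : ℝ) / d)..((k + 1 : ℕ) : ℝ) / d, F x) -
        ∫ _ in ((k : ℝ) / d)..((k + 1 : ℕ) : ℝ) / d, f (gridPoint d (k + 1))| ≤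
      K / d * (1 / d) := by
    intro k hk
    have hk' : k + 1 ≤ d := Finset.mem_range.1 hk
    have hkd : ((k + 1 : ℕ) : ℝ) / d ≤ 1 := by rw [div_le_one hd']; exact_mod_cast hk'
    have hle : (k : ℝ) / d ≤ ((k + 1 : ℕ) : ℝ) / d := by gcongr; simp
    have hlen : ((k + 1 : ℕ) : ℝ) / d - (k : ℝ) / d = 1 / d := by push_cast; ring
    rw [← intervalIntegral.integral_sub (hFint _ _) (by simp)]
    have := intervalIntegral.norm_integral_le_of_norm_le_const (a := (k : ℝ) / d)
      (b := ((k + 1 : ℕ) : ℝ) / d) (f := fun x => F x - f (gridPoint d (k + 1))) (C := K / d) ?_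
    · rw [hlen, abs_of_nonneg (by positivity : (0 : ℝ) ≤ 1 / d)] at this
      exact this
    · intro x hx
      rw [Set.uIoc_of_le hle] at hx
      have hx01 : x ∈ Set.Icc (0 : ℝ) 1 := ⟨le_trans (by positivity) hx.1.le, hx.2.trans hkd⟩
      rw [Real.norm_eq_abs]
      simp only [F]
      rw [Set.IccExtend_of_mem _ _ hx01]
      refine (h _ _).trans ?_
      rw [coe_gridPoint hd hk', div_eq_mul_one_div K]
      gcongr
      rw [abs_le]
      constructor <;> linarith [hx.1, hx.2]
  refine (Finset.sum_le_sum hterm).trans (le_of_eq ?_)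
  rw [Finset.sum_const, Finset.card_range, nsmul_eq_mul]
  field_simp

/-! ### Smooth covariance kernels -/

/-- A symmetric, bounded and Lipschitz kernel with bounded mixed second differences and
continuously differentiable sections. -/
structure IsSmoothKernel (A : unitInterval → unitInterval → ℝ) (K : ℝ) : Prop where
  symm : ∀ x y, A x y = A y x
  bound : ∀ x y, |A x y| ≤ K
  lip : ∀ x y z, |A x z - A y z| ≤ K * |(x : ℝ) - y|
  mixed : ∀ x x' y y', |A x y - A x' y - (A x y' - A x' y')| ≤
    K * |(x : ℝ) - x'| * |(y : ℝ) - y'|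
  contDiff : ∀ x, ContDiffOn ℝ 1 (Set.IccExtend (zero_le_one (α := ℝ)) (A x)) (Set.Icc 0 1)

section Kernel

variable {A : unitInterval → unitInterval → ℝ} {K : ℝ}

theorem IsSmoothKernel.nonneg (hA : IsSmoothKernel A K) : 0 ≤ K :=
  (abs_nonneg _).trans (hA.bound 0 0)

theorem IsSmoothKernel.lip_right (hA : IsSmoothKernel A K) (x y z : unitInterval) :
    |A z x - A z y| ≤ K * |(x : ℝ) - y| := by
  rw [hA.symm z x, hA.symm z y]; exact hA.lip x y z

theorem IsSmoothKernel.continuous (hA : IsSmoothKernel A K) (x : unitInterval) :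
    Continuous (A x) := continuous_of_lipschitz fun y z => hA.lip_right y z x

theorem IsSmoothKernel.abs_disc_le (hA : IsSmoothKernel A K) {d : ℕ} (hd : 1 ≤ d) {i : ℕ}
    (hi : i ∈ Finset.Icc 1 d) (y : unitInterval) :
    |disc d (fun j => A (gridPoint d j) y) i| ≤ K :=
  SGDFluctuation.abs_disc_le hd (f := fun x => A x y) (fun x => hA.bound x y)
    (fun x x' => hA.lip x x' y) hi

/-- The bound on mixed second differences makes the discrete `x`-derivative of `A` Lipschitz in `y`
uniformly in `d`, as needed to compare the Riemann sum in the scheme with the integral in the limit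
equation. -/
theorem IsSmoothKernel.disc_lip (hA : IsSmoothKernel A K) {d : ℕ} (hd : 1 ≤ d) {i : ℕ}
    (hi : i ∈ Finset.Icc 1 d) (y y' : unitInterval) :
    |disc d (fun j => A (gridPoint d j) y) i - disc d (fun j => A (gridPoint d j) y') i| ≤
      K * |(y : ℝ) - y'| := by
  rw [← disc_sub]
  refine SGDFluctuation.abs_disc_le hd (f := fun x => A x y - A x y')
    (fun x => hA.lip_right y y' x) (fun x x' => ?_) hi
  have := hA.mixed x x' y y'
  rw [show A x y - A x y' - (A x' y - A x' y') = A x y - A x' y - (A x y' - A x' y') by ring]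
  refine this.trans (le_of_eq (by ring))

end Kernel

/-! ### Interpolation of smooth functions -/

/-- The error at `x` of the piecewise linear interpolation of `f` with mesh `1 / d`. -/
noncomputable def interpErr (d : ℕ) (f : unitInterval → ℝ) (x : unitInterval) : ℝ :=
  linInterp (fun i => f (gridPoint d i)) ((d : ℝ) * x) - f x

/-- The point `x` is the barycentre of its two grid neighbours, so affine parts drop out of the
error. The weight and the neighbours depend on `d` and `x` only, which lets the same combination act
on `Θ` and on `A`. -/
theorem exists_interpErr_eq {d : ℕ} (hd : 1 ≤ d) (x : unitInterval) :
    ∃ (l : ℝ) (p q : unitInterval), 0 ≤ l ∧ l ≤ 1 ∧ |(p : ℝ) - x| ≤ 1 / d ∧ |(q : ℝ) - x| ≤ 1 / d ∧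
      (1 - l) * ((p : ℝ) - x) + l * (q - x) = 0 ∧
      ∀ f : unitInterval → ℝ, interpErr d f x = (1 - l) * f p + l * f q - f x := by
  have hd' : (0 : ℝ) < d := by positivity
  have hx0 : 0 ≤ (d : ℝ) * x := mul_nonneg hd'.le x.2.1
  have hxd : (d : ℝ) * x ≤ d := by nlinarith [x.2.2]
  set n := ⌊(d : ℝ) * x⌋₊ with hn
  have h1 : (n : ℝ) ≤ d * x := Nat.floor_le hx0
  have h2 : (d : ℝ) * x < n + 1 := Nat.lt_floor_add_one _
  have hnd : n ≤ d := by
    have : (n : ℝ) ≤ d := h1.trans hxd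
    exact_mod_cast this
  have hform : ∀ f : unitInterval → ℝ, interpErr d f x =
      (1 - ((d : ℝ) * x - n)) * f (gridPoint d n) + ((d : ℝ) * x - n) * f (gridPoint d (n + 1))
        - f x := by
    intro f
    rw [interpErr, linInterp_eq _ n h1 h2.le]
    simp only [smul_eq_mul]
    ring
  have hp : (gridPoint d n : ℝ) = n / d := coe_gridPoint hd hnd
  have hxe : (x : ℝ) = (d * x) / d := by field_simp
  have hpx : |(gridPoint d n : ℝ) - x| ≤ 1 / d := by
    rw [hp, hxe, ← sub_div, abs_div, abs_of_pos hd']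
    gcongr
    rw [abs_le]; constructor <;> linarith
  rcases hnd.lt_or_eq with hlt | heq
  · have hq : (gridPoint d (n + 1) : ℝ) = (n + 1) / d := by
      rw [coe_gridPoint hd hlt]; push_cast; rfl
    refine ⟨(d : ℝ) * x - n, gridPoint d n, gridPoint d (n + 1), by linarith, by linarith, hpx, ?_,
      ?_, hform⟩
    · rw [hq, hxe, ← sub_div, abs_div, abs_of_pos hd']
      gcongr
      rw [abs_le]; constructor <;> linarith
    · rw [hp, hq]; field_simp; ring
  -- At `x = 1` the right neighbour would be node `d + 1`; its weight is zero, so the last node is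
  -- taken twice.
  · have hx1 : (d : ℝ) * x = n := le_antisymm (by rw [heq]; exact hxd) h1
    have hpx' : (gridPoint d n : ℝ) = x := by rw [hp, ← hx1]; field_simp
    refine ⟨0, gridPoint d n, gridPoint d n, le_rfl, zero_le_one, hpx, hpx, ?_, fun f => ?_⟩
    · rw [hpx']; ring
    · rw [hform, hx1]; ring

theorem abs_interpErr_le {d : ℕ} (hd : 1 ≤ d) {f : unitInterval → ℝ} {K : ℝ}
    (h : ∀ x y, |f x - f y| ≤ K * |(x : ℝ) - y|) (x : unitInterval) :
    |interpErr d f x| ≤ K / d := by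
  obtain ⟨l, p, q, hl0, hl1, hp, hq, -, hf⟩ := exists_interpErr_eq hd x
  have hK : 0 ≤ K := by
    have := (abs_nonneg _).trans (h 1 0)
    simpa using this
  have e : interpErr d f x = (1 - l) * (f p - f x) + l * (f q - f x) := by rw [hf]; ring
  have hp' : |f p - f x| ≤ K / d := (h p x).trans (by rw [div_eq_mul_one_div]; gcongr)
  have hq' : |f q - f x| ≤ K / d := (h q x).trans (by rw [div_eq_mul_one_div]; gcongr)
  rw [e]
  calc _ ≤ |(1 - l) * (f p - f x)| + |l * (f q - f x)| := abs_add_le _ _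
    _ = (1 - l) * |f p - f x| + l * |f q - f x| := by
        rw [abs_mul, abs_mul, abs_of_nonneg hl0, abs_of_nonneg (by linarith : 0 ≤ 1 - l)]
    _ ≤ (1 - l) * (K / d) + l * (K / d) := by
        have : 0 ≤ 1 - l := by linarith
        gcongr
    _ = K / d := by ring

theorem interpErr_sub (d : ℕ) (f g : unitInterval → ℝ) (x : unitInterval) :
    interpErr d (fun y => f y - g y) x = interpErr d f x - interpErr d g x := by
  simp only [interpErr, linInterp, smul_eq_mul]; ring

/-- The derivative is uniformly continuous on the compact interval, so the mean value inequality
gives a uniform first-order remainder. -/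
theorem exists_uniform_taylor {f : unitInterval → ℝ}
    (hf : ContDiffOn ℝ 1 (Set.IccExtend (zero_le_one (α := ℝ)) f) (Set.Icc 0 1)) :
    ∃ g : unitInterval → ℝ, ∀ ε > 0, ∃ δ > 0, ∀ x y : unitInterval, |(y : ℝ) - x| < δ →
      |f y - f x - g x * ((y : ℝ) - x)| ≤ ε * |(y : ℝ) - x| := by
  set F := Set.IccExtend (zero_le_one (α := ℝ)) f
  have hcont : ContinuousOn (derivWithin F (Set.Icc 0 1)) (Set.Icc 0 1) :=
    hf.continuousOn_derivWithin (uniqueDiffOn_Icc zero_lt_one) le_rfl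
  have hunif := isCompact_Icc.uniformContinuousOn_of_continuous hcont
  refine ⟨fun x => derivWithin F (Set.Icc 0 1) x, fun ε hε => ?_⟩
  obtain ⟨δ, hδ, h⟩ := Metric.uniformContinuousOn_iff.1 hunif ε hε
  refine ⟨δ, hδ, fun x y hxy => ?_⟩
  have hsub : Set.uIcc (x : ℝ) y ⊆ Set.Icc 0 1 := Set.uIcc_subset_Icc x.2 y.2
  have hder : ∀ z ∈ Set.uIcc (x : ℝ) y, HasDerivWithinAt
      (fun z => F z - derivWithin F (Set.Icc 0 1) x * z)
      (derivWithin F (Set.Icc 0 1) z - derivWithin F (Set.Icc 0 1) x * 1) (Set.uIcc (x : ℝ) y) z := by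
    intro z hz
    have h1 : HasDerivWithinAt F (derivWithin F (Set.Icc 0 1) z) (Set.Icc 0 1) z :=
      ((hf.differentiableOn (by norm_num)) z (hsub hz)).hasDerivWithinAt
    exact (h1.mono hsub).sub ((hasDerivWithinAt_id z _).const_mul _)
  have hb : ∀ z ∈ Set.uIcc (x : ℝ) y,
      ‖derivWithin F (Set.Icc 0 1) z - derivWithin F (Set.Icc 0 1) x * 1‖ ≤ ε := by
    intro z hz
    rw [mul_one, ← dist_eq_norm]
    refine (h z (hsub hz) x x.2 ?_).le
    rw [Real.dist_eq]
    exact (Set.abs_sub_left_of_mem_uIcc hz).trans_lt hxy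
  have := Convex.norm_image_sub_le_of_norm_hasDerivWithin_le hder hb (convex_uIcc (x : ℝ) y)
    Set.left_mem_uIcc Set.right_mem_uIcc
  simp only [F, Set.IccExtend_val, Real.norm_eq_abs] at this
  refine le_trans (le_of_eq ?_) this
  congr 1
  ring

/-- The linear Taylor terms cancel by the barycentre identity, leaving remainders `o(1/d)`. A
Lipschitz bound would only give `O(1/d)`, which is not enough when `γ` is of order `d`. -/
theorem eventually_interpErr_le_of_contDiff {f : unitInterval → ℝ}
    (hf : ContDiffOn ℝ 1 (Set.IccExtend (zero_le_one (α := ℝ)) f) (Set.Icc 0 1)) {ε : ℝ}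
    (hε : 0 < ε) :
    ∀ᶠ d : ℕ in atTop, ∀ x, (d : ℝ) * |interpErr d f x| ≤ ε := by
  obtain ⟨g, hg⟩ := exists_uniform_taylor hf
  obtain ⟨δ, hδ, h⟩ := hg ε hε
  have hlim : ∀ᶠ d : ℕ in atTop, 1 / (d : ℝ) < δ :=
    tendsto_one_div_atTop_nhds_zero_nat.eventually_lt_const hδ
  filter_upwards [hlim, eventually_ge_atTop 1] with d hdδ hd x
  have hd' : (0 : ℝ) < d := by positivity
  obtain ⟨l, p, q, hl0, hl1, hp, hq, hpq, hfe⟩ := exists_interpErr_eq hd x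
  have hp' : |f p - f x - g x * ((p : ℝ) - x)| ≤ ε * (1 / d) :=
    (h x p (hp.trans_lt hdδ)).trans (by gcongr)
  have hq' : |f q - f x - g x * ((q : ℝ) - x)| ≤ ε * (1 / d) :=
    (h x q (hq.trans_lt hdδ)).trans (by gcongr)
  have e : interpErr d f x = (1 - l) * (f p - f x - g x * ((p : ℝ) - x)) +
      l * (f q - f x - g x * ((q : ℝ) - x)) := by
    rw [hfe]; linear_combination (g x) * hpq
  have hb : |interpErr d f x| ≤ ε * (1 / d) := by
    rw [e]
    calc _ ≤ |(1 - l) * (f p - f x - g x * ((p : ℝ) - x))| +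
          |l * (f q - f x - g x * ((q : ℝ) - x))| := abs_add_le _ _
      _ = (1 - l) * |f p - f x - g x * ((p : ℝ) - x)| +
          l * |f q - f x - g x * ((q : ℝ) - x)| := by
          rw [abs_mul, abs_mul, abs_of_nonneg hl0, abs_of_nonneg (by linarith : 0 ≤ 1 - l)]
      _ ≤ (1 - l) * (ε * (1 / d)) + l * (ε * (1 / d)) := by
          have : 0 ≤ 1 - l := by linarith
          gcongr
      _ = _ := by ring
  calc (d : ℝ) * |interpErr d f x| ≤ d * (ε * (1 / d)) := by gcongr
    _ = ε := by field_simp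

/-- Each section is `C¹`, but uniformity in `y` has to be earned. A finite net of sections is
treated first; moving `y` to the net changes the error by at most `K |y - y'| / d`, thanks to the
mixed differences. -/
theorem IsSmoothKernel.eventually_interpErr_le {A : unitInterval → unitInterval → ℝ} {K : ℝ}
    (hA : IsSmoothKernel A K) {ε : ℝ} (hε : 0 < ε) :
    ∀ᶠ d : ℕ in atTop, ∀ x y, (d : ℝ) * |interpErr d (fun z => A z y) x| ≤ ε := by
  have hK := hA.nonneg
  obtain ⟨m, hm⟩ := exists_nat_gt (2 * K / ε)
  have hm0 : (0 : ℝ) < m := lt_of_le_of_lt (by positivity) hm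
  have hm1 : 1 ≤ m := by
    have : 0 < m := by exact_mod_cast hm0
    omega
  have hnet : ∀ᶠ d : ℕ in atTop, ∀ k ∈ Finset.range (m + 1), ∀ x,
      (d : ℝ) * |interpErr d (fun z => A z (gridPoint m k)) x| ≤ ε / 2 := by
    rw [Filter.eventually_all_finset]
    intro k _
    have h := eventually_interpErr_le_of_contDiff (hA.contDiff (gridPoint m k)) (half_pos hε)
    rwa [show A (gridPoint m k) = fun z => A z (gridPoint m k) from
      funext fun z => hA.symm _ _] at h
  filter_upwards [hnet, eventually_ge_atTop 1] with d hd hd1 x y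
  have hd' : (0 : ℝ) < d := by positivity
  set k := ⌊(m : ℝ) * y⌋₊ with hk
  have h1 : (k : ℝ) ≤ m * y := Nat.floor_le (mul_nonneg hm0.le y.2.1)
  have h2 : (m : ℝ) * y < k + 1 := Nat.lt_floor_add_one _
  have hkm : k ≤ m := by
    have : (k : ℝ) ≤ m := by nlinarith [y.2.2]
    exact_mod_cast this
  have hky : |(y : ℝ) - gridPoint m k| ≤ 1 / m := by
    rw [coe_gridPoint hm1 hkm, show (y : ℝ) = (m * y) / m by field_simp, ← sub_div, abs_div,
      abs_of_pos hm0]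
    gcongr
    rw [abs_le]; constructor <;> linarith
  have h3 := hd k (Finset.mem_range.2 (by omega)) x
  have h4 : |interpErr d (fun z => A z y - A z (gridPoint m k)) x| ≤
      K * |(y : ℝ) - gridPoint m k| / d := by
    refine abs_interpErr_le hd1 (fun x x' => ?_) x
    have := hA.mixed x x' y (gridPoint m k)
    rw [show A x y - A x (gridPoint m k) - (A x' y - A x' (gridPoint m k)) =
      A x y - A x' y - (A x (gridPoint m k) - A x' (gridPoint m k)) by ring]
    exact this.trans (le_of_eq (by ring))
  rw [interpErr_sub] at h4
  have h5 : K * |(y : ℝ) - gridPoint m k| ≤ ε / 2 := by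
    calc _ ≤ K * (1 / m) := by gcongr
      _ ≤ ε / 2 := by
        rw [div_lt_iff₀ hε] at hm
        rw [mul_one_div, div_le_iff₀ hm0]
        linarith
  have h6 := abs_sub_abs_le_abs_sub (interpErr d (fun z => A z y) x)
    (interpErr d (fun z => A z (gridPoint m k)) x)
  have h7 : (d : ℝ) * (K * |(y : ℝ) - gridPoint m k| / d) ≤ ε / 2 := by
    rw [mul_div_cancel₀ _ hd'.ne']; exact h5
  have h8 := mul_le_mul_of_nonneg_left (h6.trans h4) hd'.le
  rw [mul_sub] at h8
  linarith

/-! ### Regularity of the scaling limit -/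

section Limit

variable {A : unitInterval → unitInterval → ℝ} {K τ α : ℝ} {hτ : 0 ≤ τ} {Θ : PathSpace τ}

theorem abs_path_le (Θ : PathSpace τ) (s : Set.Icc (0 : ℝ) τ) (x : unitInterval) :
    |Θ s x| ≤ ‖Θ‖ := ((Θ s).norm_coe_le_norm x).trans (Θ.norm_coe_le_norm s)

theorem IsScalingLimit.integrable (hA : IsSmoothKernel A K) (Θ : PathSpace τ)
    (s : Set.Icc (0 : ℝ) τ) (x : unitInterval) : Integrable fun y => A x y * Θ s y :=
  integrable_of_continuous_unitInterval ((hA.continuous x).mul (Θ s).continuous)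

/-- Three terms cover all the combinations in use: a value, a difference of two values, and the
interpolation error `(1 - l) Θ(p) + l Θ(q) - Θ(x)`. -/
theorem IsScalingLimit.hasDerivWithinAt_comb (hΘ : IsScalingLimit hτ α A Θ)
    (hA : IsSmoothKernel A K) (c₁ c₂ c₃ : ℝ) (x₁ x₂ x₃ : unitInterval) (s : Set.Icc (0 : ℝ) τ) :
    HasDerivWithinAt (fun r : ℝ => c₁ * Θ (Set.projIcc 0 τ hτ r) x₁ +
        c₂ * Θ (Set.projIcc 0 τ hτ r) x₂ + c₃ * Θ (Set.projIcc 0 τ hτ r) x₃)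
      (-α * ∫ y, (c₁ * A x₁ y + c₂ * A x₂ y + c₃ * A x₃ y) * Θ s y) (Set.Icc 0 τ) s := by
  have i1 := (IsScalingLimit.integrable hA Θ s x₁).const_mul c₁
  have i2 := (IsScalingLimit.integrable hA Θ s x₂).const_mul c₂
  have i3 := (IsScalingLimit.integrable hA Θ s x₃).const_mul c₃
  have e : -α * ∫ y, (c₁ * A x₁ y + c₂ * A x₂ y + c₃ * A x₃ y) * Θ s y =
      c₁ * (-α * ∫ y, A x₁ y * Θ s y) + c₂ * (-α * ∫ y, A x₂ y * Θ s y) +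
        c₃ * (-α * ∫ y, A x₃ y * Θ s y) := by
    rw [show (fun y => (c₁ * A x₁ y + c₂ * A x₂ y + c₃ * A x₃ y) * Θ s y) =
      fun y => c₁ * (A x₁ y * Θ s y) + c₂ * (A x₂ y * Θ s y) + c₃ * (A x₃ y * Θ s y) from
        funext fun y => by ring]
    rw [integral_add (f := fun y => c₁ * (A x₁ y * Θ s y) + c₂ * (A x₂ y * Θ s y)) (i1.add i2) i3,
      integral_add i1 i2, integral_const_mul, integral_const_mul,
      integral_const_mul]
    ring
  rw [e]
  exact (((hΘ.ode s x₁).const_mul c₁).add ((hΘ.ode s x₂).const_mul c₂)).add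
    ((hΘ.ode s x₃).const_mul c₃)

/-- The integral equation transfers every bound on a combination of rows of `A` to the evolution of
the same combination of `Θ`. Spatial regularity of `Θ` is thus propagated from time `0`. -/
theorem IsScalingLimit.comb_sub_le (hΘ : IsScalingLimit hτ α A Θ) (hα : 0 ≤ α)
    (hA : IsSmoothKernel A K) {c₁ c₂ c₃ : ℝ} {x₁ x₂ x₃ : unitInterval} {b : ℝ}
    (hb : ∀ y, |c₁ * A x₁ y + c₂ * A x₂ y + c₃ * A x₃ y| ≤ b) (s s' : Set.Icc (0 : ℝ) τ) :
    |(c₁ * Θ s x₁ + c₂ * Θ s x₂ + c₃ * Θ s x₃) - (c₁ * Θ s' x₁ + c₂ * Θ s' x₂ + c₃ * Θ s' x₃)| ≤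
      α * (b * ‖Θ‖) * |(s : ℝ) - s'| := by
  have hder := fun r (hr : r ∈ Set.Icc (0 : ℝ) τ) =>
    hΘ.hasDerivWithinAt_comb hA c₁ c₂ c₃ x₁ x₂ x₃ ⟨r, hr⟩
  have := Convex.norm_image_sub_le_of_norm_hasDerivWithin_le
    (f' := fun r => -α * ∫ y, (c₁ * A x₁ y + c₂ * A x₂ y + c₃ * A x₃ y) *
      Θ (Set.projIcc 0 τ hτ r) y) (C := α * (b * ‖Θ‖)) (fun r hr => by
        have h := hder r hr
        simp only [← Set.projIcc_of_mem hτ hr] at h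
        exact h) (fun r _ => ?_) (convex_Icc (0 : ℝ) τ) s'.2 s.2
  · simpa only [Set.projIcc_val, Real.norm_eq_abs] using this
  · rw [norm_mul, norm_neg, Real.norm_of_nonneg hα]
    gcongr
    refine abs_integral_unitInterval_le fun y => ?_
    rw [abs_mul]
    have := abs_path_le Θ (Set.projIcc 0 τ hτ r) y
    have h0 := (abs_nonneg _).trans (hb y)
    gcongr
    exact hb y

theorem IsScalingLimit.time_lip (hΘ : IsScalingLimit hτ α A Θ) (hα : 0 ≤ α)
    (hA : IsSmoothKernel A K) (s s' : Set.Icc (0 : ℝ) τ) (x : unitInterval) :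
    |Θ s x - Θ s' x| ≤ α * (K * ‖Θ‖) * |(s : ℝ) - s'| := by
  have := hΘ.comb_sub_le hα hA (c₁ := 1) (c₂ := 0) (c₃ := 0) (x₁ := x) (x₂ := x) (x₃ := x)
    (b := K) (fun y => by simpa using hA.bound x y) s s'
  simpa using this

theorem IsScalingLimit.exists_space_lip (hΘ : IsScalingLimit hτ α A Θ) (hα : 0 ≤ α)
    (hA : IsSmoothKernel A K) : ∃ C : ℝ, 0 ≤ C ∧ ∀ (s : Set.Icc (0 : ℝ) τ) (x y : unitInterval),
      |Θ s x - Θ s y| ≤ C * |(x : ℝ) - y| := by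
  obtain ⟨L, hL⟩ := hΘ.initial.exists_lipschitzOnWith (by norm_num) (convex_Icc 0 1) isCompact_Icc
  have hK := hA.nonneg
  refine ⟨L + α * (K * ‖Θ‖) * τ, by positivity, fun s x y => ?_⟩
  have h1 := hΘ.comb_sub_le hα hA (c₁ := 1) (c₂ := -1) (c₃ := 0) (x₁ := x) (x₂ := y) (x₃ := x)
    (b := K * |(x : ℝ) - y|) (fun z => by simpa [sub_eq_add_neg] using hA.lip x y z) s ⟨0, le_rfl, hτ⟩
  have h2 := hL.dist_le_mul x x.2 y y.2
  simp only [Set.IccExtend_val, Real.dist_eq] at h2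
  have h3 : |(s : ℝ) - (⟨0, le_rfl, hτ⟩ : Set.Icc (0 : ℝ) τ)| ≤ τ := by
    simp only [sub_zero]; rw [abs_of_nonneg s.2.1]; exact s.2.2
  have h4 : α * (K * |(x : ℝ) - y| * ‖Θ‖) * |(s : ℝ) - (⟨0, le_rfl, hτ⟩ : Set.Icc (0 : ℝ) τ)| ≤
      α * (K * |(x : ℝ) - y| * ‖Θ‖) * τ := by gcongr
  have h5 := abs_sub_abs_le_abs_sub (Θ s x - Θ s y)
    (Θ ⟨0, le_rfl, hτ⟩ x - Θ ⟨0, le_rfl, hτ⟩ y)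
  have h6 : |(Θ s x - Θ s y) - (Θ ⟨0, le_rfl, hτ⟩ x - Θ ⟨0, le_rfl, hτ⟩ y)| ≤
      α * (K * |(x : ℝ) - y| * ‖Θ‖) * τ := by
    refine le_trans (le_of_eq ?_) (h1.trans h4)
    congr 1; ring
  calc _ ≤ α * (K * |(x : ℝ) - y| * ‖Θ‖) * τ + L * |(x : ℝ) - y| := by linarith
    _ = _ := by ring

theorem IsScalingLimit.eventually_interpErr_le (hΘ : IsScalingLimit hτ α A Θ) (hα : 0 ≤ α)
    (hA : IsSmoothKernel A K) {ε : ℝ} (hε : 0 < ε) :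
    ∀ᶠ d : ℕ in atTop, ∀ s x, (d : ℝ) * |interpErr d (Θ s) x| ≤ ε := by
  -- The accuracy `ε / (2ρ)` for the kernel integrates to at most `ε / 2` over `[0, τ]`; the summand
  -- `1` keeps `ρ` positive.
  set ρ := α * ‖Θ‖ * τ + 1 with hρ
  have hρ0 : 0 < ρ := by positivity
  filter_upwards [eventually_interpErr_le_of_contDiff hΘ.initial (half_pos hε),
    hA.eventually_interpErr_le (ε := ε / (2 * ρ)) (by positivity), eventually_ge_atTop 1]
    with d h1 h2 hd s x
  have hd' : (0 : ℝ) < d := by positivity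
  obtain ⟨l, p, q, -, -, -, -, -, hfe⟩ := exists_interpErr_eq hd x
  have h3 := hΘ.comb_sub_le hα hA (c₁ := 1 - l) (c₂ := l) (c₃ := -1) (x₁ := p) (x₂ := q) (x₃ := x)
    (b := ε / (2 * ρ) / d) (fun y => by
      have h := h2 x y
      rw [hfe] at h
      rw [le_div_iff₀ hd', mul_comm]
      refine le_trans (le_of_eq ?_) h
      congr 2; ring) s ⟨0, le_rfl, hτ⟩
  have h4 := h1 x
  have e : ∀ s, (1 - l) * Θ s p + l * Θ s q + -1 * Θ s x = interpErr d (Θ s) x := fun s => by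
    rw [hfe]; ring
  rw [e, e] at h3
  have h5 : |(s : ℝ) - (⟨0, le_rfl, hτ⟩ : Set.Icc (0 : ℝ) τ)| ≤ τ := by
    simp only [sub_zero]; rw [abs_of_nonneg s.2.1]; exact s.2.2
  have h6 : α * (ε / (2 * ρ) / d * ‖Θ‖) * |(s : ℝ) - (⟨0, le_rfl, hτ⟩ : Set.Icc (0 : ℝ) τ)| ≤
      α * (ε / (2 * ρ) / d * ‖Θ‖) * τ := by gcongr
  have h7 : (d : ℝ) * (α * (ε / (2 * ρ) / d * ‖Θ‖) * τ) ≤ ε / 2 := by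
    have e1 : (d : ℝ) * (α * (ε / (2 * ρ) / d * ‖Θ‖) * τ) = ε / 2 * ((α * ‖Θ‖ * τ) / ρ) := by
      field_simp
    rw [e1]
    have : (α * ‖Θ‖ * τ) / ρ ≤ 1 := by rw [div_le_one hρ0]; linarith
    nlinarith
  have h8 := abs_sub_abs_le_abs_sub (interpErr d (Θ s) x) (interpErr d (Θ ⟨0, le_rfl, hτ⟩) x)
  have h9 := mul_le_mul_of_nonneg_left ((h8.trans h3).trans h6) hd'.le
  rw [mul_sub] at h9
  change (d : ℝ) * |interpErr d (Θ ⟨0, le_rfl, hτ⟩) x| ≤ ε / 2 at h4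
  linarith

/-- The consistency error of the discrete derivatives of the scheme. -/
theorem IsScalingLimit.exists_residual_le (hΘ : IsScalingLimit hτ α A Θ) (hα : 0 ≤ α)
    (hA : IsSmoothKernel A K) : ∃ C : ℝ, 0 ≤ C ∧ ∀ (d T : ℕ), 1 ≤ d → 1 ≤ T →
      ∀ i ∈ Finset.Icc 1 d, ∀ t₀ s s' : Set.Icc (0 : ℝ) τ, t₀ ≤ s → t₀ ≤ s' →
      (s : ℝ) ≤ t₀ + 1 / T → (s' : ℝ) ≤ t₀ + 1 / T →
      |disc d (fun j => Θ s (gridPoint d j)) i - disc d (fun j => Θ s' (gridPoint d j)) i +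
        ((s : ℝ) - s') * ((α / d) * ∑ j ∈ Finset.Icc 1 d,
          disc d (fun k => A (gridPoint d k) (gridPoint d j)) i * Θ t₀ (gridPoint d j))| ≤
        C * (1 / d + 1 / T) * |(s : ℝ) - s'| := by
  obtain ⟨C₁, hC₁, hlip⟩ := hΘ.exists_space_lip hα hA
  have hK := hA.nonneg
  refine ⟨α * (K * (α * (K * ‖Θ‖)) + (K * C₁ + K * ‖Θ‖)), by positivity, ?_⟩
  intro d T hd hT i hi t₀ s s' hs hs' hsT hs'T
  have hd' : (0 : ℝ) < d := by positivity
  have hT' : (0 : ℝ) < T := by positivity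
  set a : unitInterval → ℝ := fun y => disc d (fun k => A (gridPoint d k) y) i with ha
  -- A discrete derivative is a combination of at most two values, so the differential equation for
  -- combinations applies to it.
  obtain ⟨c₁, c₂, x₁, x₂, hc⟩ : ∃ (c₁ c₂ : ℝ) (x₁ x₂ : unitInterval), ∀ f : unitInterval → ℝ,
      disc d (fun j => f (gridPoint d j)) i = c₁ * f x₁ + c₂ * f x₂ + 0 * f x₁ := by
    by_cases h : i ≤ 1
    · refine ⟨1, 0, gridPoint d 1, gridPoint d 1, fun f => ?_⟩
      simp [disc, h]
    · refine ⟨d, -d, gridPoint d i, gridPoint d (i - 1), fun f => ?_⟩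
      simp only [disc, h, if_false]; ring
  have hac : ∀ y, c₁ * A x₁ y + c₂ * A x₂ y + 0 * A x₁ y = a y := fun y =>
    (hc fun x => A x y).symm
  have hab : ∀ y, |a y| ≤ K := hA.abs_disc_le hd hi
  have hal : ∀ y y', |a y - a y'| ≤ K * |(y : ℝ) - y'| := hA.disc_lip hd hi
  have hacont : Continuous a := continuous_of_lipschitz hal
  set m := (α / d) * ∑ j ∈ Finset.Icc 1 d, a (gridPoint d j) * Θ t₀ (gridPoint d j) with hm
  set S := Set.Icc (t₀ : ℝ) (t₀ + 1 / T) ∩ Set.Icc 0 τ with hS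
  -- Adding `r * m` removes the frozen Riemann sum from the derivative. What is left comes from
  -- freezing the time at `t₀`, of order `1/T`, and from the Riemann sum, of order `1/d`; the mean
  -- value inequality integrates it.
  have hder : ∀ r ∈ S, HasDerivWithinAt (fun r : ℝ => (c₁ * Θ (Set.projIcc 0 τ hτ r) x₁ +
        c₂ * Θ (Set.projIcc 0 τ hτ r) x₂ + 0 * Θ (Set.projIcc 0 τ hτ r) x₁) + r * m)
      ((-α * ∫ y, a y * Θ (Set.projIcc 0 τ hτ r) y) + 1 * m) S r := by
    intro r hr
    have h1 := hΘ.hasDerivWithinAt_comb hA c₁ c₂ 0 x₁ x₂ x₁ ⟨r, hr.2⟩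
    simp only [hac] at h1
    rw [← Set.projIcc_of_mem hτ hr.2] at h1
    exact (h1.mono Set.inter_subset_right).add ((hasDerivWithinAt_id r S).mul_const m)
  have hbound : ∀ r ∈ S, ‖(-α * ∫ y, a y * Θ (Set.projIcc 0 τ hτ r) y) + 1 * m‖ ≤
      α * (K * (α * (K * ‖Θ‖)) + (K * C₁ + K * ‖Θ‖)) * (1 / d + 1 / T) := by
    intro r hr
    set r' := Set.projIcc 0 τ hτ r
    have hr' : (r' : ℝ) = r := by simp only [r']; rw [Set.projIcc_of_mem hτ hr.2]
    have i1 : ∀ u : Set.Icc (0 : ℝ) τ, Integrable fun y => a y * Θ u y := fun u =>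
      integrable_of_continuous_unitInterval (hacont.mul (Θ u).continuous)
    have h1 : |(∫ y, a y * Θ r' y) - ∫ y, a y * Θ t₀ y| ≤ K * (α * (K * ‖Θ‖)) * (1 / T) := by
      rw [← integral_sub (i1 _) (i1 _)]
      refine abs_integral_unitInterval_le fun y => ?_
      rw [← mul_sub, abs_mul, mul_assoc]
      refine mul_le_mul (hab y) ((hΘ.time_lip hα hA r' t₀ y).trans ?_) (abs_nonneg _) hK
      gcongr
      rw [hr', abs_of_nonneg (by linarith [hr.1.1])]
      linarith [hr.1.2]
    have h2 := abs_integral_sub_riemann_le hd (f := fun y => a y * Θ t₀ y)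
      (K := K * C₁ + K * ‖Θ‖) (fun x y => by
        have e : a x * Θ t₀ x - a y * Θ t₀ y = a x * (Θ t₀ x - Θ t₀ y) + (a x - a y) * Θ t₀ y := by
          ring
        rw [e]
        calc _ ≤ |a x * (Θ t₀ x - Θ t₀ y)| + |(a x - a y) * Θ t₀ y| := abs_add_le _ _
          _ = |a x| * |Θ t₀ x - Θ t₀ y| + |a x - a y| * |Θ t₀ y| := by rw [abs_mul, abs_mul]
          _ ≤ K * (C₁ * |(x : ℝ) - y|) + K * |(x : ℝ) - y| * ‖Θ‖ := by
            gcongr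
            · exact hab x
            · exact hlip t₀ x y
            · exact hal x y
            · exact abs_path_le Θ t₀ y
          _ = _ := by ring)
    have e : (-α * ∫ y, a y * Θ r' y) + 1 * m = -α * (((∫ y, a y * Θ r' y) - ∫ y, a y * Θ t₀ y) +
        ((∫ y, a y * Θ t₀ y) -
          (1 / (d : ℝ)) * ∑ j ∈ Finset.Icc 1 d, a (gridPoint d j) * Θ t₀ (gridPoint d j))) := by
      rw [hm]; ring
    rw [e, norm_mul, norm_neg, Real.norm_of_nonneg hα, Real.norm_eq_abs, mul_assoc]
    gcongr
    refine (abs_add_le _ _).trans ((add_le_add h1 h2).trans ?_)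
    have p1 : 0 ≤ K * (α * (K * ‖Θ‖)) := by positivity
    have p2 : 0 ≤ K * C₁ + K * ‖Θ‖ := by positivity
    have p3 : 0 ≤ 1 / (d : ℝ) := by positivity
    have p4 : 0 ≤ 1 / (T : ℝ) := by positivity
    rw [div_eq_mul_one_div (K * C₁ + K * ‖Θ‖)]
    nlinarith [mul_nonneg p1 p3, mul_nonneg p2 p4]
  have := Convex.norm_image_sub_le_of_norm_hasDerivWithin_le hder hbound
    ((convex_Icc _ _).inter (convex_Icc _ _)) (x := (s' : ℝ)) (y := (s : ℝ))
    ⟨⟨hs', hs'T⟩, s'.2⟩ ⟨⟨hs, hsT⟩, s.2⟩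
  simp only [Set.projIcc_val, Real.norm_eq_abs] at this
  refine le_trans (le_of_eq ?_) this
  rw [hc fun x => Θ s x, hc fun x => Θ s' x]
  congr 1
  ring

end Limit


/-! ### Fourth moments -/

theorem add_pow_four_le (x y : ℝ) : (x + y) ^ 4 ≤ 8 * (x ^ 4 + y ^ 4) := by
  nlinarith [sq_nonneg (x - y), sq_nonneg (x + y), sq_nonneg (x ^ 2 - y ^ 2),
    mul_nonneg (sq_nonneg (x - y)) (sq_nonneg (x + y)), sq_nonneg (x * y), sq_nonneg (x^2+y^2),
    mul_nonneg (sq_nonneg (x - y)) (add_nonneg (sq_nonneg x) (sq_nonneg y))]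

theorem add_add_pow_four_le (x y z : ℝ) : (x + y + z) ^ 4 ≤ 27 * (x ^ 4 + y ^ 4 + z ^ 4) := by
  have h1 : (x + y + z) ^ 2 ≤ 3 * (x ^ 2 + y ^ 2 + z ^ 2) := by
    nlinarith [sq_nonneg (x - y), sq_nonneg (y - z), sq_nonneg (x - z)]
  have h2 : (x ^ 2 + y ^ 2 + z ^ 2) ^ 2 ≤ 3 * (x ^ 4 + y ^ 4 + z ^ 4) := by
    nlinarith [sq_nonneg (x ^ 2 - y ^ 2), sq_nonneg (y ^ 2 - z ^ 2), sq_nonneg (x ^ 2 - z ^ 2)]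
  have h3 : ((x + y + z) ^ 2) ^ 2 ≤ (3 * (x ^ 2 + y ^ 2 + z ^ 2)) ^ 2 := by gcongr
  nlinarith

theorem sum_pow_four_le {ι : Type*} (s : Finset ι) (f : ι → ℝ) :
    (∑ i ∈ s, f i) ^ 4 ≤ (s.card : ℝ) ^ 3 * ∑ i ∈ s, f i ^ 4 := by
  have h1 : (∑ i ∈ s, f i) ^ 2 ≤ s.card * ∑ i ∈ s, f i ^ 2 := sq_sum_le_card_mul_sum_sq
  have h2 : (∑ i ∈ s, f i ^ 2) ^ 2 ≤ s.card * ∑ i ∈ s, (f i ^ 2) ^ 2 := sq_sum_le_card_mul_sum_sq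
  have h3 : ((∑ i ∈ s, f i) ^ 2) ^ 2 ≤ (s.card * ∑ i ∈ s, f i ^ 2) ^ 2 := by gcongr
  have e : ∀ i, (f i ^ 2) ^ 2 = f i ^ 4 := fun i => by ring
  simp only [e] at h2
  calc (∑ i ∈ s, f i) ^ 4 = ((∑ i ∈ s, f i) ^ 2) ^ 2 := by ring
    _ ≤ (s.card * ∑ i ∈ s, f i ^ 2) ^ 2 := h3
    _ = (s.card : ℝ) ^ 2 * (∑ i ∈ s, f i ^ 2) ^ 2 := by ring
    _ ≤ (s.card : ℝ) ^ 2 * (s.card * ∑ i ∈ s, f i ^ 4) := by gcongr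
    _ = _ := by ring

section Moments

variable {Ω : Type*} [MeasurableSpace Ω] {P : Measure Ω}

theorem integrable_pow_four {f : Ω → ℝ} (hf : MemLp f 4 P) : Integrable (fun ω => f ω ^ 4) P := by
  have := MemLp.integrable_norm_pow (p := 4) (f := f) (by exact_mod_cast hf) (by norm_num)
  refine this.congr (Eventually.of_forall fun ω => ?_)
  simp only [Real.norm_eq_abs]
  rw [← abs_pow, abs_of_nonneg (by positivity)]

theorem memLp_four_of_integrable {f : Ω → ℝ} (hf : AEStronglyMeasurable f P)
    (h : Integrable (fun ω => f ω ^ 4) P) : MemLp f 4 P := by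
  have h4 : (4 : ENNReal).toReal = ((4 : ℕ) : ℝ) := by norm_num
  rw [← integrable_norm_rpow_iff hf (by norm_num) (by norm_num)]
  refine h.congr (Eventually.of_forall fun ω => ?_)
  simp only [Real.norm_eq_abs, h4, Real.rpow_natCast]
  rw [← abs_pow, abs_of_nonneg (by positivity)]

theorem integrable_mul_of_bound {f g : Ω → ℝ} (hf : MemLp f 4 P) (hg : MemLp g 4 P) {h : ℝ → ℝ → ℝ}
    (hh : Continuous fun p : ℝ × ℝ => h p.1 p.2) (hb : ∀ x y, |h x y| ≤ x ^ 4 + y ^ 4) :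
    Integrable (fun ω => h (f ω) (g ω)) P := by
  refine ((integrable_pow_four hf).add (integrable_pow_four hg)).mono ?_ ?_
  · exact hh.comp_aestronglyMeasurable (hf.1.prodMk hg.1)
  · refine Eventually.of_forall fun ω => ?_
    rw [Real.norm_eq_abs]
    exact (hb _ _).trans (le_abs_self _)

theorem integrable_cube_mul {f g : Ω → ℝ} (hf : MemLp f 4 P) (hg : MemLp g 4 P) :
    Integrable (fun ω => f ω ^ 3 * g ω) P := by
  refine integrable_mul_of_bound hf hg (h := fun x y => x ^ 3 * y) (by fun_prop) fun x y => ?_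
  rw [abs_le]
  constructor <;> nlinarith [sq_nonneg (x ^ 2 + x * y), sq_nonneg (x ^ 2 - x * y),
    sq_nonneg (x ^ 2 - y ^ 2), sq_nonneg x, sq_nonneg (x ^ 2), sq_nonneg (y ^ 2)]

/-- The term `4 Y³ g` has mean zero, and the rest is at most `8 Y² g² + 3 g⁴`, split by a weighted
arithmetic–geometric mean inequality. The choice `c = T` suits the Gronwall step, `c = 4k` the sum
of `k` martingale increments. -/
theorem integral_add_pow_four_le {Y g : Ω → ℝ} (hY : MemLp Y 4 P) (hg : MemLp g 4 P)
    (h0 : ∫ ω, Y ω ^ 3 * g ω ∂P = 0) {c : ℝ} (hc : 0 < c) :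
    ∫ ω, (Y ω + g ω) ^ 4 ∂P ≤
      (1 + 4 / c) * ∫ ω, Y ω ^ 4 ∂P + (4 * c + 3) * ∫ ω, g ω ^ 4 ∂P := by
  have i1 := integrable_pow_four hY
  have i2 := integrable_pow_four hg
  have i3 := integrable_cube_mul hY hg
  have hle : ∀ ω, (Y ω + g ω) ^ 4 ≤
      (1 + 4 / c) * Y ω ^ 4 + (4 * c + 3) * g ω ^ 4 + 4 * (Y ω ^ 3 * g ω) := by
    intro ω
    set y := Y ω
    set z := g ω
    have h1 : 8 * (y ^ 2 * z ^ 2) ≤ 4 / c * y ^ 4 + 4 * c * z ^ 4 := by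
      have h2 : 0 ≤ 4 / c * (y ^ 2 - c * z ^ 2) ^ 2 := by positivity
      have h3 : 4 / c * (y ^ 2 - c * z ^ 2) ^ 2 =
          4 / c * y ^ 4 + 4 * c * z ^ 4 - 8 * (y ^ 2 * z ^ 2) := by field_simp; ring
      linarith
    have h2 : 4 * (y * z ^ 3) ≤ 2 * (y ^ 2 * z ^ 2) + 2 * z ^ 4 := by
      nlinarith [sq_nonneg (y * z - z ^ 2)]
    have h3 : (y + z) ^ 4 = y ^ 4 + 4 * (y ^ 3 * z) + 6 * (y ^ 2 * z ^ 2) + 4 * (y * z ^ 3) + z ^ 4 := by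
      ring
    rw [h3]
    linarith
  calc _ ≤ ∫ ω, (1 + 4 / c) * Y ω ^ 4 + (4 * c + 3) * g ω ^ 4 + 4 * (Y ω ^ 3 * g ω) ∂P := by
        refine integral_mono (integrable_pow_four (hY.add hg)) ?_ hle
        exact ((i1.const_mul _).add (i2.const_mul _)).add (i3.const_mul _)
    _ = _ := by
        rw [integral_add (f := fun ω => (1 + 4 / c) * Y ω ^ 4 + (4 * c + 3) * g ω ^ 4)
          ((i1.const_mul _).add (i2.const_mul _)) (i3.const_mul _),
          integral_add (i1.const_mul _) (i2.const_mul _), integral_const_mul, integral_const_mul,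
          integral_const_mul, h0]
        ring

theorem integral_add_add_pow_four_le {f g h : Ω → ℝ} (hf : MemLp f 4 P) (hg : MemLp g 4 P)
    (hh : MemLp h 4 P) : ∫ ω, (f ω + g ω + h ω) ^ 4 ∂P ≤
      27 * (∫ ω, f ω ^ 4 ∂P + ∫ ω, g ω ^ 4 ∂P + ∫ ω, h ω ^ 4 ∂P) := by
  have i1 := integrable_pow_four hf
  have i2 := integrable_pow_four hg
  have i3 := integrable_pow_four hh
  calc _ ≤ ∫ ω, 27 * (f ω ^ 4 + g ω ^ 4 + h ω ^ 4) ∂P := by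
        refine integral_mono (integrable_pow_four ((hf.add hg).add hh)) ?_
          fun ω => add_add_pow_four_le _ _ _
        exact ((i1.add i2).add i3).const_mul _
    _ = _ := by
        rw [integral_const_mul, integral_add (f := fun ω => f ω ^ 4 + g ω ^ 4) (i1.add i2) i3,
          integral_add i1 i2]

theorem integral_add_pow_four_le' {f g : Ω → ℝ} (hf : MemLp f 4 P) (hg : MemLp g 4 P) :
    ∫ ω, (f ω + g ω) ^ 4 ∂P ≤ 8 * (∫ ω, f ω ^ 4 ∂P + ∫ ω, g ω ^ 4 ∂P) := by
  have i1 := integrable_pow_four hf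
  have i2 := integrable_pow_four hg
  calc _ ≤ ∫ ω, 8 * (f ω ^ 4 + g ω ^ 4) ∂P := by
        refine integral_mono (integrable_pow_four (hf.add hg)) ?_ fun ω => add_pow_four_le _ _
        exact (i1.add i2).const_mul _
    _ = _ := by rw [integral_const_mul, integral_add i1 i2]

theorem integral_sum_pow_four_le {ι : Type*} (s : Finset ι) {f : ι → Ω → ℝ} {b : ℝ}
    (hf : ∀ i ∈ s, MemLp (f i) 4 P) (hb : ∀ i ∈ s, ∫ ω, f i ω ^ 4 ∂P ≤ b) :
    ∫ ω, (∑ i ∈ s, f i ω) ^ 4 ∂P ≤ (s.card : ℝ) ^ 4 * b := by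
  have hi : ∀ i ∈ s, Integrable (fun ω => f i ω ^ 4) P := fun i hi => integrable_pow_four (hf i hi)
  calc _ ≤ ∫ ω, (s.card : ℝ) ^ 3 * ∑ i ∈ s, f i ω ^ 4 ∂P := by
        refine integral_mono (integrable_pow_four (memLp_finsetSum s hf)) ?_
          fun ω => sum_pow_four_le s _
        exact (integrable_finsetSum s hi).const_mul _
    _ = (s.card : ℝ) ^ 3 * ∑ i ∈ s, ∫ ω, f i ω ^ 4 ∂P := by
        rw [integral_const_mul, integral_finsetSum s hi]
    _ ≤ (s.card : ℝ) ^ 3 * ∑ i ∈ s, b := by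
        gcongr with i hi
        exact hb i hi
    _ = _ := by rw [Finset.sum_const, nsmul_eq_mul]; ring

theorem integral_const_mul_pow_four (c : ℝ) (f : Ω → ℝ) :
    ∫ ω, (c * f ω) ^ 4 ∂P = c ^ 4 * ∫ ω, f ω ^ 4 ∂P := by
  simp only [mul_pow, integral_const_mul]

theorem integral_pow_four_nonneg (f : Ω → ℝ) : 0 ≤ ∫ ω, f ω ^ 4 ∂P :=
  integral_nonneg fun ω => by positivity

end Moments

/-! ### Schemes driven by martingale increments -/

/-- A family of processes that is affine on the cells of a grid of mesh `1 / T` up to a Lipschitz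
deterministic error, with adapted drifts `a` and martingale increments `g` whose fourth moments
are controlled by those of the process. -/
structure IsIncrementScheme {Ω : Type*} [MeasurableSpace Ω] (P : Measure Ω) (τ K : ℝ) (T : ℕ)
    (I : Finset ℕ) (D : ℝ → ℕ → Ω → ℝ) (a g : ℕ → ℕ → Ω → ℝ) (ℱ : ℕ → MeasurableSpace Ω) :
    Prop where
  mono : Monotone ℱ
  adapted : ∀ (t i : ℕ), i ∈ I → (t : ℝ) ≤ τ * T → Measurable[ℱ t] (D (t / T) i)
  adapted_drift : ∀ (t i : ℕ), i ∈ I → (t : ℝ) ≤ τ * T → Measurable[ℱ t] (a t i)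
  adapted_mart : ∀ (t i : ℕ), i ∈ I → (t : ℝ) ≤ τ * T → Measurable[ℱ (t + 1)] (g t i)
  init : ∀ i ∈ I, MemLp (D 0 i) 4 P ∧ ∫ ω, D 0 i ω ^ 4 ∂P ≤ K
  cell : ∀ (t i : ℕ) (s s' : ℝ), i ∈ I → (t : ℝ) / T ≤ s → (t : ℝ) / T ≤ s' →
    s ≤ t / T + 1 / T → s' ≤ t / T + 1 / T → s ≤ τ → s' ≤ τ → ∃ ρ : ℝ, |ρ| ≤ K * |s - s'| ∧
      ∀ ω, D s i ω - D s' i ω = T * (s - s') * (a t i ω + g t i ω) + ρ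
  step : ∀ (t : ℕ) (φ : ℝ), (t : ℝ) ≤ τ * T →
    (∀ i ∈ I, MemLp (D (t / T) i) 4 P ∧ ∫ ω, D (t / T) i ω ^ 4 ∂P ≤ φ) → ∀ i ∈ I,
      MemLp (a t i) 4 P ∧ ∫ ω, a t i ω ^ 4 ∂P ≤ K * φ / T ^ 4 ∧
      MemLp (g t i) 4 P ∧ ∫ ω, g t i ω ^ 4 ∂P ≤ K * (1 + φ) / T ^ 2 ∧
      ∀ Y : Ω → ℝ, Measurable[ℱ t] Y → MemLp Y 4 P → ∫ ω, Y ω ^ 3 * g t i ω ∂P = 0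

section Scheme

variable {Ω : Type*} [MeasurableSpace Ω] {P : Measure Ω} [IsProbabilityMeasure P] {τ K : ℝ} {T : ℕ}
  {I : Finset ℕ} {D : ℝ → ℕ → Ω → ℝ} {a g : ℕ → ℕ → Ω → ℝ} {ℱ : ℕ → MeasurableSpace Ω}

theorem integral_const_pow_four (c : ℝ) : ∫ _ : Ω, c ^ 4 ∂P = c ^ 4 := by simp

/-- Here `u = 1 / T`: the bound of one step is linearised in `u`, higher powers being absorbed by `u
≤ 1`. -/
theorem scheme_step_arith {u φ b K : ℝ} (hu0 : 0 ≤ u) (hu : u ≤ 1) (hφ : 0 ≤ φ) (hb : 0 ≤ b) :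
    (1 + 4 * u) * ((1 + u) ^ 3 * (φ + u * (b * (1 + φ)))) + 7 * u * (K * (1 + φ)) + 1 ≤
      (1 + (39 + 40 * b + 7 * K) * u) * (1 + φ) := by
  have h3 : (1 + u) ^ 3 ≤ 1 + 7 * u := by nlinarith [mul_nonneg hu0 (sub_nonneg.2 hu), pow_nonneg hu0 2]
  have hΦ : 0 ≤ b * (1 + φ) := by positivity
  have h4 : (1 + u) ^ 3 * (φ + u * (b * (1 + φ))) ≤ (1 + 7 * u) * (φ + u * (b * (1 + φ))) := by gcongr
  have h5 : (1 + 7 * u) * (φ + u * (b * (1 + φ))) ≤ φ + u * (7 * φ + 8 * (b * (1 + φ))) := by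
    nlinarith [mul_nonneg (mul_nonneg hu0 (sub_nonneg.2 hu)) hΦ]
  have h6 : (1 + 4 * u) * (φ + u * (7 * φ + 8 * (b * (1 + φ)))) ≤
      φ + u * (39 * φ + 40 * (b * (1 + φ))) := by
    have : 0 ≤ 7 * φ + 8 * (b * (1 + φ)) := by positivity
    nlinarith [mul_nonneg (mul_nonneg hu0 (sub_nonneg.2 hu)) this]
  have h7 := mul_le_mul_of_nonneg_left (h4.trans h5) (show 0 ≤ 1 + 4 * u by linarith)
  nlinarith

/-- One step of the Gronwall argument, for the quantity `1 + φ`. The drift costs a factor `1 +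
O(1/T)` by convexity; the martingale increment does so because it is orthogonal to cubes of past
variables. -/
theorem IsIncrementScheme.moment_succ (h : IsIncrementScheme P τ K T I D a g ℱ) (hT : 1 ≤ T)
    (hK : 0 ≤ K) {t : ℕ} (ht : ((t + 1 : ℕ) : ℝ) ≤ τ * T) {φ : ℝ} (hφ : 0 ≤ φ)
    (hD : ∀ i ∈ I, MemLp (D (t / T) i) 4 P ∧ ∫ ω, D (t / T) i ω ^ 4 ∂P ≤ φ) {i : ℕ} (hi : i ∈ I) :
    MemLp (D ((t + 1 : ℕ) / T) i) 4 P ∧ ∫ ω, D ((t + 1 : ℕ) / T) i ω ^ 4 ∂P + 1 ≤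
      (1 + (39 + 40 * (8 * (K + K ^ 4)) + 7 * K) * (1 / T)) * (1 + φ) := by
  have hT' : (1 : ℝ) ≤ T := by exact_mod_cast hT
  have hT0 : (0 : ℝ) < T := by linarith
  have ht' : (t : ℝ) ≤ τ * T := by push_cast at ht; linarith
  obtain ⟨ha, ha4, hg, hg4, hmart⟩ := h.step t φ ht' hD i hi
  obtain ⟨hDt, hDt4⟩ := hD i hi
  have hτ' : ((t + 1 : ℕ) : ℝ) / T ≤ τ := by rw [div_le_iff₀ hT0]; exact ht
  have hstep : ((t + 1 : ℕ) : ℝ) / T - t / T = 1 / T := by push_cast; ring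
  obtain ⟨ρ, hρ, hrep⟩ := h.cell t i ((t + 1 : ℕ) / T) (t / T) hi (by linarith [one_div_pos.2 hT0])
    le_rfl (by linarith) (by linarith [one_div_pos.2 hT0]) hτ'
    (by linarith [one_div_pos.2 hT0])
  rw [hstep, abs_of_pos (one_div_pos.2 hT0)] at hρ
  rw [hstep] at hrep
  have hrep' : ∀ ω, D ((t + 1 : ℕ) / T) i ω = (D (t / T) i ω + (a t i ω + ρ)) + g t i ω := by
    intro ω
    have := hrep ω
    rw [mul_one_div_cancel hT0.ne', one_mul] at this
    linarith
  have hconst : MemLp (fun _ : Ω => ρ) 4 P := memLp_const ρ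
  have hb : MemLp (fun ω => a t i ω + ρ) 4 P := ha.add hconst
  have hY : MemLp (fun ω => D (t / T) i ω + (a t i ω + ρ)) 4 P := hDt.add hb
  have hYm : Measurable[ℱ t] (fun ω => D (t / T) i ω + (a t i ω + ρ)) :=
    (h.adapted t i hi ht').add ((h.adapted_drift t i hi ht').add measurable_const)
  have h0 := hmart _ hYm hY
  have hb4 : ∫ ω, (a t i ω + ρ) ^ 4 ∂P ≤ 8 * (K + K ^ 4) * (1 + φ) / T ^ 4 := by
    refine (integral_add_pow_four_le' ha hconst).trans ?_
    rw [integral_const_pow_four]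
    have hρ4 : ρ ^ 4 ≤ K ^ 4 / T ^ 4 := by
      have : |ρ| ^ 4 ≤ (K * (1 / T)) ^ 4 := by gcongr
      rw [← abs_pow, abs_of_nonneg (by positivity : 0 ≤ ρ ^ 4)] at this
      refine this.trans (le_of_eq ?_)
      rw [mul_one_div, div_pow]
    calc 8 * (∫ ω, a t i ω ^ 4 ∂P + ρ ^ 4) ≤ 8 * (K * φ / T ^ 4 + K ^ 4 / T ^ 4) := by gcongr
      _ = 8 * (K * φ + K ^ 4) / T ^ 4 := by ring
      _ ≤ _ := by
        gcongr ?_ / _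
        nlinarith [mul_nonneg (pow_nonneg hK 4) hφ]
  have hY4 : ∫ ω, (D (t / T) i ω + (a t i ω + ρ)) ^ 4 ∂P ≤
      (1 + 1 / T) ^ 3 * (φ + 1 / T * (8 * (K + K ^ 4) * (1 + φ))) := by
    have hle : ∀ ω, (D (t / T) i ω + (a t i ω + ρ)) ^ 4 ≤
        (1 + 1 / (T : ℝ)) ^ 3 * (D (t / T) i ω ^ 4 + T ^ 3 * (a t i ω + ρ) ^ 4) := by
      intro ω
      set x := D (t / T) i ω
      set y := a t i ω + ρ
      have hw : (0 : ℝ) < 1 + 1 / T := by positivity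
      -- Jensen applied to `x` and `T y` with weights proportional to `1` and `1 / T`. A term `y`
      -- with fourth moment of order `T^{-4}` then contributes only `T³ · T^{-4} = 1 / T`.
      have := Real.pow_arith_mean_le_arith_mean_pow_of_even (Finset.univ : Finset (Fin 2))
        ![1 / (1 + 1 / (T : ℝ)), (1 / T) / (1 + 1 / (T : ℝ))] ![x, T * y]
        (by intro j _; fin_cases j <;> simp <;> positivity)
        (by simp [Fin.sum_univ_two]; field_simp) (n := 4) (by decide)
      simp only [Fin.sum_univ_two, Matrix.cons_val_zero, Matrix.cons_val_one] at this
      have e1 : 1 / (1 + 1 / (T : ℝ)) * x + 1 / T / (1 + 1 / (T : ℝ)) * (T * y) =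
          (x + y) / (1 + 1 / (T : ℝ)) := by field_simp
      rw [e1, div_pow, div_le_iff₀ (by positivity)] at this
      refine this.trans (le_of_eq ?_)
      field_simp
    calc _ ≤ ∫ ω, (1 + 1 / (T : ℝ)) ^ 3 * (D (t / T) i ω ^ 4 + T ^ 3 * (a t i ω + ρ) ^ 4) ∂P := by
          refine integral_mono (integrable_pow_four hY) ?_ hle
          exact ((integrable_pow_four hDt).add ((integrable_pow_four hb).const_mul _)).const_mul _
      _ = (1 + 1 / (T : ℝ)) ^ 3 * (∫ ω, D (t / T) i ω ^ 4 ∂P +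
          T ^ 3 * ∫ ω, (a t i ω + ρ) ^ 4 ∂P) := by
          rw [integral_const_mul, integral_add (integrable_pow_four hDt)
            ((integrable_pow_four hb).const_mul _), integral_const_mul]
      _ ≤ (1 + 1 / (T : ℝ)) ^ 3 * (φ + T ^ 3 * (8 * (K + K ^ 4) * (1 + φ) / T ^ 4)) := by gcongr
      _ = _ := by
          congr 2
          field_simp
  have hfin := integral_add_pow_four_le hY hg h0 hT0
  simp only [← hrep'] at hfin
  refine ⟨?_, ?_⟩
  · have := hY.add hg
    refine this.ae_eq (Eventually.of_forall fun ω => ?_)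
    exact (hrep' ω).symm
  · have hu1 : 1 / (T : ℝ) ≤ 1 := by rw [div_le_one hT0]; exact hT'
    have harith := scheme_step_arith (u := 1 / (T : ℝ)) (b := 8 * (K + K ^ 4)) (by positivity) hu1
      hφ (by positivity) (K := K)
    have h1 : (1 + 4 / (T : ℝ)) * ∫ ω, (D (t / T) i ω + (a t i ω + ρ)) ^ 4 ∂P ≤
        (1 + 4 * (1 / (T : ℝ))) *
          ((1 + 1 / (T : ℝ)) ^ 3 * (φ + 1 / T * (8 * (K + K ^ 4) * (1 + φ)))) := by
      rw [mul_one_div]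
      gcongr
    have h2 : (4 * (T : ℝ) + 3) * ∫ ω, g t i ω ^ 4 ∂P ≤ 7 * (1 / (T : ℝ)) * (K * (1 + φ)) := by
      calc _ ≤ (7 * (T : ℝ)) * (K * (1 + φ) / T ^ 2) := by
            gcongr
            linarith
        _ = _ := by field_simp
    linarith

theorem IsIncrementScheme.moment_le (h : IsIncrementScheme P τ K T I D a g ℱ) (hT : 1 ≤ T)
    (hK : 0 ≤ K) (t : ℕ) (ht : (t : ℝ) ≤ τ * T) : ∀ i ∈ I, MemLp (D (t / T) i) 4 P ∧
      ∫ ω, D (t / T) i ω ^ 4 ∂P ≤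
        (1 + K) * Real.exp ((39 + 40 * (8 * (K + K ^ 4)) + 7 * K) * τ) := by
  have hT0 : (0 : ℝ) < T := by exact_mod_cast hT
  set κ := 39 + 40 * (8 * (K + K ^ 4)) + 7 * K with hκ
  have hκ0 : 0 ≤ κ := by positivity
  have key : ∀ t : ℕ, (t : ℝ) ≤ τ * T → ∀ i ∈ I, MemLp (D (t / T) i) 4 P ∧
      ∫ ω, D (t / T) i ω ^ 4 ∂P ≤ (1 + κ * (1 / T)) ^ t * (1 + K) - 1 := by
    intro t
    induction t with
    | zero =>
      intro _ i hi
      have := h.init i hi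
      simpa using this
    | succ t ih =>
      intro ht i hi
      have ht' : (t : ℝ) ≤ τ * T := by push_cast at ht; linarith
      have hφ : 0 ≤ (1 + κ * (1 / (T : ℝ))) ^ t * (1 + K) - 1 := by
        have : 1 ≤ (1 + κ * (1 / (T : ℝ))) ^ t := one_le_pow₀ (by
          have : 0 ≤ κ * (1 / (T : ℝ)) := by positivity
          linarith)
        nlinarith
      obtain ⟨h1, h2⟩ := h.moment_succ hT hK ht hφ (ih ht') hi
      refine ⟨h1, ?_⟩
      rw [← hκ] at h2
      rw [pow_succ]
      linarith
  intro i hi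
  obtain ⟨h1, h2⟩ := key t ht i hi
  refine ⟨h1, h2.trans ?_⟩
  have h3 : (1 + κ * (1 / (T : ℝ))) ^ t ≤ Real.exp (κ * τ) := by
    calc _ ≤ (Real.exp (κ * (1 / T))) ^ t := by
          gcongr
          rw [add_comm]
          exact Real.add_one_le_exp _
      _ = Real.exp (κ * (t / T)) := by rw [← Real.exp_nat_mul]; congr 1; ring
      _ ≤ _ := by
          gcongr
          rw [div_le_iff₀ hT0]; exact ht
  nlinarith

/-- The bound `K (1 + φ)` for the scaled moments of drifts and martingale increments. -/
noncomputable def schemeBound (K τ : ℝ) : ℝ :=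
  K * (1 + (1 + K) * Real.exp ((39 + 40 * (8 * (K + K ^ 4)) + 7 * K) * τ))

theorem schemeBound_nonneg (hK : 0 ≤ K) : 0 ≤ schemeBound K τ := by
  unfold schemeBound; positivity

theorem IsIncrementScheme.step_le (h : IsIncrementScheme P τ K T I D a g ℱ) (hT : 1 ≤ T)
    (hK : 0 ≤ K) {i : ℕ} (hi : i ∈ I) (t : ℕ) (ht : (t : ℝ) ≤ τ * T) :
    MemLp (a t i) 4 P ∧ ∫ ω, a t i ω ^ 4 ∂P ≤ schemeBound K τ / T ^ 4 ∧
      MemLp (g t i) 4 P ∧ ∫ ω, g t i ω ^ 4 ∂P ≤ schemeBound K τ / T ^ 2 ∧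
      ∀ Y : Ω → ℝ, Measurable[ℱ t] Y → MemLp Y 4 P → ∫ ω, Y ω ^ 3 * g t i ω ∂P = 0 := by
  obtain ⟨h1, h2, h3, h4, h5⟩ := h.step t _ ht (h.moment_le hT hK t ht) i hi
  refine ⟨h1, h2.trans ?_, h3, h4, h5⟩
  unfold schemeBound
  gcongr
  linarith

/-- Inside a cell the increment carries the factor `l = T (s' - s) ≤ 1`. Hence `l⁴ ≤ l²`, and `l² /
T²` is exactly `(s' - s)²`. -/
theorem IsIncrementScheme.cell_le (h : IsIncrementScheme P τ K T I D a g ℱ) (hT : 1 ≤ T)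
    (hK : 0 ≤ K) {i : ℕ} (hi : i ∈ I) (t : ℕ) (s s' : ℝ) (hs : (t : ℝ) / T ≤ s) (hss : s ≤ s')
    (hs' : s' ≤ t / T + 1 / T) (hτ' : s' ≤ τ) :
    MemLp (fun ω => D s' i ω - D s i ω) 4 P ∧ ∫ ω, (D s' i ω - D s i ω) ^ 4 ∂P ≤
      27 * (2 * schemeBound K τ + K ^ 4 * τ ^ 2) * (s' - s) ^ 2 := by
  have hβ0 := schemeBound_nonneg (τ := τ) hK
  have hstep := h.step_le hT hK hi
  set β := schemeBound K τ
  have hT1 : (1 : ℝ) ≤ T := by exact_mod_cast hT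
  have hT0 : (0 : ℝ) < T := by linarith
  have ht : (t : ℝ) ≤ τ * T := by
    rw [div_le_iff₀ hT0] at hs
    nlinarith
  obtain ⟨ha, ha4, hg, hg4, -⟩ := hstep t ht
  obtain ⟨ρ, hρ, hrep⟩ := h.cell t i s' s hi (hs.trans hss) hs hs' (hss.trans hs') hτ'
    (hss.trans hτ')
  have hs0 : 0 ≤ s := le_trans (by positivity) hs
  set l := (T : ℝ) * (s' - s) with hl
  have hl0 : 0 ≤ l := mul_nonneg hT0.le (by linarith)
  have hl1 : l ≤ 1 := by
    have h1 : (T : ℝ) * (s' - s) ≤ T * (1 / T) := by gcongr; linarith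
    rwa [mul_one_div_cancel hT0.ne'] at h1
  have hrep' : ∀ ω, D s' i ω - D s i ω = l * a t i ω + l * g t i ω + ρ := fun ω => by
    rw [hrep ω]; ring
  simp only [hrep']
  have m1 := ha.const_mul l
  have m2 := hg.const_mul l
  have m3 : MemLp (fun _ : Ω => ρ) 4 P := memLp_const ρ
  refine ⟨(m1.add m2).add m3, (integral_add_add_pow_four_le m1 m2 m3).trans ?_⟩
  rw [integral_const_mul_pow_four, integral_const_mul_pow_four, integral_const_pow_four]
  have hss0 : 0 ≤ s' - s := by linarith
  have hl4 : l ^ 4 ≤ l ^ 2 := pow_le_pow_of_le_one hl0 hl1 (by norm_num)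
  have hρ4 : ρ ^ 4 ≤ K ^ 4 * τ ^ 2 * (s' - s) ^ 2 := by
    have h1 : |ρ| ^ 4 ≤ (K * |s' - s|) ^ 4 := by gcongr
    rw [← abs_pow, abs_of_nonneg (by positivity : 0 ≤ ρ ^ 4), abs_of_nonneg hss0] at h1
    calc ρ ^ 4 ≤ (K * (s' - s)) ^ 4 := h1
      _ = K ^ 4 * (s' - s) ^ 2 * (s' - s) ^ 2 := by ring
      _ ≤ K ^ 4 * τ ^ 2 * (s' - s) ^ 2 := by gcongr; linarith
  have hTle : β / T ^ 4 ≤ β / (T : ℝ) ^ 2 := by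
    gcongr
    norm_num
  have e : l ^ 2 * (β / T ^ 2) = β * (s' - s) ^ 2 := by rw [hl]; field_simp
  have h1 : l ^ 4 * ∫ ω, a t i ω ^ 4 ∂P ≤ β * (s' - s) ^ 2 := by
    rw [← e]
    exact mul_le_mul hl4 (ha4.trans hTle) (integral_pow_four_nonneg _) (by positivity)
  have h2 : l ^ 4 * ∫ ω, g t i ω ^ 4 ∂P ≤ β * (s' - s) ^ 2 := by
    rw [← e]
    exact mul_le_mul hl4 hg4 (integral_pow_four_nonneg _) (by positivity)
  nlinarith

theorem IsIncrementScheme.memLp (h : IsIncrementScheme P τ K T I D a g ℱ) (hT : 1 ≤ T)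
    (hK : 0 ≤ K) {i : ℕ} (hi : i ∈ I) {s : ℝ} (hs : s ∈ Set.Icc 0 τ) : MemLp (D s i) 4 P := by
  have hcell := h.cell_le hT hK hi
  have hT1 : (1 : ℝ) ≤ T := by exact_mod_cast hT
  have hT0 : (0 : ℝ) < T := by linarith
  have hsT : 0 ≤ s * T := mul_nonneg hs.1 hT0.le
  have h1 := Nat.floor_le hsT
  have h2 := Nat.lt_floor_add_one (s * T)
  have h3 : ((⌊s * T⌋₊ : ℕ) : ℝ) / T ≤ s := by rw [div_le_iff₀ hT0]; exact h1
  have h4 : s ≤ ((⌊s * T⌋₊ : ℕ) : ℝ) / T + 1 / T := by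
    rw [← add_div, le_div_iff₀ hT0]; exact h2.le
  have h5 := (hcell ⌊s * T⌋₊ _ s le_rfl h3 h4 hs.2).1
  have h6 := (h.moment_le hT hK ⌊s * T⌋₊ (h1.trans (by
    have := hs.2
    gcongr)) i hi).1
  have := h5.add h6
  refine this.ae_eq (Eventually.of_forall fun ω => ?_)
  simp

/-- Drifts and residuals add up to the elapsed time, whose fourth power is at most `τ²` times its
square. The martingale part grows diffusively: its fourth moment is quadratic in the number of
steps. -/
theorem IsIncrementScheme.nodes_le (h : IsIncrementScheme P τ K T I D a g ℱ) (hT : 1 ≤ T)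
    (hK : 0 ≤ K) {i : ℕ} (hi : i ∈ I) {m n : ℕ} (hmn : m ≤ n) (hn : (n : ℝ) ≤ τ * T) :
    ∫ ω, (D (n / T) i ω - D (m / T) i ω) ^ 4 ∂P ≤
      27 * (schemeBound K τ * τ ^ 2 + K ^ 4 * τ ^ 2 + 16 * schemeBound K τ) *
        (((n : ℝ) - m) / T) ^ 2 := by
  have hβ0 := schemeBound_nonneg (τ := τ) hK
  have hstep := h.step_le hT hK hi
  set β := schemeBound K τ
  have hT1 : (1 : ℝ) ≤ T := by exact_mod_cast hT
  have hT0 : (0 : ℝ) < T := by linarith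
  have hle : ∀ t ∈ Finset.Ico m n, (t : ℝ) ≤ τ * T := fun t ht => by
    have : (t : ℝ) ≤ n := by exact_mod_cast (Finset.mem_Ico.1 ht).2.le
    linarith
  have hrep : ∃ r : ℝ, |r| ≤ K * (((n : ℝ) - m) / T) ∧ ∀ ω, D (n / T) i ω - D (m / T) i ω =
      ∑ t ∈ Finset.Ico m n, a t i ω + ∑ t ∈ Finset.Ico m n, g t i ω + r := by
    clear hle
    induction n, hmn using Nat.le_induction with
    | base => exact ⟨0, by simp, fun ω => by simp⟩
    | succ n hmn ih =>
      have hn' : (n : ℝ) ≤ τ * T := by push_cast at hn; linarith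
      obtain ⟨r, hr, hrω⟩ := ih hn'
      have hstp : ((n + 1 : ℕ) : ℝ) / T - n / T = 1 / T := by push_cast; ring
      have hp := one_div_pos.2 hT0
      obtain ⟨ρ, hρ, hρω⟩ := h.cell n i ((n + 1 : ℕ) / T) (n / T) hi (by linarith) le_rfl
        (by linarith) (by linarith) (by rw [div_le_iff₀ hT0]; exact hn)
        (by rw [div_le_iff₀ hT0]; exact hn')
      rw [hstp, abs_of_pos hp] at hρ
      rw [hstp] at hρω
      refine ⟨r + ρ, ?_, fun ω => ?_⟩
      · refine (abs_add_le _ _).trans ((add_le_add hr hρ).trans (le_of_eq ?_))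
        push_cast; ring
      · have h1 := hρω ω
        have h2 := hrω ω
        rw [mul_one_div_cancel hT0.ne', one_mul] at h1
        rw [Finset.sum_Ico_succ_top hmn, Finset.sum_Ico_succ_top hmn]
        linarith
  obtain ⟨r, hr, hrω⟩ := hrep
  have hcard : ((Finset.Ico m n).card : ℝ) = (n : ℝ) - m := by
    rw [Nat.card_Ico, Nat.cast_sub hmn]
  have hnm : (0 : ℝ) ≤ (n : ℝ) - m := by rw [sub_nonneg]; exact_mod_cast hmn
  have m1 : MemLp (fun ω => ∑ t ∈ Finset.Ico m n, a t i ω) 4 P :=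
    memLp_finsetSum _ fun t ht => (hstep t (hle t ht)).1
  have m2 : MemLp (fun ω => ∑ t ∈ Finset.Ico m n, g t i ω) 4 P :=
    memLp_finsetSum _ fun t ht => (hstep t (hle t ht)).2.2.1
  have m3 : MemLp (fun _ : Ω => r) 4 P := memLp_const r
  simp only [hrω]
  refine (integral_add_add_pow_four_le m1 m2 m3).trans ?_
  rw [integral_const_pow_four]
  set w := ((n : ℝ) - m) / T with hw
  have hw0 : 0 ≤ w := div_nonneg hnm hT0.le
  have hwτ : w ≤ τ := by
    rw [hw, div_le_iff₀ hT0]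
    have : (0 : ℝ) ≤ m := Nat.cast_nonneg m
    linarith
  have hw4 : w ^ 4 ≤ τ ^ 2 * w ^ 2 := by
    calc w ^ 4 = w ^ 2 * w ^ 2 := by ring
      _ ≤ τ ^ 2 * w ^ 2 := by gcongr
  have b1 : ∫ ω, (∑ t ∈ Finset.Ico m n, a t i ω) ^ 4 ∂P ≤ β * τ ^ 2 * w ^ 2 := by
    refine (integral_sum_pow_four_le _ (fun t ht => (hstep t (hle t ht)).1)
      fun t ht => (hstep t (hle t ht)).2.1).trans ?_
    rw [hcard]
    calc ((n : ℝ) - m) ^ 4 * (β / T ^ 4) = β * w ^ 4 := by rw [hw]; field_simp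
      _ ≤ β * (τ ^ 2 * w ^ 2) := by gcongr
      _ = _ := by ring
  have b3 : r ^ 4 ≤ K ^ 4 * τ ^ 2 * w ^ 2 := by
    have h1 : |r| ^ 4 ≤ (K * w) ^ 4 := by gcongr
    rw [← abs_pow, abs_of_nonneg (by positivity : 0 ≤ r ^ 4)] at h1
    calc r ^ 4 ≤ (K * w) ^ 4 := h1
      _ = K ^ 4 * w ^ 4 := by ring
      _ ≤ K ^ 4 * (τ ^ 2 * w ^ 2) := by gcongr
      _ = _ := by ring
  have b2 : ∫ ω, (∑ t ∈ Finset.Ico m n, g t i ω) ^ 4 ∂P ≤ 16 * β * w ^ 2 := by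
    -- A fourth-moment Burkholder inequality by induction. With `c = 4k` the step reads `(1 + 1/k)
    -- 16 k² + 16 k + 3 ≤ 16 (k + 1)²`; `k = 0` is separate because `c` must be positive.
    have key : ∀ k : ℕ, ((m + k : ℕ) : ℝ) ≤ τ * T →
        Measurable[ℱ (m + k)] (fun ω => ∑ t ∈ Finset.Ico m (m + k), g t i ω) ∧
        ∫ ω, (∑ t ∈ Finset.Ico m (m + k), g t i ω) ^ 4 ∂P ≤ 16 * (k : ℝ) ^ 2 * (β / T ^ 2) := by
      intro k
      induction k with
      | zero => intro _; simp [measurable_const]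
      | succ k ih =>
        intro hk
        have hk' : ((m + k : ℕ) : ℝ) ≤ τ * T := by push_cast at hk ⊢; linarith
        obtain ⟨i1, i2⟩ := ih hk'
        have hSm : MemLp (fun ω => ∑ t ∈ Finset.Ico m (m + k), g t i ω) 4 P := by
          refine memLp_finsetSum _ fun t ht => (hstep t ?_).2.2.1
          have : (t : ℝ) ≤ (m + k : ℕ) := by exact_mod_cast (Finset.mem_Ico.1 ht).2.le
          linarith
        obtain ⟨-, -, hg, hg4, hmart⟩ := hstep (m + k) hk'
        have hsum : ∀ ω, ∑ t ∈ Finset.Ico m (m + (k + 1)), g t i ω =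
            ∑ t ∈ Finset.Ico m (m + k), g t i ω + g (m + k) i ω := fun ω => by
          rw [← add_assoc, Finset.sum_Ico_succ_top (by omega)]
        simp only [hsum]
        refine ⟨(i1.mono (h.mono (by omega)) le_rfl).add
          (h.adapted_mart (m + k) i hi hk'), ?_⟩
        rcases Nat.eq_zero_or_pos k with rfl | hk0
        · simp only [add_zero, Finset.Ico_self, Finset.sum_empty, zero_add] at hg4 ⊢
          refine hg4.trans ?_
          have : 0 ≤ β / (T : ℝ) ^ 2 := by positivity
          push_cast
          linarith
        · have hk0' : (0 : ℝ) < k := by exact_mod_cast hk0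
          have h4 := integral_add_pow_four_le hSm hg (hmart _ i1 hSm) (c := 4 * k) (by positivity)
          refine h4.trans ?_
          set B := β / (T : ℝ) ^ 2
          have hB : 0 ≤ B := by positivity
          calc _ ≤ (1 + 4 / (4 * (k : ℝ))) * (16 * (k : ℝ) ^ 2 * B) +
              (4 * (4 * (k : ℝ)) + 3) * B := by gcongr
            _ = (16 * (k : ℝ) ^ 2 + 32 * k + 3) * B := by field_simp; ring
            _ ≤ (16 * ((k : ℝ) + 1) ^ 2) * B := by gcongr; nlinarith
            _ = _ := by push_cast; ring
    have := (key (n - m) (by rwa [Nat.add_sub_cancel' hmn])).2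
    rw [Nat.add_sub_cancel' hmn, Nat.cast_sub hmn] at this
    refine this.trans (le_of_eq ?_)
    rw [hw]; field_simp
  nlinarith

theorem IsIncrementScheme.exists_moment_bound (τ K : ℝ) (hK : 0 ≤ K) : ∃ K' : ℝ, 0 ≤ K' ∧
    ∀ (T : ℕ) (I : Finset ℕ) (D : ℝ → ℕ → Ω → ℝ) (a g : ℕ → ℕ → Ω → ℝ) (ℱ : ℕ → MeasurableSpace Ω),
      1 ≤ T → IsIncrementScheme P τ K T I D a g ℱ → ∀ i ∈ I,
        ∀ s ∈ Set.Icc 0 τ, MemLp (D s i) 4 P ∧ ∀ s' ∈ Set.Icc 0 τ,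
          ∫ ω, (D s i ω - D s' i ω) ^ 4 ∂P ≤ K' * |s - s'| ^ 2 := by
  have hβ0 := schemeBound_nonneg (τ := τ) hK
  set β := schemeBound K τ
  set K₁ := 27 * (2 * β + K ^ 4 * τ ^ 2) + 27 * (β * τ ^ 2 + K ^ 4 * τ ^ 2 + 16 * β) with hK₁
  have hK₁0 : 0 ≤ K₁ := by positivity
  refine ⟨3 * 8 ^ 2 * K₁, by positivity, ?_⟩
  intro T I D a g ℱ hT h i hi
  have hT1 : (1 : ℝ) ≤ T := by exact_mod_cast hT
  have hT0 : (0 : ℝ) < T := by linarith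
  have hcell := h.cell_le hT hK hi
  have hmem := fun s => h.memLp hT hK hi (s := s)
  have hnodes := fun m n => h.nodes_le hT hK hi (m := m) (n := n)
  intro s hs
  refine ⟨hmem s hs, ?_⟩
  have main : ∀ s ∈ Set.Icc 0 τ, ∀ s' ∈ Set.Icc 0 τ, s ≤ s' →
      ∫ ω, (D s' i ω - D s i ω) ^ 4 ∂P ≤ 3 * 8 ^ 2 * K₁ * (s' - s) ^ 2 := by
    intro s hs s' hs' hss
    have := le_of_cells (ψ := fun x y => ∫ ω, (D (y / T) i ω - D (x / T) i ω) ^ 4 ∂P)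
      (G := fun u => K₁ * (u / T) ^ 2) (b := τ * T) (c := 8) (by norm_num)
      (fun u hu v _ huv => by
        have : 0 ≤ u / T := div_nonneg hu hT0.le
        dsimp only
        gcongr) (fun u _ => by positivity) (fun x y z hx hxy hyz hz => ?_)
      (fun n x y hnx hxy hyn hyb => ?_) (fun m n hmn hn => ?_) (s * T) (s' * T)
      (mul_nonneg hs.1 hT0.le) (by gcongr) (by have := hs'.2; gcongr)
    · simp only [mul_div_cancel_right₀ _ hT0.ne'] at this
      refine this.trans (le_of_eq ?_)
      rw [← sub_mul, mul_div_cancel_right₀ _ hT0.ne']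
      ring
    · have hx' : x / T ∈ Set.Icc 0 τ := ⟨by positivity, by rw [div_le_iff₀ hT0]; linarith⟩
      have hy' : y / T ∈ Set.Icc 0 τ :=
        ⟨div_nonneg (by linarith) hT0.le, by rw [div_le_iff₀ hT0]; linarith⟩
      have hz' : z / T ∈ Set.Icc 0 τ :=
        ⟨div_nonneg (by linarith) hT0.le, by rw [div_le_iff₀ hT0]; linarith⟩
      have := integral_add_pow_four_le' ((hmem _ hy').sub (hmem _ hx'))
        ((hmem _ hz').sub (hmem _ hy'))
      refine le_trans (le_of_eq ?_) this
      congr 1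
      ext ω
      simp only [Pi.sub_apply]
      ring
    · refine (hcell n (x / T) (y / T) (by gcongr) (by gcongr) ?_ ?_).2.trans ?_
      · rw [← add_div]; gcongr
      · rw [div_le_iff₀ hT0]; exact hyb
      · rw [← sub_div]
        gcongr
        have : 0 ≤ 27 * (β * τ ^ 2 + K ^ 4 * τ ^ 2 + 16 * β) := by positivity
        linarith
    · refine (hnodes m n hmn hn).trans ?_
      gcongr
      have : 0 ≤ 27 * (2 * β + K ^ 4 * τ ^ 2) := by positivity
      linarith
  intro s' hs'
  rw [sq_abs]
  rcases le_total s s' with hle | hle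
  · have := main s hs s' hs' hle
    rw [show (s - s') ^ 2 = (s' - s) ^ 2 by ring]
    refine le_trans (le_of_eq ?_) this
    congr 1; ext ω; ring
  · exact main s' hs' s hs hle

end Scheme


/-! ### Independence -/

section Independence

variable {Ω : Type*} {m₁ m₂ m₃ : MeasurableSpace Ω} [mΩ : MeasurableSpace Ω] {P : Measure Ω}

/-- The intersections `u ∩ v` form a π-system generating `m₂ ⊔ m₃`. There the product formula
follows by splitting off `v` twice and separating `s` from `u`. -/
theorem indep_sup_right [IsProbabilityMeasure P] (h₁ : m₁ ≤ mΩ) (h₂ : m₂ ≤ mΩ) (h₃ : m₃ ≤ mΩ)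
    (h12 : Indep m₁ m₂ P) (h123 : Indep (m₁ ⊔ m₂) m₃ P) : Indep m₁ (m₂ ⊔ m₃) P := by
  set p : Set (Set Ω) := {s | ∃ u v, MeasurableSet[m₂] u ∧ MeasurableSet[m₃] v ∧ s = u ∩ v} with hp
  have hpi : IsPiSystem p := by
    rintro _ ⟨u, v, hu, hv, rfl⟩ _ ⟨u', v', hu', hv', rfl⟩ -
    exact ⟨u ∩ u', v ∩ v', hu.inter hu', hv.inter hv', by ac_rfl⟩
  have hgen : m₂ ⊔ m₃ = MeasurableSpace.generateFrom p := by
    apply le_antisymm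
    · refine sup_le (fun u hu => ?_) (fun v hv => ?_)
      · exact MeasurableSpace.measurableSet_generateFrom ⟨u, Set.univ, hu, MeasurableSet.univ, by simp⟩
      · exact MeasurableSpace.measurableSet_generateFrom ⟨Set.univ, v, MeasurableSet.univ, hv, by simp⟩
    · refine MeasurableSpace.generateFrom_le ?_
      rintro _ ⟨u, v, hu, hv, rfl⟩
      exact MeasurableSet.inter (le_sup_left (a := m₂) (b := m₃) u hu)
        (le_sup_right (a := m₂) (b := m₃) v hv)
  refine IndepSets.indep h₁ (sup_le h₂ h₃) (@MeasurableSpace.isPiSystem_measurableSet Ω m₁) hpi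
    (@MeasurableSpace.generateFrom_measurableSet Ω m₁).symm hgen ?_
  rw [IndepSets_iff]
  rintro s _ hs ⟨u, v, hu, hv, rfl⟩
  have hs' : MeasurableSet[m₁] s := hs
  rw [Indep_iff] at h12 h123
  have e1 := h123 (s ∩ u) v (MeasurableSet.inter (le_sup_left (a := m₁) (b := m₂) s hs')
    (le_sup_right (a := m₁) (b := m₂) u hu)) hv
  have e2 := h123 u v (le_sup_right (a := m₁) (b := m₂) u hu) hv
  rw [← Set.inter_assoc, e1, h12 s u hs' hu, e2, mul_assoc]

theorem indepFun_of_measurable (h : Indep m₁ m₂ P) {q r : Ω → ℝ}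
    (hq : Measurable[m₁] q) (hr : Measurable[m₂] r) : IndepFun q r P := by
  rw [IndepFun_iff_Indep]
  exact indep_of_indep_of_le_left (indep_of_indep_of_le_right h hr.comap_le) hq.comap_le

theorem memLp_mul_of_indep (h₁ : m₁ ≤ mΩ) (h₂ : m₂ ≤ mΩ)
    (h : Indep m₁ m₂ P) {q r : Ω → ℝ} (hq : Measurable[m₁] q) (hr : Measurable[m₂] r)
    (hq4 : MemLp q 4 P) (hr4 : MemLp r 4 P) :
    MemLp (fun ω => q ω * r ω) 4 P ∧
      ∫ ω, (q ω * r ω) ^ 4 ∂P = (∫ ω, q ω ^ 4 ∂P) * ∫ ω, r ω ^ 4 ∂P := by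
  have hind : IndepFun (fun ω => q ω ^ 4) (fun ω => r ω ^ 4) P :=
    indepFun_of_measurable h (hq.pow_const 4) (hr.pow_const 4)
  have hint := hind.integrable_mul (integrable_pow_four hq4) (integrable_pow_four hr4)
  have e : (fun ω => (q ω * r ω) ^ 4) = (fun ω => q ω ^ 4) * fun ω => r ω ^ 4 := by
    ext ω; simp [mul_pow]
  refine ⟨memLp_four_of_integrable ?_ ?_, ?_⟩
  · exact ((hq.mono h₁ le_rfl).mul (hr.mono h₂ le_rfl)).aestronglyMeasurable
  · rw [e]; exact hint
  · rw [e]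
    exact hind.integral_mul_eq_mul_integral (integrable_pow_four hq4).aestronglyMeasurable
      (integrable_pow_four hr4).aestronglyMeasurable

/-- The centred factor `q` is independent of `Y³ r`, so the mean of `q` factors out. The product
formula requires no integrability of `Y³ r`. -/
theorem integral_cube_mul_eq_zero (h₂ : m₂ ≤ mΩ)
    (h : Indep m₁ m₂ P) {q r Y : Ω → ℝ} (hq : Measurable[m₁] q) (hr : Measurable[m₂] r)
    (hY : Measurable[m₂] Y) (hq4 : MemLp q 4 P) (hq0 : ∫ ω, q ω ∂P = 0) :
    ∫ ω, Y ω ^ 3 * (q ω * r ω) ∂P = 0 := by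
  have hm : Measurable[m₂] (fun ω => Y ω ^ 3 * r ω) := (hY.pow_const 3).mul hr
  have hind : IndepFun q (fun ω => Y ω ^ 3 * r ω) P := indepFun_of_measurable h hq hm
  have e := hind.integral_mul_eq_mul_integral hq4.1 (hm.mono h₂ le_rfl).aestronglyMeasurable
  rw [hq0, zero_mul] at e
  rw [← e]
  refine integral_congr_ae (Eventually.of_forall fun ω => ?_)
  simp only [Pi.mul_apply]
  ring

end Independence

/-! ### Moments of the data process -/

section Data

variable {Ω : Type*} [MeasurableSpace Ω] {P : Measure Ω} [IsProbabilityMeasure P]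
  {W : ℝ≥0 → unitInterval → Ω → ℝ} {A : unitInterval → unitInterval → ℝ}
  {B : (Fin 4 → unitInterval) → ℝ} {E : (Fin 8 → unitInterval) → ℝ}

theorem IsDataProcess.memLp_four (hW : IsDataProcess P W A B E) (s : ℝ≥0) (x : unitInterval) :
    MemLp (W s x) 4 P := (hW.memLp s x).mono_exponent (by norm_num)

omit [IsProbabilityMeasure P] in
theorem memLp_four_mul {X Y : Ω → ℝ}
    (hX : MemLp X 8 P) (hY : MemLp Y 8 P) : MemLp (fun ω => X ω * Y ω) 4 P := by
  have : ENNReal.HolderTriple 8 8 4 := ⟨by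
    rw [← ENNReal.toReal_eq_toReal_iff' (by simp) (by simp), ENNReal.toReal_add (by simp) (by simp)]
    norm_num⟩
  exact MemLp.mul' hY hX

theorem IsDataProcess.integrable_prod_four (hW : IsDataProcess P W A B E) (s : ℝ≥0)
    (z : Fin 4 → unitInterval) : Integrable (fun ω => ∏ k, W s (z k) ω) P := by
  have := MemLp.prod' (s := Finset.univ) (f := fun k => W s (z k)) (p := fun _ => 4)
    (μ := P) fun k _ => hW.memLp_four s (z k)
  rw [← memLp_one_iff_integrable]
  convert this using 1
  rw [Finset.sum_const, Finset.card_univ, Fintype.card_fin, nsmul_eq_mul]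
  rw [show ((4 : ℕ) : ENNReal) = 4 by norm_num, ENNReal.mul_inv_cancel (by norm_num) (by norm_num)]
  simp

omit [IsProbabilityMeasure P] in
theorem IsDataProcess.integrable_prod_eight (hW : IsDataProcess P W A B E) (s : ℝ≥0)
    (z : Fin 8 → unitInterval) : Integrable (fun ω => ∏ k, W s (z k) ω) P := by
  have := MemLp.prod' (s := Finset.univ) (f := fun k => W s (z k)) (p := fun _ => 8)
    (μ := P) fun k _ => hW.memLp s (z k)
  rw [← memLp_one_iff_integrable]
  convert this using 1
  rw [Finset.sum_const, Finset.card_univ, Fintype.card_fin, nsmul_eq_mul]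
  rw [show ((8 : ℕ) : ENNReal) = 8 by norm_num, ENNReal.mul_inv_cancel (by norm_num) (by norm_num)]
  simp

omit [IsProbabilityMeasure P] in
theorem integral_five {f₁ f₂ f₃ f₄ f₅ : Ω → ℝ} (h₁ : Integrable f₁ P) (h₂ : Integrable f₂ P)
    (h₃ : Integrable f₃ P) (h₄ : Integrable f₄ P) (h₅ : Integrable f₅ P) :
    ∫ ω, (f₁ ω + f₂ ω + 6 * f₃ ω - 4 * f₄ ω - 4 * f₅ ω) ∂P =
      ∫ ω, f₁ ω ∂P + ∫ ω, f₂ ω ∂P + 6 * ∫ ω, f₃ ω ∂P - 4 * ∫ ω, f₄ ω ∂P - 4 * ∫ ω, f₅ ω ∂P := by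
  have a1 : Integrable (fun ω => f₁ ω + f₂ ω) P := h₁.add h₂
  have a2 : Integrable (fun ω => f₁ ω + f₂ ω + 6 * f₃ ω) P := a1.add (h₃.const_mul 6)
  have a3 : Integrable (fun ω => f₁ ω + f₂ ω + 6 * f₃ ω - 4 * f₄ ω) P := a2.sub (h₄.const_mul 4)
  rw [integral_sub a3 (h₅.const_mul 4), integral_sub a2 (h₄.const_mul 4),
    integral_add a1 (h₃.const_mul 6), integral_add h₁ h₂, integral_const_mul, integral_const_mul,
    integral_const_mul]

/-- Binomial expansion; it identifies the alternating sums of the smoothness hypotheses as fourth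
moments of spatial increments. -/
theorem IsDataProcess.integral_sub_pow_four (hW : IsDataProcess P W A B E) (s : ℝ≥0)
    (x y : unitInterval) : ∫ ω, (W s x ω - W s y ω) ^ 4 ∂P =
      B ![x, x, x, x] + B ![y, y, y, y] + 6 * B ![x, x, y, y] - 4 * B ![x, x, x, y]
        - 4 * B ![x, y, y, y] := by
  simp only [← hW.fourth s]
  rw [← integral_five (hW.integrable_prod_four s _) (hW.integrable_prod_four s _)
    (hW.integrable_prod_four s _) (hW.integrable_prod_four s _) (hW.integrable_prod_four s _)]
  refine integral_congr_ae (Eventually.of_forall fun ω => ?_)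
  simp only [Fin.prod_univ_four, Matrix.cons_val]
  ring

omit [IsProbabilityMeasure P] in
theorem IsDataProcess.integral_sub_pow_four_mul (hW : IsDataProcess P W A B E) (s : ℝ≥0)
    (x y z : unitInterval) : ∫ ω, ((W s x ω - W s y ω) * W s z ω) ^ 4 ∂P =
      E ![x, x, x, x, z, z, z, z] + E ![y, y, y, y, z, z, z, z] + 6 * E ![x, x, y, y, z, z, z, z]
        - 4 * E ![x, x, x, y, z, z, z, z] - 4 * E ![x, y, y, y, z, z, z, z] := by
  simp only [← hW.eighth s]
  rw [← integral_five (hW.integrable_prod_eight s _) (hW.integrable_prod_eight s _)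
    (hW.integrable_prod_eight s _) (hW.integrable_prod_eight s _) (hW.integrable_prod_eight s _)]
  refine integral_congr_ae (Eventually.of_forall fun ω => ?_)
  simp only [Fin.prod_univ_eight, Matrix.cons_val]
  ring

theorem IsDataProcess.integrable_mul (hW : IsDataProcess P W A B E) (s : ℝ≥0)
    (x y : unitInterval) : Integrable (fun ω => W s x ω * W s y ω) P :=
  (memLp_four_mul (hW.memLp s x) (hW.memLp s y)).integrable (by norm_num)

theorem IsDataProcess.integral_sub_sq (hW : IsDataProcess P W A B E) (s : ℝ≥0)
    (x y : unitInterval) : ∫ ω, (W s x ω - W s y ω) ^ 2 ∂P = A x x + A y y - 2 * A x y := by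
  have e : ∀ ω, (W s x ω - W s y ω) ^ 2 =
      W s x ω * W s x ω + W s y ω * W s y ω - 2 * (W s x ω * W s y ω) := fun ω => by ring
  have i1 : Integrable (fun ω => W s x ω * W s x ω + W s y ω * W s y ω) P :=
    (hW.integrable_mul s x x).add (hW.integrable_mul s y y)
  simp only [e]
  rw [integral_sub i1 ((hW.integrable_mul s x y).const_mul 2),
    integral_add (hW.integrable_mul s x x) (hW.integrable_mul s y y), integral_const_mul,
    hW.second, hW.second, hW.second]

/-- A mixed second difference of `A` is the covariance of two spatial increments of `W`.
Cauchy–Schwarz therefore bounds it by the diagonal hypothesis alone. -/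
theorem IsDataProcess.exists_isSmoothKernel (hW : IsDataProcess P W A B E)
    (hM : SmoothMoments A B E) : ∃ K, IsSmoothKernel A K := by
  obtain ⟨C₂, h2⟩ := hM.A_bound
  obtain ⟨C₃, h3⟩ := hM.A_lip
  obtain ⟨C₄, h4⟩ := hM.A_diag
  have hC₂ : 0 ≤ C₂ := (abs_nonneg _).trans (h2 0 0)
  have hC₃ : 0 ≤ C₃ := by simpa using (abs_nonneg _).trans (h3 0 1 0)
  refine ⟨C₂ + C₃ + C₄ ^ 2, ⟨fun x y => ?_, fun x y => ?_, fun x y z => ?_, fun x x' y y' => ?_,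
    hM.A_contDiff⟩⟩
  · rw [← hW.second 0, ← hW.second 0]
    simp only [mul_comm]
  · exact (h2 x y).trans (by nlinarith [sq_nonneg C₄])
  · exact (h3 x y z).trans (mul_le_mul_of_nonneg_right (by nlinarith [sq_nonneg C₄]) (abs_nonneg _))
  · set p := |(x : ℝ) - x'| with hp
    set q := |(y : ℝ) - y'| with hq
    have hp0 : 0 ≤ p := abs_nonneg _
    have hq0 : 0 ≤ q := abs_nonneg _
    suffices h : |A x y - A x' y - (A x y' - A x' y')| ≤ C₄ ^ 2 * p * q by
      refine h.trans ?_
      gcongr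
      linarith
    rcases hp0.lt_or_eq with hp1 | hp1
    swap
    · have : x = x' := Subtype.ext (sub_eq_zero.1 (abs_eq_zero.1 hp1.symm))
      subst this
      simp [← hp1]
    rcases hq0.lt_or_eq with hq1 | hq1
    swap
    · have : y = y' := Subtype.ext (sub_eq_zero.1 (abs_eq_zero.1 hq1.symm))
      subst this
      simp [← hq1]
    have i1 : MemLp (fun ω => W 0 x ω - W 0 x' ω) 8 P := (hW.memLp 0 x).sub (hW.memLp 0 x')
    have i2 : MemLp (fun ω => W 0 y ω - W 0 y' ω) 8 P := (hW.memLp 0 y).sub (hW.memLp 0 y')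
    have iuv := (memLp_four_mul i1 i2).integrable (by norm_num)
    have iu : Integrable (fun ω => (W 0 x ω - W 0 x' ω) ^ 2) P := by
      simpa only [sq] using (memLp_four_mul i1 i1).integrable (by norm_num)
    have iv : Integrable (fun ω => (W 0 y ω - W 0 y' ω) ^ 2) P := by
      simpa only [sq] using (memLp_four_mul i2 i2).integrable (by norm_num)
    have e : A x y - A x' y - (A x y' - A x' y') =
        ∫ ω, (W 0 x ω - W 0 x' ω) * (W 0 y ω - W 0 y' ω) ∂P := by
      have e1 : ∀ ω, (W 0 x ω - W 0 x' ω) * (W 0 y ω - W 0 y' ω) =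
        (W 0 x ω * W 0 y ω - W 0 x' ω * W 0 y ω) - (W 0 x ω * W 0 y' ω - W 0 x' ω * W 0 y' ω) :=
          fun ω => by ring
      simp only [e1]
      rw [integral_sub (f := fun ω => W 0 x ω * W 0 y ω - W 0 x' ω * W 0 y ω)
        (g := fun ω => W 0 x ω * W 0 y' ω - W 0 x' ω * W 0 y' ω)
        ((hW.integrable_mul 0 x y).sub (hW.integrable_mul 0 x' y))
        ((hW.integrable_mul 0 x y').sub (hW.integrable_mul 0 x' y')),
        integral_sub (hW.integrable_mul 0 x y) (hW.integrable_mul 0 x' y),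
        integral_sub (hW.integrable_mul 0 x y') (hW.integrable_mul 0 x' y')]
      simp only [hW.second]
    have bu : ∫ ω, (W 0 x ω - W 0 x' ω) ^ 2 ∂P ≤ C₄ ^ 2 * p ^ 2 := by
      rw [hW.integral_sub_sq]; exact (le_abs_self _).trans (h4 x x')
    have bv : ∫ ω, (W 0 y ω - W 0 y' ω) ^ 2 ∂P ≤ C₄ ^ 2 * q ^ 2 := by
      rw [hW.integral_sub_sq]; exact (le_abs_self _).trans (h4 y y')
    -- Cauchy–Schwarz in the form `2 p q |u v| ≤ q² u² + p² v²`. Dividing by `2 p q` is the reason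
    -- for treating `p = 0` and `q = 0` beforehand.
    have key : |2 * p * q * ∫ ω, (W 0 x ω - W 0 x' ω) * (W 0 y ω - W 0 y' ω) ∂P| ≤
        q ^ 2 * (C₄ ^ 2 * p ^ 2) + p ^ 2 * (C₄ ^ 2 * q ^ 2) := by
      rw [← integral_const_mul]
      calc _ ≤ ∫ ω, |2 * p * q * ((W 0 x ω - W 0 x' ω) * (W 0 y ω - W 0 y' ω))| ∂P :=
            abs_integral_le_integral_abs
        _ ≤ ∫ ω, q ^ 2 * (W 0 x ω - W 0 x' ω) ^ 2 + p ^ 2 * (W 0 y ω - W 0 y' ω) ^ 2 ∂P := by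
            refine integral_mono (iuv.const_mul _).abs ((iu.const_mul _).add (iv.const_mul _))
              fun ω => ?_
            dsimp only
            rw [abs_le]
            constructor <;> nlinarith [sq_nonneg (q * (W 0 x ω - W 0 x' ω) - p * (W 0 y ω - W 0 y' ω)),
              sq_nonneg (q * (W 0 x ω - W 0 x' ω) + p * (W 0 y ω - W 0 y' ω))]
        _ = q ^ 2 * ∫ ω, (W 0 x ω - W 0 x' ω) ^ 2 ∂P + p ^ 2 * ∫ ω, (W 0 y ω - W 0 y' ω) ^ 2 ∂P := by
            rw [integral_add (iu.const_mul _) (iv.const_mul _), integral_const_mul,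
              integral_const_mul]
        _ ≤ _ := by gcongr
    rw [abs_mul, abs_of_pos (by positivity : 0 < 2 * p * q), ← e] at key
    have hpq : 0 < 2 * p * q := by positivity
    refine le_of_mul_le_mul_left (key.trans (le_of_eq ?_)) hpq
    ring

/-- Moment bounds for the discrete derivatives of the samples. -/
theorem IsDataProcess.exists_disc_moments (hW : IsDataProcess P W A B E)
    (hM : SmoothMoments A B E) : ∃ K : ℝ, 0 ≤ K ∧ ∀ (d : ℕ) (s : ℝ≥0), 1 ≤ d →
      ∀ i ∈ Finset.Icc 1 d, ∃ X : Ω → ℝ,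
        (∀ ω, X ω = disc d (fun j => W s (gridPoint d j) ω) i) ∧ MemLp X 8 P ∧
        ∫ ω, X ω ∂P = 0 ∧ ∫ ω, X ω ^ 4 ∂P ≤ K ∧
        ∀ y, ∫ ω, (X ω * W s y ω) ^ 4 ∂P ≤ K ∧
          ∫ ω, X ω * W s y ω ∂P = disc d (fun j => A (gridPoint d j) y) i := by
  obtain ⟨C₅, h5⟩ := hM.B_bound
  obtain ⟨C₇, h7⟩ := hM.B_fourth
  obtain ⟨C₈, h8⟩ := hM.E_bound
  obtain ⟨C₉, h9⟩ := hM.E_fourth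
  have p5 := abs_nonneg C₅
  have p8 := abs_nonneg C₈
  have p7 : 0 ≤ C₇ ^ 4 := by positivity
  have p9 : 0 ≤ C₉ ^ 4 := by positivity
  refine ⟨|C₅| + |C₈| + C₇ ^ 4 + C₉ ^ 4, by positivity, fun d s hd i hi => ?_⟩
  have hd' : (0 : ℝ) < d := by positivity
  rw [Finset.mem_Icc] at hi
  obtain ⟨i, rfl⟩ : ∃ k, i = k + 1 := ⟨i - 1, by omega⟩
  rcases Nat.eq_zero_or_pos i with rfl | h
  · simp only [zero_add, disc_one]
    refine ⟨W s (gridPoint d 1), fun _ => rfl, hW.memLp s _, hW.mean s _, ?_, fun y => ⟨?_, ?_⟩⟩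
    · have e := hW.fourth s ![gridPoint d 1, gridPoint d 1, gridPoint d 1, gridPoint d 1]
      simp only [Fin.prod_univ_four, Matrix.cons_val] at e
      have hb := (le_abs_self _).trans (h5 ![gridPoint d 1, gridPoint d 1, gridPoint d 1,
        gridPoint d 1])
      rw [← e] at hb
      have e2 : ∀ ω, W s (gridPoint d 1) ω ^ 4 = W s (gridPoint d 1) ω * W s (gridPoint d 1) ω *
        W s (gridPoint d 1) ω * W s (gridPoint d 1) ω := fun ω => by ring
      simp only [e2]
      linarith [le_abs_self C₅]
    · have e := hW.eighth s ![gridPoint d 1, gridPoint d 1, gridPoint d 1, gridPoint d 1, y, y, y, y]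
      simp only [Fin.prod_univ_eight, Matrix.cons_val] at e
      have hb := h8 ![gridPoint d 1, gridPoint d 1, gridPoint d 1, gridPoint d 1, y, y, y, y]
      rw [← e] at hb
      have e2 : ∀ ω, (W s (gridPoint d 1) ω * W s y ω) ^ 4 = W s (gridPoint d 1) ω *
        W s (gridPoint d 1) ω * W s (gridPoint d 1) ω * W s (gridPoint d 1) ω * W s y ω * W s y ω *
        W s y ω * W s y ω := fun ω => by ring
      simp only [e2]
      linarith [le_abs_self C₈]
    · exact hW.second s _ y
  · have hg := abs_gridPoint_sub hd hi.2
    set x := gridPoint d (i + 1) with hx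
    set x' := gridPoint d i with hx'
    simp only [disc_succ _ _ h]
    refine ⟨fun ω => (d : ℝ) * (W s x ω - W s x' ω), fun _ => rfl,
      ((hW.memLp s x).sub (hW.memLp s x')).const_mul _, ?_, ?_, fun y => ⟨?_, ?_⟩⟩
    · rw [integral_const_mul, integral_sub ((hW.memLp s x).integrable (by norm_num))
        ((hW.memLp s x').integrable (by norm_num)), hW.mean, hW.mean]
      simp
    · rw [integral_const_mul_pow_four, hW.integral_sub_pow_four]
      have hb := (le_abs_self _).trans (h7 x x')
      rw [hg] at hb
      calc _ ≤ (d : ℝ) ^ 4 * (C₇ ^ 4 * (1 / d) ^ 4) := by gcongr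
        _ = C₇ ^ 4 := by field_simp
        _ ≤ _ := by linarith
    · simp only [mul_assoc]
      rw [integral_const_mul_pow_four, hW.integral_sub_pow_four_mul]
      have hb := (le_abs_self _).trans (h9 x x' y y y y)
      rw [hg] at hb
      calc _ ≤ (d : ℝ) ^ 4 * (C₉ ^ 4 * (1 / d) ^ 4) := by gcongr
        _ = C₉ ^ 4 := by field_simp
        _ ≤ _ := by linarith
    · simp only [mul_assoc, sub_mul]
      rw [integral_const_mul, integral_sub (hW.integrable_mul s x y) (hW.integrable_mul s x' y),
        hW.second, hW.second]

/-! ### The information of the past -/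

/-- The information generated by the random variable `Z` and by the samples before step `t`. -/
@[reducible] noncomputable def past {β : Type*} [MeasurableSpace β] (W : ℝ≥0 → unitInterval → Ω → ℝ) (T : ℕ) (Z : Ω → β)
    (t : ℕ) : MeasurableSpace Ω :=
  (⨆ r ∈ Set.Iio t, MeasurableSpace.comap
    (fun ω (x : unitInterval) => W ((r : ℝ≥0) / (T : ℝ≥0)) x ω) inferInstance) ⊔
    MeasurableSpace.comap Z inferInstance

/-- The information generated by the sample of step `t`. -/
@[reducible] noncomputable def present (W : ℝ≥0 → unitInterval → Ω → ℝ) (T : ℕ) (t : ℕ) : MeasurableSpace Ω :=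
  MeasurableSpace.comap
    (fun ω (x : unitInterval) => W ((t : ℝ≥0) / (T : ℝ≥0)) x ω) inferInstance

variable {β : Type*} [MeasurableSpace β] {Z : Ω → β}

omit [MeasurableSpace Ω] in
theorem past_mono (W : ℝ≥0 → unitInterval → Ω → ℝ) (T : ℕ) (Z : Ω → β) :
    Monotone (past W T Z) := fun _ _ h =>
  sup_le_sup_right (biSup_mono fun _ hr => lt_of_lt_of_le hr h) _

omit [MeasurableSpace Ω] in
theorem present_le_past_succ (W : ℝ≥0 → unitInterval → Ω → ℝ) (T : ℕ) (Z : Ω → β) (t : ℕ) :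
    present W T t ≤ past W T Z (t + 1) :=
  le_sup_of_le_left (le_biSup (fun r : ℕ => MeasurableSpace.comap
    (fun ω (x : unitInterval) => W ((r : ℝ≥0) / (T : ℝ≥0)) x ω) inferInstance)
    (show t ∈ Set.Iio (t + 1) from Nat.lt_succ_self t))

omit [MeasurableSpace Ω] in
theorem measurable_past (W : ℝ≥0 → unitInterval → Ω → ℝ) (T : ℕ) (Z : Ω → β) (t : ℕ) :
    Measurable[past W T Z t] Z :=
  (comap_measurable Z).mono le_sup_right le_rfl

omit [MeasurableSpace Ω] in
theorem measurable_present (W : ℝ≥0 → unitInterval → Ω → ℝ) (T t : ℕ) (x : unitInterval) :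
    Measurable[present W T t] (W ((t : ℝ≥0) / (T : ℝ≥0)) x) :=
  (measurable_pi_apply x).comp
    (comap_measurable (fun ω (x : unitInterval) => W ((t : ℝ≥0) / (T : ℝ≥0)) x ω))

omit [IsProbabilityMeasure P] in
theorem IsDataProcess.present_le (hW : IsDataProcess P W A B E) (T t : ℕ) :
    present W T t ≤ ‹MeasurableSpace Ω› :=
  (measurable_pi_iff.2 fun x => hW.measurable _ x).comap_le

omit [IsProbabilityMeasure P] in
theorem IsDataProcess.past_le (hW : IsDataProcess P W A B E) (hZ : Measurable Z) (T t : ℕ) :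
    past W T Z t ≤ ‹MeasurableSpace Ω› :=
  sup_le (iSup₂_le fun r _ => hW.present_le T r) hZ.comap_le

/-- Whiteness in time separates the present sample from the earlier ones, since `t ↦ t / T` is
injective. The variable `Z` is independent of all samples together, so it may carry the noises of
every time, future ones included. -/
theorem IsDataProcess.indep_present_past (hW : IsDataProcess P W A B E) (hZ : Measurable Z)
    (hind : IndepFun (fun (ω : Ω) (p : ℝ≥0 × unitInterval) => W p.1 p.2 ω) Z P) {T : ℕ}
    (hT : 1 ≤ T) (t : ℕ) : Indep (present W T t) (past W T Z t) P := by
  have hT' : (0 : ℝ≥0) < T := by exact_mod_cast hT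
  have hinj : Function.Injective fun r : ℕ => (r : ℝ≥0) / (T : ℝ≥0) := by
    intro a b hab
    have hab' : (a : ℝ≥0) / (T : ℝ≥0) = (b : ℝ≥0) / (T : ℝ≥0) := hab
    rw [div_left_inj' hT'.ne'] at hab'
    exact_mod_cast hab'
  have h1 : iIndep (fun r : ℕ => present W T r) P := by
    have := hW.white
    rw [iIndepFun_iff_iIndep] at this
    exact this.precomp hinj
  have h2 := indep_iSup_of_disjoint (fun r => hW.present_le T r) h1
    (S := {t}) (T := Set.Iio t) (by simp)
  simp only [Set.mem_singleton_iff, iSup_iSup_eq_left] at h2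
  refine indep_sup_right (hW.present_le T t) (iSup₂_le fun r _ => hW.present_le T r) hZ.comap_le
    h2 ?_
  rw [IndepFun_iff_Indep] at hind
  refine indep_of_indep_of_le_left hind ?_
  have hle : ∀ r, present W T r ≤ MeasurableSpace.comap
      (fun (ω : Ω) (p : ℝ≥0 × unitInterval) => W p.1 p.2 ω) inferInstance := by
    intro r
    have hres : Measurable fun (w : ℝ≥0 × unitInterval → ℝ) (x : unitInterval) =>
        w ((r : ℝ≥0) / (T : ℝ≥0), x) := measurable_pi_lambda _ fun x => measurable_pi_apply _
    exact (hres.comp (comap_measurable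
      (fun (ω : Ω) (p : ℝ≥0 × unitInterval) => W p.1 p.2 ω))).comap_le
  exact sup_le (hle t) (iSup₂_le fun r _ => hle r)

end Data


/-! ### Interpolated arrays -/

/-- At `x = 1` the formula formally reads node `d + 1`, with weight zero. Bounding the difference by
`sob`, which sees only the nodes `1, …, d`, avoids any case distinction. -/
theorem spaceInterp_congr {d : ℕ} (hd : 1 ≤ d) {v w : ℕ → ℝ}
    (h : ∀ i ∈ Finset.Icc 1 d, v i = w i) : spaceInterp d v = spaceInterp d w := by
  have h0 : sob d v = sob d w := by
    ext i
    have hi := i.2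
    simp only [sob, LinearMap.coe_mk, AddHom.coe_mk]
    split_ifs with h1
    · exact h 1 (Finset.mem_Icc.2 ⟨le_rfl, hd⟩)
    · rw [h (i + 1) (Finset.mem_Icc.2 ⟨by omega, by omega⟩),
        h i (Finset.mem_Icc.2 ⟨by omega, by omega⟩)]
  have := norm_spaceInterp_sub_le hd v w
  rw [h0, sub_self, norm_zero, mul_zero] at this
  exact sub_eq_zero.1 (norm_le_zero_iff.1 this)

theorem spaceInterp_apply (d : ℕ) (v : ℕ → ℝ) (x : unitInterval) :
    spaceInterp d v x = linInterp (nodeValue v) ((d : ℝ) * x) := rfl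

theorem spaceInterp_smul (d : ℕ) (c : ℝ) (v : ℕ → ℝ) :
    spaceInterp d (fun j => c * v j) = c • spaceInterp d v := by
  ext x
  simp only [ContinuousMap.smul_apply, spaceInterp_apply, linInterp, nodeValue, smul_eq_mul]
  split_ifs <;> ring

theorem spaceInterp_gridPoint {d : ℕ} (v : ℕ → ℝ) {j : ℕ} (hj : j ∈ Finset.Icc 1 d) :
    spaceInterp d v (gridPoint d j) = v j := by
  rw [Finset.mem_Icc] at hj
  have hd' : (d : ℝ) ≠ 0 := by have : 1 ≤ d := by omega
                               positivity
  rw [spaceInterp_apply, coe_gridPoint (by omega) hj.2, mul_div_cancel₀ _ hd', linInterp_natCast,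
    nodeValue, if_neg (by omega)]

theorem spaceTimeInterp_apply {τ : ℝ} (d T : ℕ) (Δ : ℕ → ℕ → ℝ) (s : Set.Icc (0 : ℝ) τ) :
    spaceTimeInterp τ d T Δ s = spaceInterp d fun j => linInterp (fun t => Δ t j) ((s : ℝ) * T) := by
  ext x
  change linInterp (fun t => spaceInterp d (Δ t)) ((s : ℝ) * T) x = _
  simp only [spaceInterp_apply, linInterp, ContinuousMap.add_apply, ContinuousMap.smul_apply,
    nodeValue, smul_eq_mul]
  split_ifs <;> ring

/-- The extension by zero of an array indexed by a finite set. -/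
def extendArray {S : Finset (ℕ × ℕ)} (a : S → ℝ) (t j : ℕ) : ℝ :=
  if h : (t, j) ∈ S then a ⟨(t, j), h⟩ else 0

/-- The interpolation of finite arrays, as a linear map. -/
noncomputable def interpLinear (τ : ℝ) (d T : ℕ) (S : Finset (ℕ × ℕ)) :
    (S → ℝ) →ₗ[ℝ] PathSpace τ where
  toFun a := spaceTimeInterp τ d T (extendArray a)
  map_add' a b := by
    have e : ∀ t j, extendArray (a + b) t j = extendArray a t j + extendArray b t j := fun t j => by
      unfold extendArray; split_ifs <;> simp
    ext s x
    simp only [ContinuousMap.add_apply, spaceTimeInterp_apply, spaceInterp_apply, linInterp, e,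
      nodeValue, smul_eq_mul]
    split_ifs <;> ring
  map_smul' c a := by
    have e : ∀ t j, extendArray (c • a) t j = c * extendArray a t j := fun t j => by
      unfold extendArray; split_ifs <;> simp
    ext s x
    simp only [ContinuousMap.smul_apply, spaceTimeInterp_apply, spaceInterp_apply, linInterp, e,
      nodeValue, smul_eq_mul, RingHom.id_apply]
    split_ifs <;> ring

/-- On `[0, τ]` only finitely many array entries matter, and a linear map from a finite-dimensional
space into the path space is continuous, hence measurable. -/
theorem measurable_spaceTimeInterp {Ω : Type*} [MeasurableSpace Ω] {τ : ℝ} {d : ℕ} (hd : 1 ≤ d)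
    (T : ℕ) {Δ : Ω → ℕ → ℕ → ℝ} (hΔ : ∀ t, ∀ j ∈ Finset.Icc 1 d, Measurable fun ω => Δ ω t j) :
    Measurable fun ω => spaceTimeInterp τ d T (Δ ω) := by
  set S := Finset.range (⌊τ * T⌋₊ + 2) ×ˢ Finset.Icc 1 d with hS
  have hL : Continuous (interpLinear τ d T S) := LinearMap.continuous_of_finiteDimensional _
  have e : (fun ω => spaceTimeInterp τ d T (Δ ω)) =
      fun ω => interpLinear τ d T S fun p => Δ ω p.1.1 p.1.2 := by
    funext ω
    ext1 s
    change _ = spaceTimeInterp τ d T (extendArray fun p : S => Δ ω p.1.1 p.1.2) s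
    rw [spaceTimeInterp_apply, spaceTimeInterp_apply]
    refine spaceInterp_congr hd fun j hj => ?_
    have hfl : ⌊(s : ℝ) * T⌋₊ ≤ ⌊τ * T⌋₊ := Nat.floor_le_floor
      (mul_le_mul_of_nonneg_right s.2.2 (Nat.cast_nonneg T))
    have e1 : ∀ t ≤ ⌊τ * T⌋₊ + 1, Δ ω t j = extendArray (fun p : S => Δ ω p.1.1 p.1.2) t j := by
      intro t ht
      rw [extendArray, dif_pos]
      rw [hS, Finset.mem_product, Finset.mem_range]
      exact ⟨by simp only; omega, hj⟩
    simp only [linInterp]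
    rw [← e1 _ (by omega), ← e1 _ (by omega)]
  rw [e]
  refine hL.measurable.comp (measurable_pi_lambda _ fun p => ?_)
  exact hΔ _ _ (Finset.mem_product.1 p.2).2

/-! ### Moments of weighted sums -/

section Moments

variable {Ω : Type*} {m₁ m₂ : MeasurableSpace Ω} [mΩ : MeasurableSpace Ω] {P : Measure Ω}

theorem memLp_const_mul_sum {d : ℕ} (c : ℝ) {f : ℕ → Ω → ℝ} {b : ℝ}
    (hf : ∀ k ∈ Finset.Icc 1 d, MemLp (f k) 4 P ∧ ∫ ω, f k ω ^ 4 ∂P ≤ b) :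
    MemLp (fun ω => c * ∑ k ∈ Finset.Icc 1 d, f k ω) 4 P ∧
      ∫ ω, (c * ∑ k ∈ Finset.Icc 1 d, f k ω) ^ 4 ∂P ≤ (c * d) ^ 4 * b := by
  refine ⟨(memLp_finsetSum _ fun k hk => (hf k hk).1).const_mul c, ?_⟩
  rw [integral_const_mul_pow_four, mul_pow, mul_assoc]
  refine mul_le_mul_of_nonneg_left ?_ (by positivity)
  simpa using integral_sum_pow_four_le _ (fun k hk => (hf k hk).1) fun k hk => (hf k hk).2

/-- Bounds for the discrete derivatives give bounds for the nodes. -/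
theorem memLp_node_of_disc {d : ℕ} (hd : 1 ≤ d) {V : ℕ → Ω → ℝ} {φ : ℝ}
    (h : ∀ i ∈ Finset.Icc 1 d, MemLp (fun ω => disc d (fun j => V j ω) i) 4 P ∧
      ∫ ω, disc d (fun j => V j ω) i ^ 4 ∂P ≤ φ) {k : ℕ} (hk : k ∈ Finset.Icc 1 d) :
    MemLp (V k) 4 P ∧ ∫ ω, V k ω ^ 4 ∂P ≤ 16 * φ := by
  have hd' : (0 : ℝ) < d := by positivity
  rw [Finset.mem_Icc] at hk
  have h1 := h 1 (Finset.mem_Icc.2 ⟨le_rfl, hd⟩)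
  have hφ : 0 ≤ φ := (integral_pow_four_nonneg _).trans h1.2
  have hm : ∀ i ∈ Finset.Ico 1 k, i + 1 ∈ Finset.Icc 1 d := fun i hi => by
    rw [Finset.mem_Ico] at hi; exact Finset.mem_Icc.2 ⟨by omega, by omega⟩
  have hs : MemLp (fun ω => ∑ i ∈ Finset.Ico 1 k, disc d (fun j => V j ω) (i + 1)) 4 P :=
    memLp_finsetSum _ fun i hi => (h _ (hm i hi)).1
  have hs4 := integral_sum_pow_four_le (Finset.Ico 1 k)
    (f := fun i ω => disc d (fun j => V j ω) (i + 1))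
    (fun i hi => (h _ (hm i hi)).1) fun i hi => (h _ (hm i hi)).2
  have e : V k = fun ω => disc d (fun j => V j ω) 1 +
      1 / (d : ℝ) * ∑ i ∈ Finset.Ico 1 k, disc d (fun j => V j ω) (i + 1) :=
    funext fun ω => eq_sum_disc hd (fun j => V j ω) hk.1
  rw [e]
  refine ⟨h1.1.add (hs.const_mul _), (integral_add_pow_four_le' h1.1 (hs.const_mul _)).trans ?_⟩
  rw [integral_const_mul_pow_four]
  have hc : ((Finset.Ico 1 k).card : ℝ) ≤ d := by
    rw [Nat.card_Ico]; exact_mod_cast (by omega : k - 1 ≤ d)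
  have h2 : (1 / (d : ℝ)) ^ 4 * ∫ ω, (∑ i ∈ Finset.Ico 1 k, disc d (fun j => V j ω) (i + 1)) ^ 4 ∂P
      ≤ (1 / (d : ℝ)) ^ 4 * ((d : ℝ) ^ 4 * φ) := by
    refine mul_le_mul_of_nonneg_left (hs4.trans ?_) (by positivity)
    gcongr
  -- The node is the first value plus a normalised sum of discrete derivatives. Each has fourth
  -- moment at most `φ`, so `8 (φ + φ) = 16 φ`.
  have h3 : (1 / (d : ℝ)) ^ 4 * ((d : ℝ) ^ 4 * φ) = φ := by field_simp
  linarith [h1.2]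

/-- The fourth moment of a martingale increment: a noise and a sum of products of centred factors
that are independent of the past with factors that are determined by the past. -/
theorem memLp_mart_increment [IsProbabilityMeasure P] (h₁ : m₁ ≤ mΩ) (h₂ : m₂ ≤ mΩ)
    (h : Indep m₁ m₂ P) {d : ℕ} {X e : Ω → ℝ} {q g : ℕ → Ω → ℝ} {c₁ c₂ K S K' S' : ℝ}
    (hX : Measurable[m₁] X) (he : Measurable[m₂] e)
    (hX4 : MemLp X 4 P) (he4 : MemLp e 4 P) (hX0 : ∫ ω, X ω ∂P = 0)
    (hXK : ∫ ω, X ω ^ 4 ∂P ≤ K) (heS : ∫ ω, e ω ^ 4 ∂P ≤ S)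
    (hq : ∀ k ∈ Finset.Icc 1 d, Measurable[m₁] (q k) ∧ MemLp (q k) 4 P ∧ ∫ ω, q k ω ∂P = 0 ∧
      ∫ ω, q k ω ^ 4 ∂P ≤ K')
    (hg : ∀ k ∈ Finset.Icc 1 d, Measurable[m₂] (g k) ∧ MemLp (g k) 4 P ∧
      ∫ ω, g k ω ^ 4 ∂P ≤ S') :
    MemLp (fun ω => c₁ * (X ω * e ω) + c₂ * ∑ k ∈ Finset.Icc 1 d, q k ω * g k ω) 4 P ∧
    ∫ ω, (c₁ * (X ω * e ω) + c₂ * ∑ k ∈ Finset.Icc 1 d, q k ω * g k ω) ^ 4 ∂P ≤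
      8 * (c₁ ^ 4 * (K * S) + (c₂ * d) ^ 4 * (K' * S')) ∧
    ∀ Y : Ω → ℝ, Measurable[m₂] Y → MemLp Y 4 P →
      ∫ ω, Y ω ^ 3 * (c₁ * (X ω * e ω) + c₂ * ∑ k ∈ Finset.Icc 1 d, q k ω * g k ω) ∂P = 0 := by
  obtain ⟨a1, a2⟩ := memLp_mul_of_indep h₁ h₂ h hX he hX4 he4
  have b1 : ∀ k ∈ Finset.Icc 1 d, MemLp (fun ω => q k ω * g k ω) 4 P ∧
      ∫ ω, (q k ω * g k ω) ^ 4 ∂P ≤ K' * S' := fun k hk => by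
    obtain ⟨q1, q2, -, q4⟩ := hq k hk
    obtain ⟨g1, g2, g3⟩ := hg k hk
    obtain ⟨u1, u2⟩ := memLp_mul_of_indep h₁ h₂ h q1 g1 q2 g2
    refine ⟨u1, u2.le.trans ?_⟩
    exact mul_le_mul q4 g3 (integral_pow_four_nonneg _) ((integral_pow_four_nonneg _).trans q4)
  obtain ⟨b2, b3⟩ := memLp_const_mul_sum c₂ b1
  refine ⟨(a1.const_mul c₁).add b2, ?_, fun Y hY hY4 => ?_⟩
  · refine (integral_add_pow_four_le' (a1.const_mul c₁) b2).trans ?_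
    rw [integral_const_mul_pow_four, a2]
    have := mul_le_mul hXK heS (integral_pow_four_nonneg _) ((integral_pow_four_nonneg _).trans hXK)
    have h4 : (0 : ℝ) ≤ c₁ ^ 4 := by positivity
    have := mul_le_mul_of_nonneg_left this h4
    linarith
  · have e1 : ∀ ω, Y ω ^ 3 * (c₁ * (X ω * e ω) + c₂ * ∑ k ∈ Finset.Icc 1 d, q k ω * g k ω) =
        c₁ * (Y ω ^ 3 * (X ω * e ω)) +
          c₂ * ∑ k ∈ Finset.Icc 1 d, Y ω ^ 3 * (q k ω * g k ω) := fun ω => by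
      rw [← Finset.mul_sum]; ring
    have i1 := integrable_cube_mul hY4 a1
    have i2 : ∀ k ∈ Finset.Icc 1 d, Integrable (fun ω => Y ω ^ 3 * (q k ω * g k ω)) P :=
      fun k hk => integrable_cube_mul hY4 (b1 k hk).1
    simp only [e1]
    rw [integral_add (i1.const_mul _) ((integrable_finsetSum _ i2).const_mul _),
      integral_const_mul, integral_const_mul, integral_finsetSum _ i2,
      integral_cube_mul_eq_zero h₂ h hX he hY hX4 hX0, Finset.sum_eq_zero]
    · simp
    · intro k hk
      obtain ⟨q1, q2, q3, -⟩ := hq k hk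
      exact integral_cube_mul_eq_zero h₂ h q1 (hg k hk).1 hY q2 q3

end Moments

/-! ### The iterates -/

section Iterates

variable {Ω : Type*} {W : ℝ≥0 → unitInterval → Ω → ℝ} {α : ℝ} {d T : ℕ} {ε Δ₀ : ℕ → Ω → ℝ}

/-- The SGD iterates with step size `α / (d T)` and samples `W(t / T, i / d)`. -/
noncomputable def iterates (W : ℝ≥0 → unitInterval → Ω → ℝ) (α : ℝ) (d T : ℕ) (ε Δ₀ : ℕ → Ω → ℝ)
    (ω : Ω) : ℕ → ℕ → ℝ :=
  centredSGD d (α / ((d : ℝ) * T)) (fun t i => W ((t : ℝ≥0) / (T : ℝ≥0)) (gridPoint d i) ω)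
    (fun t => ε t ω) (fun i => Δ₀ i ω)

/-- The increment of particle `i` is its sample times a scalar common to all particles. A discrete
derivative in `i` therefore falls on the sample alone. -/
theorem iterates_succ_sub (ω : Ω) (t i : ℕ) :
    iterates W α d T ε Δ₀ ω (t + 1) i - iterates W α d T ε Δ₀ ω t i =
      W ((t : ℝ≥0) / (T : ℝ≥0)) (gridPoint d i) ω * (α / ((d : ℝ) * T) * (ε t ω -
        ∑ j ∈ Finset.Icc 1 d, W ((t : ℝ≥0) / (T : ℝ≥0)) (gridPoint d j) ω *
          iterates W α d T ε Δ₀ ω t j)) := by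
  rw [iterates, centredSGD]
  simp only [mul_assoc]
  rw [← Finset.mul_sum]
  ring

/-- The initial values and the noises. -/
def dataSource (d : ℕ) (Δ₀ ε : ℕ → Ω → ℝ) (ω : Ω) : (Set.Icc 1 d → ℝ) × (ℕ → ℝ) :=
  ((fun i => Δ₀ i ω), fun t => ε t ω)

theorem measurable_past_noise (t r : ℕ) :
    Measurable[past W T (dataSource d Δ₀ ε) t] (ε r) :=
  ((measurable_pi_apply r).comp measurable_snd).comp (measurable_past W T (dataSource d Δ₀ ε) t)

theorem measurable_past_iterates (t : ℕ) : ∀ i ∈ Finset.Icc 1 d,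
    Measurable[past W T (dataSource d Δ₀ ε) t] fun ω => iterates W α d T ε Δ₀ ω t i := by
  induction t with
  | zero =>
    intro i hi
    exact ((measurable_pi_apply (⟨i, Finset.mem_Icc.1 hi⟩ : Set.Icc 1 d)).comp
      measurable_fst).comp (measurable_past W T (dataSource d Δ₀ ε) 0)
  | succ t ih =>
    intro i hi
    have hx : ∀ x, Measurable[past W T (dataSource d Δ₀ ε) (t + 1)]
        (W ((t : ℝ≥0) / (T : ℝ≥0)) x) := fun x =>
      (measurable_present W T t x).mono (present_le_past_succ W T _ t) le_rfl
    have hθ : ∀ j ∈ Finset.Icc 1 d, Measurable[past W T (dataSource d Δ₀ ε) (t + 1)]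
        fun ω => iterates W α d T ε Δ₀ ω t j := fun j hj =>
      (ih j hj).mono (past_mono W T _ (Nat.le_succ t)) le_rfl
    have e : (fun ω => iterates W α d T ε Δ₀ ω (t + 1) i) = fun ω =>
        iterates W α d T ε Δ₀ ω t i + W ((t : ℝ≥0) / (T : ℝ≥0)) (gridPoint d i) ω *
        (α / ((d : ℝ) * T) * (ε t ω -
        ∑ j ∈ Finset.Icc 1 d, W ((t : ℝ≥0) / (T : ℝ≥0)) (gridPoint d j) ω *
          iterates W α d T ε Δ₀ ω t j)) := by
      funext ω
      rw [← iterates_succ_sub]; ring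
    rw [e]
    refine (hθ i hi).add ((hx _).mul (((measurable_past_noise (t + 1) t).sub ?_).const_mul _))
    exact Finset.measurable_fun_sum _ fun j hj => (hx _).mul (hθ j hj)

variable {τ : ℝ} {Θ : PathSpace τ} {γ : ℝ}

theorem fluctuation_apply (ω : Ω) (s : Set.Icc (0 : ℝ) τ) (x : unitInterval) :
    fluctuation W Θ α d T γ ε Δ₀ ω s x =
      γ * (spaceTimeInterp τ d T (iterates W α d T ε Δ₀ ω) s x - Θ s x) := rfl

theorem fluctuation_gridPoint (ω : Ω) (s : Set.Icc (0 : ℝ) τ) {j : ℕ} (hj : j ∈ Finset.Icc 1 d) :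
    fluctuation W Θ α d T γ ε Δ₀ ω s (gridPoint d j) =
      γ * (linInterp (fun t => iterates W α d T ε Δ₀ ω t j) ((s : ℝ) * T) - Θ s (gridPoint d j)) := by
  rw [fluctuation_apply, spaceTimeInterp_apply, spaceInterp_gridPoint _ hj]

theorem measurable_fluctuation [MeasurableSpace Ω] (hd : 1 ≤ d)
    (hθ : ∀ t, ∀ j ∈ Finset.Icc 1 d, Measurable fun ω => iterates W α d T ε Δ₀ ω t j) :
    Measurable (fluctuation W Θ α d T γ ε Δ₀) := by
  have hc : Continuous fun u : PathSpace τ => γ • (u - Θ) := by fun_prop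
  exact hc.measurable.comp (measurable_spaceTimeInterp hd T hθ)

end Iterates


/-! ### The increments of the discrete derivatives of the fluctuations -/

theorem pow_four_le_of_abs_le {x K : ℝ} (h : |x| ≤ K) : x ^ 4 ≤ K ^ 4 := by
  have := pow_le_pow_left₀ (abs_nonneg x) h 4
  rwa [Even.pow_abs (by decide)] at this

theorem measurable_disc {Ω : Type*} [MeasurableSpace Ω] {d : ℕ} {f : ℕ → Ω → ℝ}
    (hf : ∀ j ∈ Finset.Icc 1 d, Measurable (f j)) {i : ℕ} (hi : i ∈ Finset.Icc 1 d) :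
    Measurable fun ω => disc d (fun j => f j ω) i := by
  rw [Finset.mem_Icc] at hi
  unfold disc
  split_ifs with h
  · exact hf 1 (Finset.mem_Icc.2 ⟨le_rfl, by omega⟩)
  · exact ((hf i (Finset.mem_Icc.2 hi)).sub
      (hf (i - 1) (Finset.mem_Icc.2 ⟨by omega, by omega⟩))).const_mul _

theorem memLp_disc {Ω : Type*} [MeasurableSpace Ω] {P : Measure Ω} {d : ℕ} {f : ℕ → Ω → ℝ}
    {p : ENNReal} (hf : ∀ j ∈ Finset.Icc 1 d, MemLp (f j) p P) {i : ℕ} (hi : i ∈ Finset.Icc 1 d) :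
    MemLp (fun ω => disc d (fun j => f j ω) i) p P := by
  rw [Finset.mem_Icc] at hi
  unfold disc
  split_ifs with h
  · exact hf 1 (Finset.mem_Icc.2 ⟨le_rfl, by omega⟩)
  · exact ((hf i (Finset.mem_Icc.2 hi)).sub
      (hf (i - 1) (Finset.mem_Icc.2 ⟨by omega, by omega⟩))).const_mul _

section Increments

variable {Ω : Type*} {W : ℝ≥0 → unitInterval → Ω → ℝ} {α : ℝ} {d T : ℕ} {ε Δ₀ : ℕ → Ω → ℝ}
  {A : unitInterval → unitInterval → ℝ} {τ : ℝ} (hτ : 0 ≤ τ) {Θ : PathSpace τ} {γ : ℝ}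

/-- The discrete derivatives of the fluctuations. -/
noncomputable def discFluct (hτ : 0 ≤ τ) (W : ℝ≥0 → unitInterval → Ω → ℝ) (Θ : PathSpace τ) (α : ℝ)
    (d T : ℕ) (γ : ℝ) (ε Δ₀ : ℕ → Ω → ℝ) (s : ℝ) (i : ℕ) (ω : Ω) : ℝ :=
  disc d (fun j => fluctuation W Θ α d T γ ε Δ₀ ω (Set.projIcc 0 τ hτ s) (gridPoint d j)) i

/-- The rescaled deviation of the iterates from the scaling limit. -/
noncomputable def deviation (hτ : 0 ≤ τ) (W : ℝ≥0 → unitInterval → Ω → ℝ) (Θ : PathSpace τ) (α : ℝ)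
    (d T : ℕ) (γ : ℝ) (ε Δ₀ : ℕ → Ω → ℝ) (t j : ℕ) (ω : Ω) : ℝ :=
  γ * (iterates W α d T ε Δ₀ ω t j - Θ (Set.projIcc 0 τ hτ ((t : ℝ) / T)) (gridPoint d j))

/-- The drift of the discrete derivatives of the fluctuations. -/
noncomputable def discDrift (hτ : 0 ≤ τ) (W : ℝ≥0 → unitInterval → Ω → ℝ)
    (A : unitInterval → unitInterval → ℝ) (Θ : PathSpace τ) (α : ℝ) (d T : ℕ) (γ : ℝ)
    (ε Δ₀ : ℕ → Ω → ℝ) (t i : ℕ) (ω : Ω) : ℝ :=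
  -(α / ((d : ℝ) * T)) * ∑ k ∈ Finset.Icc 1 d,
    disc d (fun j => A (gridPoint d j) (gridPoint d k)) i * deviation hτ W Θ α d T γ ε Δ₀ t k ω

/-- The martingale increments of the discrete derivatives of the fluctuations. -/
noncomputable def discMart (W : ℝ≥0 → unitInterval → Ω → ℝ)
    (A : unitInterval → unitInterval → ℝ) (α : ℝ) (d T : ℕ) (γ : ℝ)
    (ε Δ₀ : ℕ → Ω → ℝ) (t i : ℕ) (ω : Ω) : ℝ :=
  γ * (α / ((d : ℝ) * T)) *
      (disc d (fun j => W ((t : ℝ≥0) / (T : ℝ≥0)) (gridPoint d j) ω) i * ε t ω) +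
    -(α / ((d : ℝ) * T)) * ∑ k ∈ Finset.Icc 1 d,
      (disc d (fun j => W ((t : ℝ≥0) / (T : ℝ≥0)) (gridPoint d j) ω) i *
        W ((t : ℝ≥0) / (T : ℝ≥0)) (gridPoint d k) ω -
          disc d (fun j => A (gridPoint d j) (gridPoint d k)) i) *
        (γ * iterates W α d T ε Δ₀ ω t k)

theorem discFluct_node (hT : 1 ≤ T) {t i : ℕ} (ht : (t : ℝ) ≤ τ * T) (hi : i ∈ Finset.Icc 1 d)
    (ω : Ω) : discFluct hτ W Θ α d T γ ε Δ₀ ((t : ℝ) / T) i ω =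
      disc d (fun j => deviation hτ W Θ α d T γ ε Δ₀ t j ω) i := by
  have hT' : (0 : ℝ) < T := by positivity
  have hmem : (t : ℝ) / T ∈ Set.Icc 0 τ := ⟨by positivity, by rwa [div_le_iff₀ hT']⟩
  refine disc_congr (fun j hj => ?_) hi
  rw [fluctuation_gridPoint _ _ hj, deviation, Set.projIcc_of_mem hτ hmem]
  simp only [div_mul_cancel₀ _ hT'.ne']
  rw [linInterp_natCast]

/-- Within a time cell the interpolated iterates are affine. Replacing the products of samples by
their means `disc A` isolates the martingale part, and inserting `Θ` leaves a drift linear in the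
fluctuations plus the deterministic residual of the limit equation. -/
theorem discFluct_sub (hd : 1 ≤ d) (hT : 1 ≤ T) {t i : ℕ} (hi : i ∈ Finset.Icc 1 d)
    {s s' : Set.Icc (0 : ℝ) τ} (hs : (t : ℝ) / T ≤ s) (hs' : (t : ℝ) / T ≤ s')
    (hs1 : (s : ℝ) ≤ t / T + 1 / T) (hs1' : (s' : ℝ) ≤ t / T + 1 / T) (ω : Ω) :
    discFluct hτ W Θ α d T γ ε Δ₀ s i ω - discFluct hτ W Θ α d T γ ε Δ₀ s' i ω =
      T * ((s : ℝ) - s') * (discDrift hτ W A Θ α d T γ ε Δ₀ t i ω + discMart W A α d T γ ε Δ₀ t i ω)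
        + -γ * (disc d (fun j => Θ s (gridPoint d j)) i - disc d (fun j => Θ s' (gridPoint d j)) i +
        ((s : ℝ) - s') * ((α / d) * ∑ j ∈ Finset.Icc 1 d,
          disc d (fun k => A (gridPoint d k) (gridPoint d j)) i *
            Θ (Set.projIcc 0 τ hτ ((t : ℝ) / T)) (gridPoint d j))) := by
  have hT' : (0 : ℝ) < T := by positivity
  have hd' : (0 : ℝ) < d := by positivity
  have hc : ∀ r : ℝ, (t : ℝ) / T ≤ r → (t : ℝ) ≤ r * T := fun r h => by rwa [div_le_iff₀ hT'] at h
  have hc' : ∀ r : ℝ, r ≤ t / T + 1 / T → r * T ≤ t + 1 := fun r h => by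
    rwa [← add_div, le_div_iff₀ hT'] at h
  set x : ℕ → ℝ := fun j => W ((t : ℝ≥0) / (T : ℝ≥0)) (gridPoint d j) ω with hx
  set θ : ℕ → ℝ := iterates W α d T ε Δ₀ ω t with hθ
  set η := α / ((d : ℝ) * T) with hη
  have e1 : discFluct hτ W Θ α d T γ ε Δ₀ s i ω - discFluct hτ W Θ α d T γ ε Δ₀ s' i ω =
      γ * (((s : ℝ) - s') * T) * (disc d x i *
        (η * (ε t ω - ∑ j ∈ Finset.Icc 1 d, x j * θ j))) -
      γ * (disc d (fun j => Θ s (gridPoint d j)) i - disc d (fun j => Θ s' (gridPoint d j)) i) := by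
    rw [discFluct, discFluct, ← disc_sub, ← disc_sub, ← disc_mul_const, ← disc_const_mul,
      ← disc_const_mul, ← disc_sub]
    refine disc_congr (fun j hj => ?_) hi
    rw [fluctuation_gridPoint _ _ hj, fluctuation_gridPoint _ _ hj, Set.projIcc_val, Set.projIcc_val]
    have h1 := linInterp_sub_of_cell (fun t => iterates W α d T ε Δ₀ ω t j) t
      (hc s' hs') (hc' s' hs1') (hc s hs) (hc' s hs1)
    have h2 := iterates_succ_sub (W := W) (α := α) (d := d) (T := T) (ε := ε) (Δ₀ := Δ₀) ω t j
    rw [h2] at h1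
    linear_combination γ * h1
  have e2 : discDrift hτ W A Θ α d T γ ε Δ₀ t i ω = -η * (γ * ∑ k ∈ Finset.Icc 1 d,
      disc d (fun j => A (gridPoint d j) (gridPoint d k)) i * θ k - γ * ∑ k ∈ Finset.Icc 1 d,
      disc d (fun j => A (gridPoint d j) (gridPoint d k)) i *
        Θ (Set.projIcc 0 τ hτ ((t : ℝ) / T)) (gridPoint d k)) := by
    rw [discDrift]
    congr 1
    rw [Finset.mul_sum, Finset.mul_sum, ← Finset.sum_sub_distrib]
    refine Finset.sum_congr rfl fun k _ => ?_
    rw [deviation]; ring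
  have e3 : discMart W A α d T γ ε Δ₀ t i ω = γ * η * (disc d x i * ε t ω) + -η *
      (disc d x i * γ * ∑ k ∈ Finset.Icc 1 d, x k * θ k - γ * ∑ k ∈ Finset.Icc 1 d,
      disc d (fun j => A (gridPoint d j) (gridPoint d k)) i * θ k) := by
    rw [discMart]
    congr 2
    rw [Finset.mul_sum, Finset.mul_sum, ← Finset.sum_sub_distrib]
    refine Finset.sum_congr rfl fun k _ => ?_
    ring
  have e4 : T * η = α / d := by rw [hη]; field_simp
  rw [e1, e2, e3, ← e4]
  ring

theorem measurable_past_deviation (t : ℕ) {j : ℕ} (hj : j ∈ Finset.Icc 1 d) :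
    Measurable[past W T (dataSource d Δ₀ ε) t] (deviation hτ W Θ α d T γ ε Δ₀ t j) :=
  ((measurable_past_iterates t j hj).sub_const _).const_mul _

theorem measurable_past_discDrift (t i : ℕ) :
    Measurable[past W T (dataSource d Δ₀ ε) t] (discDrift hτ W A Θ α d T γ ε Δ₀ t i) :=
  Measurable.const_mul (Finset.measurable_fun_sum _ fun _ hk =>
    (measurable_past_deviation hτ t hk).const_mul _) _

theorem measurable_present_disc (t : ℕ) {i : ℕ} (hi : i ∈ Finset.Icc 1 d) :
    Measurable[present W T t]
      fun ω => disc d (fun j => W ((t : ℝ≥0) / (T : ℝ≥0)) (gridPoint d j) ω) i :=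
  @measurable_disc _ (present W T t) _ _ (fun _ _ => measurable_present W T t _) _ hi

theorem measurable_past_discMart (t : ℕ) {i : ℕ} (hi : i ∈ Finset.Icc 1 d) :
    Measurable[past W T (dataSource d Δ₀ ε) (t + 1)] (discMart W A α d T γ ε Δ₀ t i) := by
  have hle := present_le_past_succ W T (dataSource d Δ₀ ε) t
  have hX := (measurable_present_disc (W := W) (T := T) t hi).mono hle le_rfl
  refine ((hX.mul (measurable_past_noise (t + 1) t)).const_mul _).add
    (Measurable.const_mul (Finset.measurable_fun_sum _ fun k hk => ?_) _)
  exact ((hX.mul ((measurable_present W T t _).mono hle le_rfl)).sub_const _).mul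
    (((measurable_past_iterates t k hk).mono (past_mono W T _ (Nat.le_succ t)) le_rfl).const_mul _)

end Increments

/-! ### Moments of the drift and of the martingale increments -/

section Step

variable {Ω : Type*} [MeasurableSpace Ω] {P : Measure Ω} [IsProbabilityMeasure P]
  {W : ℝ≥0 → unitInterval → Ω → ℝ} {A : unitInterval → unitInterval → ℝ}
  {B : (Fin 4 → unitInterval) → ℝ} {E : (Fin 8 → unitInterval) → ℝ}
  {α : ℝ} {d T : ℕ} {ε Δ₀ : ℕ → Ω → ℝ} {τ : ℝ} (hτ : 0 ≤ τ) {Θ : PathSpace τ} {γ K : ℝ}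

omit [IsProbabilityMeasure P] in
theorem memLp_discDrift (hA : IsSmoothKernel A K) (hd : 1 ≤ d) {t : ℕ} {φ : ℝ}
    (hV : ∀ k ∈ Finset.Icc 1 d, MemLp (deviation hτ W Θ α d T γ ε Δ₀ t k) 4 P ∧
      ∫ ω, deviation hτ W Θ α d T γ ε Δ₀ t k ω ^ 4 ∂P ≤ φ) {i : ℕ} (hi : i ∈ Finset.Icc 1 d) :
    MemLp (discDrift hτ W A Θ α d T γ ε Δ₀ t i) 4 P ∧
      ∫ ω, discDrift hτ W A Θ α d T γ ε Δ₀ t i ω ^ 4 ∂P ≤ (α / T) ^ 4 * (K ^ 4 * φ) := by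
  have hd' : (0 : ℝ) < d := by positivity
  obtain ⟨h1, h2⟩ := memLp_const_mul_sum (P := P) (-(α / ((d : ℝ) * T)))
    (f := fun k ω => disc d (fun j => A (gridPoint d j) (gridPoint d k)) i *
      deviation hτ W Θ α d T γ ε Δ₀ t k ω) (b := K ^ 4 * φ) fun k hk => by
    refine ⟨(hV k hk).1.const_mul _, ?_⟩
    rw [integral_const_mul_pow_four]
    refine mul_le_mul ?_ (hV k hk).2 (integral_pow_four_nonneg _) (by positivity)
    exact pow_four_le_of_abs_le (hA.abs_disc_le hd hi _)
  refine ⟨h1, h2.trans (le_of_eq ?_)⟩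
  field_simp

/-- Each summand is a centred present factor times the past variable `γ θ_k`, which is the deviation
plus `γ Θ`. The latter produces the term `γ⁴ ‖Θ‖⁴`. -/
theorem memLp_discMart (hW : IsDataProcess P W A B E) (hA : IsSmoothKernel A K) (hd : 1 ≤ d)
    (hT : 1 ≤ T) (hZ : Measurable (dataSource d Δ₀ ε))
    (hind : IndepFun (fun (ω : Ω) (p : ℝ≥0 × unitInterval) => W p.1 p.2 ω) (dataSource d Δ₀ ε) P)
    {t : ℕ} {φ K' S : ℝ} (hε : MemLp (ε t) 4 P) (hεS : ∫ ω, ε t ω ^ 4 ∂P ≤ S)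
    {i : ℕ} (hi : i ∈ Finset.Icc 1 d)
    (hX4 : ∫ ω, disc d (fun j => W ((t : ℝ≥0) / (T : ℝ≥0)) (gridPoint d j) ω) i ^ 4 ∂P ≤ K')
    (hX0 : ∫ ω, disc d (fun j => W ((t : ℝ≥0) / (T : ℝ≥0)) (gridPoint d j) ω) i ∂P = 0)
    (hXW : ∀ y, ∫ ω, (disc d (fun j => W ((t : ℝ≥0) / (T : ℝ≥0)) (gridPoint d j) ω) i *
        W ((t : ℝ≥0) / (T : ℝ≥0)) y ω) ^ 4 ∂P ≤ K' ∧
      ∫ ω, disc d (fun j => W ((t : ℝ≥0) / (T : ℝ≥0)) (gridPoint d j) ω) i *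
        W ((t : ℝ≥0) / (T : ℝ≥0)) y ω ∂P = disc d (fun j => A (gridPoint d j) y) i)
    (hV : ∀ k ∈ Finset.Icc 1 d, MemLp (deviation hτ W Θ α d T γ ε Δ₀ t k) 4 P ∧
      ∫ ω, deviation hτ W Θ α d T γ ε Δ₀ t k ω ^ 4 ∂P ≤ φ) :
    MemLp (discMart W A α d T γ ε Δ₀ t i) 4 P ∧
      ∫ ω, discMart W A α d T γ ε Δ₀ t i ω ^ 4 ∂P ≤
        8 * ((γ * (α / ((d : ℝ) * T))) ^ 4 * (K' * S) +
          (α / T) ^ 4 * (8 * (K' + K ^ 4) * (8 * (φ + γ ^ 4 * ‖Θ‖ ^ 4)))) ∧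
      ∀ Y : Ω → ℝ, Measurable[past W T (dataSource d Δ₀ ε) t] Y → MemLp Y 4 P →
        ∫ ω, Y ω ^ 3 * discMart W A α d T γ ε Δ₀ t i ω ∂P = 0 := by
  have hd' : (0 : ℝ) < d := by positivity
  set a : ℕ → ℝ := fun k => disc d (fun j => A (gridPoint d j) (gridPoint d k)) i with ha
  set X : Ω → ℝ := fun ω => disc d (fun j => W ((t : ℝ≥0) / (T : ℝ≥0)) (gridPoint d j) ω) i with hX
  have hX8 : MemLp X 8 P := memLp_disc (f := fun j => W ((t : ℝ≥0) / (T : ℝ≥0)) (gridPoint d j))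
    (fun j _ => hW.memLp _ _) hi
  have hXm := measurable_present_disc (W := W) (T := T) t hi
  have h := memLp_mart_increment (P := P) (d := d) (c₁ := γ * (α / ((d : ℝ) * T)))
    (c₂ := -(α / ((d : ℝ) * T))) (hW.present_le T t) (hW.past_le hZ T t)
    (hW.indep_present_past hZ hind hT t) (X := X) (e := ε t)
    (q := fun k ω => X ω * W ((t : ℝ≥0) / (T : ℝ≥0)) (gridPoint d k) ω - a k)
    (g := fun k ω => γ * iterates W α d T ε Δ₀ ω t k) (K := K') (S := S)
    (K' := 8 * (K' + K ^ 4)) (S' := 8 * (φ + γ ^ 4 * ‖Θ‖ ^ 4)) hXm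
    (measurable_past_noise t t) (hX8.mono_exponent (by norm_num)) hε hX0 hX4 hεS ?_ ?_
  · obtain ⟨h1, h2, h3⟩ := h
    refine ⟨h1, h2.trans (le_of_eq ?_), h3⟩
    congr 2
    field_simp
  · intro k hk
    have hm : MemLp (fun ω => X ω * W ((t : ℝ≥0) / (T : ℝ≥0)) (gridPoint d k) ω) 4 P :=
      memLp_four_mul hX8 (hW.memLp _ _)
    refine ⟨(hXm.mul (measurable_present W T t _)).sub_const _, hm.sub (memLp_const _), ?_, ?_⟩
    · rw [integral_sub (hm.integrable (by norm_num)) (integrable_const _), (hXW _).2]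
      simp [ha]
    · have := integral_add_pow_four_le' hm (memLp_const (-a k))
      simp only [← sub_eq_add_neg, integral_const_pow_four] at this
      refine this.trans ?_
      have h4 : (-a k) ^ 4 ≤ K ^ 4 := by
        refine pow_four_le_of_abs_le ?_
        rw [abs_neg]
        exact hA.abs_disc_le hd hi _
      linarith [(hXW (gridPoint d k)).1]
  · intro k hk
    set z := Θ (Set.projIcc 0 τ hτ ((t : ℝ) / T)) (gridPoint d k) with hz
    have e : (fun ω => γ * iterates W α d T ε Δ₀ ω t k) =
        fun ω => deviation hτ W Θ α d T γ ε Δ₀ t k ω + γ * z := by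
      funext ω; rw [deviation]; ring
    refine ⟨(measurable_past_iterates t k hk).const_mul _, ?_, ?_⟩
    · simp only [e]
      exact (hV k hk).1.add (memLp_const _)
    · have e' : ∀ ω, γ * iterates W α d T ε Δ₀ ω t k =
          deviation hτ W Θ α d T γ ε Δ₀ t k ω + γ * z := fun ω => congrFun e ω
      simp only [e']
      refine (integral_add_pow_four_le' (hV k hk).1 (memLp_const _)).trans ?_
      rw [integral_const_pow_four, mul_pow]
      have h4 : z ^ 4 ≤ ‖Θ‖ ^ 4 := by
        exact pow_four_le_of_abs_le (abs_path_le Θ _ _)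
      have := mul_le_mul_of_nonneg_left h4 (by positivity : 0 ≤ γ ^ 4)
      linarith [(hV k hk).2]

end Step


/-! ### Uniform moment bounds for the fluctuations -/

/-- The scaling regime makes both parts of order `1 / T²`: the bound on `γ σ / (d √T)` for the label
noise, and the bound on `γ / √T` for the sampling noise acting on `γ Θ`. -/
theorem mart_bound_arith {α C n K' K'' C₁ σ γ φ d T : ℝ} (hd : 0 < d) (hT : 0 < T) (hσ : 0 ≤ σ)
    (hγ : 0 ≤ γ) (hK' : 0 ≤ K') (hK'' : 0 ≤ K'') (hφ : 0 ≤ φ) (h1 : γ / √T ≤ C)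
    (h2 : γ * σ / (d * √T) ≤ C) :
    8 * ((γ * (α / (d * T))) ^ 4 * (K' * (C₁ * σ ^ 4)) +
      (α / T) ^ 4 * (K'' * (8 * (16 * φ + γ ^ 4 * n ^ 4)))) ≤
    8 * (α ^ 4 * (K' * |C₁| * C ^ 4) + α ^ 4 * K'' * 8 * (16 / T ^ 2 + C ^ 4 * n ^ 4)) * (1 + φ)
      / T ^ 2 := by
  have hs : √T ^ 4 = T ^ 2 := by
    rw [show (4 : ℕ) = 2 * 2 from rfl, pow_mul, Real.sq_sqrt hT.le]
  have hs0 : 0 < √T := Real.sqrt_pos.2 hT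
  have g1 : γ ^ 4 ≤ C ^ 4 * T ^ 2 := by
    have := pow_le_pow_left₀ (by positivity) h1 4
    rwa [div_pow, hs, div_le_iff₀ (by positivity)] at this
  have g2 : (γ * σ / (d * √T)) ^ 4 ≤ C ^ 4 := pow_le_pow_left₀ (by positivity) h2 4
  have e1 : (γ * (α / (d * T))) ^ 4 * (K' * (C₁ * σ ^ 4)) =
      α ^ 4 * (K' * C₁ * (γ * σ / (d * √T)) ^ 4) / T ^ 2 := by
    rw [div_pow, mul_pow d, hs]
    field_simp
  have b1 : (γ * (α / (d * T))) ^ 4 * (K' * (C₁ * σ ^ 4)) ≤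
      α ^ 4 * (K' * |C₁| * C ^ 4) * (1 + φ) / T ^ 2 := by
    rw [e1]
    have : α ^ 4 * (K' * C₁ * (γ * σ / (d * √T)) ^ 4) ≤ α ^ 4 * (K' * |C₁| * C ^ 4) := by
      gcongr
      exact le_abs_self _
    refine div_le_div_of_nonneg_right (this.trans ?_) (by positivity)
    have h0 : 0 ≤ α ^ 4 * (K' * |C₁| * C ^ 4) := by positivity
    nlinarith
  have b2 : (α / T) ^ 4 * (K'' * (8 * (16 * φ + γ ^ 4 * n ^ 4))) ≤
      α ^ 4 * K'' * 8 * (16 / T ^ 2 + C ^ 4 * n ^ 4) * (1 + φ) / T ^ 2 := by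
    have e2 : α ^ 4 * K'' * 8 * (16 / T ^ 2 + C ^ 4 * n ^ 4) * (1 + φ) / T ^ 2 =
        (α / T) ^ 4 * (K'' * (8 * ((16 + C ^ 4 * T ^ 2 * n ^ 4) * (1 + φ)))) := by
      field_simp
    rw [e2]
    gcongr
    have h3 : γ ^ 4 * n ^ 4 ≤ C ^ 4 * T ^ 2 * n ^ 4 := by gcongr
    have h4 : 0 ≤ C ^ 4 * T ^ 2 * n ^ 4 := by positivity
    nlinarith
  calc _ ≤ 8 * (α ^ 4 * (K' * |C₁| * C ^ 4) * (1 + φ) / T ^ 2 +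
        α ^ 4 * K'' * 8 * (16 / T ^ 2 + C ^ 4 * n ^ 4) * (1 + φ) / T ^ 2) := by gcongr
    _ = _ := by ring

section Uniform

variable {Ω : Type*} [MeasurableSpace Ω] {P : Measure Ω} [IsProbabilityMeasure P]
  {W : ℝ≥0 → unitInterval → Ω → ℝ} {A : unitInterval → unitInterval → ℝ}
  {B : (Fin 4 → unitInterval) → ℝ} {E : (Fin 8 → unitInterval) → ℝ}
  {α : ℝ} {τ : ℝ} {hτ : 0 ≤ τ} {Θ : PathSpace τ}

theorem exists_isIncrementScheme (hW : IsDataProcess P W A B E) (hABE : SmoothMoments A B E)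
    (hα : 0 ≤ α) (hΘ : IsScalingLimit hτ α A Θ) (C₁ C Q : ℝ) : ∃ K : ℝ, 0 ≤ K ∧
    ∀ (d T : ℕ) (γ σ : ℝ) (ε Δ₀ : ℕ → Ω → ℝ), 1 ≤ d → 1 ≤ T → 0 ≤ γ → 0 ≤ σ →
      γ / √(T : ℝ) ≤ C → γ / d ≤ C → γ * σ / (d * √(T : ℝ)) ≤ C → IsNoise P C₁ σ ε →
      (∀ i ∈ Finset.Icc 1 d, Measurable (Δ₀ i)) → (∀ i ∈ Finset.Icc 1 d, MemLp (Δ₀ i) 4 P) →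
      IndepFun (fun (ω : Ω) (p : ℝ≥0 × unitInterval) => W p.1 p.2 ω) (dataSource d Δ₀ ε) P →
      (∀ i ∈ Finset.Icc 1 d, ∫ ω, discFluct hτ W Θ α d T γ ε Δ₀ 0 i ω ^ 4 ∂P ≤ Q) →
      IsIncrementScheme P τ K T (Finset.Icc 1 d) (discFluct hτ W Θ α d T γ ε Δ₀)
        (discDrift hτ W A Θ α d T γ ε Δ₀) (discMart W A α d T γ ε Δ₀)
        (past W T (dataSource d Δ₀ ε)) := by
  obtain ⟨K₁, hA⟩ := hW.exists_isSmoothKernel hABE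
  obtain ⟨K₂, hK₂, hX⟩ := hW.exists_disc_moments hABE
  obtain ⟨K₃, hK₃, hres⟩ := hΘ.exists_residual_le hα hA
  set k₁ := |Q| with hk₁
  set k₂ := |C| * K₃ * 2 with hk₂
  set k₃ := α ^ 4 * K₁ ^ 4 * 16 with hk₃
  set k₄ := 8 * (α ^ 4 * (K₂ * |C₁| * C ^ 4) +
    α ^ 4 * (8 * (K₂ + K₁ ^ 4)) * 8 * (16 + C ^ 4 * ‖Θ‖ ^ 4)) with hk₄
  have p1 : 0 ≤ k₁ := by positivity
  have p2 : 0 ≤ k₂ := by positivity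
  have p3 : 0 ≤ k₃ := by positivity
  have p4 : 0 ≤ k₄ := by positivity
  refine ⟨k₁ + k₂ + k₃ + k₄, by positivity, ?_⟩
  intro d T γ σ ε Δ₀ hd hT hγ hσ hC1 hC2 hC3 hε hΔ hΔ4 hind hQ
  have hT1 : (1 : ℝ) ≤ T := by exact_mod_cast hT
  have hT' : (0 : ℝ) < T := by positivity
  have hd' : (0 : ℝ) < d := by positivity
  have hZ : Measurable (dataSource d Δ₀ ε) :=
    (measurable_pi_lambda _ fun i : Set.Icc 1 d => hΔ i (Finset.mem_Icc.2 i.2)).prodMk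
      (measurable_pi_lambda _ fun t => hε.measurable t)
  refine ⟨past_mono W T _, fun t i hi ht => ?_, fun t i hi ht => measurable_past_discDrift hτ t i,
    fun t i hi ht => measurable_past_discMart t hi, fun i hi => ⟨?_, ?_⟩, ?_, ?_⟩
  · have e : discFluct hτ W Θ α d T γ ε Δ₀ ((t : ℝ) / T) i = fun ω =>
        disc d (fun j => deviation hτ W Θ α d T γ ε Δ₀ t j ω) i :=
      funext fun ω => discFluct_node hτ hT ht hi ω
    rw [e]
    exact @measurable_disc _ (past W T (dataSource d Δ₀ ε) t) _ _
      (fun j hj => measurable_past_deviation hτ t hj) _ hi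
  · have e : discFluct hτ W Θ α d T γ ε Δ₀ 0 i = fun ω =>
        disc d (fun j => deviation hτ W Θ α d T γ ε Δ₀ 0 j ω) i := by
      funext ω
      have := discFluct_node (W := W) (Θ := Θ) (α := α) (γ := γ) (ε := ε) (Δ₀ := Δ₀) hτ hT
        (t := 0) (by simpa using mul_nonneg hτ hT'.le) hi ω
      simpa using this
    rw [e]
    exact memLp_disc (fun j hj => ((hΔ4 j hj).sub (memLp_const _)).const_mul _) hi
  · linarith [hQ i hi, le_abs_self Q]
  · intro t i s s' hi hs hs' hs1 hs1' hsτ hsτ'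
    have ht0 : 0 ≤ (t : ℝ) / T := by positivity
    have hmem : (t : ℝ) / T ∈ Set.Icc 0 τ := ⟨ht0, hs.trans hsτ⟩
    lift s to Set.Icc (0 : ℝ) τ using ⟨ht0.trans hs, hsτ⟩
    lift s' to Set.Icc (0 : ℝ) τ using ⟨ht0.trans hs', hsτ'⟩
    refine ⟨_, ?_, fun ω => discFluct_sub (A := A) hτ hd hT hi hs hs' hs1 hs1' ω⟩
    rw [Set.projIcc_of_mem hτ hmem, abs_mul, abs_neg, abs_of_nonneg hγ]
    have hr := hres d T hd hT i hi ⟨(t : ℝ) / T, hmem⟩ s s' hs hs' hs1 hs1'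
    -- As `T ≥ 1`, the bound on `γ / √T` also controls `γ / T`; with `γ / d` this makes the residual
    -- Lipschitz in time uniformly in `d` and `T`.
    have hTT : √(T : ℝ) ≤ T := by
      rw [Real.sqrt_le_left hT'.le]; nlinarith
    have hg : γ / T ≤ |C| := by
      refine le_trans ?_ (hC1.trans (le_abs_self C))
      exact div_le_div_of_nonneg_left hγ (Real.sqrt_pos.2 hT') hTT
    have hg2 := hC2.trans (le_abs_self C)
    calc _ ≤ γ * (K₃ * (1 / d + 1 / T) * |(s : ℝ) - s'|) := by gcongr
      _ = (γ / d + γ / T) * K₃ * |(s : ℝ) - s'| := by ring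
      _ ≤ (|C| + |C|) * K₃ * |(s : ℝ) - s'| := by gcongr
      _ = k₂ * |(s : ℝ) - s'| := by rw [hk₂]; ring
      _ ≤ _ := by gcongr; linarith
  · intro t φ ht hD i hi
    have hφ : 0 ≤ φ := (integral_pow_four_nonneg _).trans (hD i hi).2
    have hV : ∀ k ∈ Finset.Icc 1 d, MemLp (deviation hτ W Θ α d T γ ε Δ₀ t k) 4 P ∧
        ∫ ω, deviation hτ W Θ α d T γ ε Δ₀ t k ω ^ 4 ∂P ≤ 16 * φ := fun k hk => by
      refine memLp_node_of_disc hd (fun j hj => ?_) hk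
      have := hD j hj
      have e : ∀ ω, discFluct hτ W Θ α d T γ ε Δ₀ ((t : ℝ) / T) j ω =
        disc d (fun j => deviation hτ W Θ α d T γ ε Δ₀ t j ω) j :=
        fun ω => discFluct_node hτ hT ht hj ω
      rwa [show discFluct hτ W Θ α d T γ ε Δ₀ ((t : ℝ) / T) j = _ from funext e] at this
    obtain ⟨a1, a2⟩ := memLp_discDrift hτ hA hd hV hi
    obtain ⟨X, hXe, -, hX0, hX4, hXW⟩ := hX d ((t : ℝ≥0) / (T : ℝ≥0)) hd i hi
    obtain rfl : X = _ := funext hXe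
    have hε4 := hε.fourth t
    simp only [Even.pow_abs (show Even 4 by decide)] at hε4
    obtain ⟨b1, b2, b3⟩ := memLp_discMart (α := α) (γ := γ) hτ hW hA hd hT hZ hind (hε.memLp t) hε4
      hi hX4 hX0 hXW hV
    refine ⟨a1, a2.trans ?_, b1, b2.trans ?_, b3⟩
    · calc _ = k₃ * φ / T ^ 4 := by rw [hk₃]; ring
        _ ≤ _ := by gcongr; linarith
    · refine (mart_bound_arith hd' hT' hσ hγ hK₂ (by positivity) hφ hC1 hC3).trans ?_
      have hT2 : 16 / (T : ℝ) ^ 2 ≤ 16 := div_le_self (by norm_num) (one_le_pow₀ hT1)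
      calc _ ≤ k₄ * (1 + φ) / T ^ 2 := by rw [hk₄]; gcongr
        _ ≤ _ := by gcongr; linarith

omit [IsProbabilityMeasure P] in
-- The squared Sobolev norm is a sum of squared discrete derivatives with weights `1, 1/d, …, 1/d`
-- of total mass at most `2`. Cauchy–Schwarz costs one factor `2`, the summation of moments another.
theorem integral_sob_pow_four_le {d : ℕ} (hd : 1 ≤ d) {v : Ω → ℕ → ℝ} {b : ℝ}
    (h : ∀ i ∈ Finset.Icc 1 d, MemLp (fun ω => disc d (v ω) i) 4 P ∧
      ∫ ω, disc d (v ω) i ^ 4 ∂P ≤ b) :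
    Integrable (fun ω => ‖sob d (v ω)‖ ^ 4) P ∧ ∫ ω, ‖sob d (v ω)‖ ^ 4 ∂P ≤ 4 * b := by
  have hd' : (0 : ℝ) < d := by positivity
  set w : ℕ → ℝ := fun i => if i = 0 then 1 else 1 / (d : ℝ) with hw
  have hw0 : ∀ i, 0 ≤ w i := fun i => by simp only [hw]; split_ifs <;> positivity
  have hws : ∑ i ∈ Finset.range d, w i ≤ 2 := by
    calc _ ≤ ∑ i ∈ Finset.range d, ((if i = 0 then 1 else 0) + 1 / (d : ℝ)) := by
          refine Finset.sum_le_sum fun i _ => ?_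
          simp only [hw]
          have : 0 ≤ 1 / (d : ℝ) := by positivity
          split_ifs <;> linarith
      _ ≤ _ := by
          rw [Finset.sum_add_distrib, Finset.sum_const, Finset.card_range, nsmul_eq_mul,
            mul_one_div_cancel hd'.ne', Finset.sum_ite_eq']
          split_ifs <;> norm_num
  have hm : ∀ i ∈ Finset.range d, i + 1 ∈ Finset.Icc 1 d := fun i hi => by
    rw [Finset.mem_range] at hi; exact Finset.mem_Icc.2 ⟨by omega, by omega⟩
  have e : ∀ ω, ‖sob d (v ω)‖ ^ 2 = ∑ i ∈ Finset.range d, w i * disc d (v ω) (i + 1) ^ 2 := by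
    intro ω
    rw [sob_norm_sq]
    refine Finset.sum_congr rfl fun i _ => ?_
    simp only [hw]
    split_ifs with hi
    · rw [hi, zero_add, disc_one, one_mul]
    · rw [disc_succ _ _ (by omega)]; field_simp
  have e4 : ∀ ω, ‖sob d (v ω)‖ ^ 4 =
      (∑ i ∈ Finset.range d, w i * disc d (v ω) (i + 1) ^ 2) ^ 2 := fun ω => by rw [← e]; ring
  have hle : ∀ ω, (∑ i ∈ Finset.range d, w i * disc d (v ω) (i + 1) ^ 2) ^ 2 ≤
      2 * ∑ i ∈ Finset.range d, w i * disc d (v ω) (i + 1) ^ 4 := fun ω => by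
    refine (Finset.sum_sq_le_sum_mul_sum_of_sq_le_mul (Finset.range d) (f := w)
      (g := fun i => w i * disc d (v ω) (i + 1) ^ 4) (fun i _ => hw0 i)
      (fun i _ => mul_nonneg (hw0 i) (by positivity)) fun i _ => le_of_eq (by ring)).trans ?_
    refine mul_le_mul_of_nonneg_right hws (Finset.sum_nonneg fun i _ => ?_)
    exact mul_nonneg (hw0 i) (by positivity)
  have hi4 : ∀ i ∈ Finset.range d, Integrable (fun ω => w i * disc d (v ω) (i + 1) ^ 4) P :=
    fun i hi => (integrable_pow_four (h _ (hm i hi)).1).const_mul _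
  have hI := (integrable_finsetSum _ hi4).const_mul 2
  simp only [e4]
  have hint : Integrable (fun ω =>
      (∑ i ∈ Finset.range d, w i * disc d (v ω) (i + 1) ^ 2) ^ 2) P := by
    refine hI.mono ?_ (Eventually.of_forall fun ω => ?_)
    · refine AEStronglyMeasurable.pow (Finset.aestronglyMeasurable_fun_sum _ fun i hi => ?_) 2
      exact ((h _ (hm i hi)).1.1.pow 2).const_mul _
    · rw [Real.norm_of_nonneg (by positivity)]
      exact (hle ω).trans (le_abs_self _)
  refine ⟨hint, (integral_mono hint hI hle).trans ?_⟩
  rw [integral_const_mul, integral_finsetSum _ hi4]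
  have hb : 0 ≤ b := (integral_pow_four_nonneg _).trans (h 1 (Finset.mem_Icc.2 ⟨le_rfl, hd⟩)).2
  have : ∑ i ∈ Finset.range d, ∫ ω, w i * disc d (v ω) (i + 1) ^ 4 ∂P ≤ 2 * b := by
    calc _ ≤ ∑ i ∈ Finset.range d, w i * b := by
          refine Finset.sum_le_sum fun i hi => ?_
          rw [integral_const_mul]
          exact mul_le_mul_of_nonneg_left (h _ (hm i hi)).2 (hw0 i)
      _ = (∑ i ∈ Finset.range d, w i) * b := by rw [Finset.sum_mul]
      _ ≤ _ := by gcongr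
  linarith

end Uniform


/-! ### Interpolation on the spatial grid -/

/-- The interpolation of a continuous function at the grid points `1 / d, …, d / d`, constant on
the boundary cell. -/
noncomputable def gridInterp (d : ℕ) : C(C(unitInterval, ℝ), C(unitInterval, ℝ)) where
  toFun f := spaceInterp d fun j => f (gridPoint d j)
  continuous_toFun := by
    refine (LipschitzWith.of_dist_le_mul (K := 1) fun f g => ?_).continuous
    rw [NNReal.coe_one, one_mul, dist_eq_norm, spaceInterp_sub]
    refine (ContinuousMap.norm_le _ dist_nonneg).2 fun x => ?_
    have hnode : ∀ n, |nodeValue ((fun j => f (gridPoint d j)) - fun j => g (gridPoint d j)) n| ≤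
        dist f g := fun n => by
      unfold nodeValue
      split_ifs
      · exact ContinuousMap.dist_apply_le_dist (f := f) (g := g) (gridPoint d 1)
      · exact ContinuousMap.dist_apply_le_dist (f := f) (g := g) (gridPoint d n)
    have hx0 : 0 ≤ (d : ℝ) * x := mul_nonneg (Nat.cast_nonneg d) x.2.1
    have h1 := Nat.floor_le hx0
    have h2 := (Nat.lt_floor_add_one ((d : ℝ) * x)).le
    rw [spaceInterp_apply, linInterp, Real.norm_eq_abs, smul_eq_mul, smul_eq_mul]
    refine (abs_add_le _ _).trans ?_
    rw [abs_mul, abs_mul, abs_of_nonneg (sub_nonneg.2 h2), abs_of_nonneg (sub_nonneg.2 h1)]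
    have a1 := mul_le_mul_of_nonneg_left (hnode ⌊(d : ℝ) * x⌋₊) (sub_nonneg.2 h2)
    have a2 := mul_le_mul_of_nonneg_left (hnode (⌊(d : ℝ) * x⌋₊ + 1)) (sub_nonneg.2 h1)
    linarith

theorem gridInterp_apply (d : ℕ) (f : C(unitInterval, ℝ)) :
    gridInterp d f = spaceInterp d fun j => f (gridPoint d j) := rfl

theorem gridInterp_gridPoint {d : ℕ} (f : C(unitInterval, ℝ)) {j : ℕ} (hj : j ∈ Finset.Icc 1 d) :
    gridInterp d f (gridPoint d j) = f (gridPoint d j) :=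
  spaceInterp_gridPoint (fun j => f (gridPoint d j)) hj

theorem gridInterp_spaceInterp {d : ℕ} (hd : 1 ≤ d) (v : ℕ → ℝ) :
    gridInterp d (spaceInterp d v) = spaceInterp d v :=
  spaceInterp_congr hd fun _ hi => spaceInterp_gridPoint v hi

theorem gridInterp_smul_sub (d : ℕ) (c : ℝ) (f g : C(unitInterval, ℝ)) :
    gridInterp d (c • (f - g)) = c • (gridInterp d f - gridInterp d g) := by
  rw [gridInterp_apply, gridInterp_apply, gridInterp_apply, spaceInterp_sub, ← spaceInterp_smul]
  rfl

/-- On the boundary cell the interpolation is constant. -/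
theorem spaceInterp_boundary {d : ℕ} (hd : 1 ≤ d) (v : ℕ → ℝ) {x : unitInterval}
    (hx : (x : ℝ) ≤ 1 / d) : spaceInterp d v x = v 1 := by
  have hd' : (0 : ℝ) < d := by positivity
  rw [le_div_iff₀ hd'] at hx
  rw [spaceInterp_apply, linInterp_eq _ 0 (by simpa using mul_nonneg hd'.le x.2.1)
    (by push_cast; linarith)]
  simp only [nodeValue, smul_eq_mul]
  norm_num
  ring

theorem spaceInterp_sup_gridPoint {d : ℕ} (hd : 1 ≤ d) (v : ℕ → ℝ) (x : unitInterval) :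
    spaceInterp d v (x ⊔ gridPoint d 1) = spaceInterp d v x := by
  have hg : (gridPoint d 1 : ℝ) = 1 / d := by simpa using coe_gridPoint hd hd
  rcases le_total x (gridPoint d 1) with h | h
  · have h' : (x : ℝ) ≤ gridPoint d 1 := h
    rw [sup_of_le_right h, spaceInterp_boundary hd v hg.le, spaceInterp_boundary hd v (hg ▸ h')]
  · rw [sup_of_le_left h]

theorem gridInterp_sub_eq_interpErr {d : ℕ} (hd : 1 ≤ d) (f : C(unitInterval, ℝ)) {x : unitInterval}
    (hx : 1 / (d : ℝ) ≤ x) : gridInterp d f x - f x = interpErr d f x := by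
  have hd' : (0 : ℝ) < d := by positivity
  rw [div_le_iff₀ hd'] at hx
  have hfl : 1 ≤ ⌊(d : ℝ) * x⌋₊ := Nat.le_floor (by push_cast; linarith)
  rw [gridInterp_apply, spaceInterp_apply, interpErr]
  simp only [linInterp, nodeValue]
  rw [if_neg (by omega), if_neg (by omega)]

/-- On the boundary cell the constant interpolation differs from the linear one by `(1 - d x)` times
the jump of `f` across the cell. -/
theorem abs_gridInterp_sub_le {d : ℕ} (hd : 1 ≤ d) (f : C(unitInterval, ℝ)) (x : unitInterval) :
    |gridInterp d f x - f x| ≤ |interpErr d f x| + |f (gridPoint d 1) - f 0| := by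
  have hd' : (0 : ℝ) < d := by positivity
  rcases le_total (x : ℝ) (1 / d) with h | h
  · have h0 : gridPoint d 0 = 0 := Subtype.ext (by simpa using coe_gridPoint hd (Nat.zero_le d))
    have hx := h
    rw [le_div_iff₀ hd'] at hx
    have hx0 := mul_nonneg hd'.le x.2.1
    have e : gridInterp d f x - f x =
        interpErr d f x + (1 - d * x) * (f (gridPoint d 1) - f 0) := by
      rw [gridInterp_apply, spaceInterp_boundary hd _ h, interpErr,
        linInterp_eq _ 0 (by simpa using hx0) (by push_cast; linarith)]
      simp only [smul_eq_mul, h0]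
      norm_num
      ring
    rw [e]
    refine (abs_add_le _ _).trans (add_le_add_right ?_ _)
    rw [abs_mul, abs_of_nonneg (by linarith : 0 ≤ 1 - (d : ℝ) * x)]
    exact mul_le_of_le_one_left (abs_nonneg _) (by linarith)
  · rw [gridInterp_sub_eq_interpErr hd f h]
    linarith [abs_nonneg (f (gridPoint d 1) - f 0)]

/-! ### Decomposition of the fluctuations -/

section Decomposition

variable {τ : ℝ}

/-- The error of the interpolation of a path on the spatial grid. -/
noncomputable def gridError (d : ℕ) (Θ : PathSpace τ) : PathSpace τ := (gridInterp d).comp Θ - Θ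

theorem gridError_apply (d : ℕ) (Θ : PathSpace τ) (s : Set.Icc (0 : ℝ) τ) (x : unitInterval) :
    gridError d Θ s x = gridInterp d (Θ s) x - Θ s x := rfl

theorem fluctuation_eq_add {Ω : Type*} {W : ℝ≥0 → unitInterval → Ω → ℝ} {Θ : PathSpace τ} {α γ : ℝ}
    {d T : ℕ} (hd : 1 ≤ d) {ε Δ₀ : ℕ → Ω → ℝ} (ω : Ω) :
    fluctuation W Θ α d T γ ε Δ₀ ω =
      (gridInterp d).comp (fluctuation W Θ α d T γ ε Δ₀ ω) + γ • gridError d Θ := by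
  have e : ∀ s, gridInterp d (spaceTimeInterp τ d T (iterates W α d T ε Δ₀ ω) s) =
      spaceTimeInterp τ d T (iterates W α d T ε Δ₀ ω) s := fun s => by
    rw [spaceTimeInterp_apply, gridInterp_spaceInterp hd]
  ext s x
  have e2 : (gridInterp d).comp (fluctuation W Θ α d T γ ε Δ₀ ω) s =
      γ • (spaceTimeInterp τ d T (iterates W α d T ε Δ₀ ω) s - gridInterp d (Θ s)) := by
    rw [← e, ← gridInterp_smul_sub]; rfl
  simp only [ContinuousMap.add_apply, ContinuousMap.smul_apply]
  rw [e2, fluctuation_apply, gridError_apply]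
  simp only [ContinuousMap.sub_apply, ContinuousMap.smul_apply, smul_eq_mul]
  ring

theorem freezeBoundary_add_smul (d : ℕ) (u v : PathSpace τ) (c : ℝ) :
    freezeBoundary d (u + c • v) = freezeBoundary d u + c • freezeBoundary d v := rfl

theorem freezeBoundary_gridInterp {d : ℕ} (hd : 1 ≤ d) (u : PathSpace τ) :
    freezeBoundary d ((gridInterp d).comp u) = (gridInterp d).comp u := by
  ext s x
  exact spaceInterp_sup_gridPoint hd _ x

variable {hτ : 0 ≤ τ} {α K : ℝ} {A : unitInterval → unitInterval → ℝ} {Θ : PathSpace τ}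

theorem norm_path_le {u : PathSpace τ} {b : ℝ} (hb : 0 ≤ b) (h : ∀ s x, |u s x| ≤ b) : ‖u‖ ≤ b :=
  (ContinuousMap.norm_le _ hb).2 fun s => (ContinuousMap.norm_le _ hb).2 fun x => h s x

/-- Freezing leaves only points with `x ≥ 1/d`, where the error is `o(1/d)` uniformly in time.
Against `γ ≤ C d` it vanishes for large `d`, while for fixed `d` the coefficient is bounded. -/
theorem exists_isCompact_freezeBoundary (hΘ : IsScalingLimit hτ α A Θ) (hα : 0 ≤ α)
    (hA : IsSmoothKernel A K) {ι : Type*} {d : ι → ℕ} (hd : ∀ i, 1 ≤ d i) {γ : ι → ℝ}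
    {C : ℝ} (hγ0 : ∀ i, 0 ≤ γ i) (hγ : ∀ i, γ i ≤ C * d i) : ∃ S : Set (PathSpace τ), IsCompact S ∧
      ∀ i, γ i • freezeBoundary (d i) (gridError (d i) Θ) ∈ S := by
  refine exists_isCompact_of_smul (b := fun n => C * n)
    (g := fun n => freezeBoundary n (gridError n Θ))
    (fun i => by rw [abs_of_nonneg (hγ0 i)]; exact hγ i) fun ε hε => ?_
  have hδ : 0 < ε / (|C| + 1) := by positivity
  obtain ⟨N, hN⟩ := eventually_atTop.1 (hΘ.eventually_interpErr_le hα hA hδ)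
  refine ⟨N, fun i hi => norm_path_le hε.le fun s x => ?_⟩
  have hd' : (0 : ℝ) < d i := by have := hd i; positivity
  have hg : (gridPoint (d i) 1 : ℝ) = 1 / d i := by simpa using coe_gridPoint (hd i) (hd i)
  set y := x ⊔ gridPoint (d i) 1 with hy
  have hxy : 1 / (d i : ℝ) ≤ y := by
    rw [← hg]; exact (le_sup_right : gridPoint (d i) 1 ≤ y)
  change |γ i * (gridInterp (d i) (Θ s) y - Θ s y)| ≤ ε
  rw [gridInterp_sub_eq_interpErr (hd i) _ hxy, abs_mul, abs_of_nonneg (hγ0 i)]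
  have h1 := hN (d i) hi s y
  calc _ ≤ (C * d i) * |interpErr (d i) (Θ s) y| := by gcongr; exact hγ i
    _ = C * (d i * |interpErr (d i) (Θ s) y|) := by ring
    _ ≤ |C| * (ε / (|C| + 1)) := by
        refine mul_le_mul (le_abs_self C) h1 (by positivity) (abs_nonneg C)
    _ ≤ (|C| + 1) * (ε / (|C| + 1)) := by gcongr; linarith
    _ = ε := by field_simp

/-- The jump of a path over the boundary cell. -/
noncomputable def boundaryJump (d : ℕ) (Θ : PathSpace τ) : ℝ :=
  ⨆ s : Set.Icc (0 : ℝ) τ, |Θ s (gridPoint d 1) - Θ s 0|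

theorem abs_le_boundaryJump (d : ℕ) (Θ : PathSpace τ) (s : Set.Icc (0 : ℝ) τ) :
    |Θ s (gridPoint d 1) - Θ s 0| ≤ boundaryJump d Θ := by
  refine le_ciSup (f := fun s : Set.Icc (0 : ℝ) τ => |Θ s (gridPoint d 1) - Θ s 0|)
    ⟨‖Θ‖ + ‖Θ‖, ?_⟩ s
  rintro _ ⟨r, rfl⟩
  exact (abs_sub _ _).trans (add_le_add (abs_path_le Θ r _) (abs_path_le Θ r _))

theorem boundaryJump_nonneg (d : ℕ) (Θ : PathSpace τ) : 0 ≤ boundaryJump d Θ :=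
  Real.iSup_nonneg fun _ => abs_nonneg _

theorem boundaryJump_le (hτ : 0 ≤ τ) {d : ℕ} {b : ℝ}
    (h : ∀ s, |Θ s (gridPoint d 1) - Θ s 0| ≤ b) : boundaryJump d Θ ≤ b := by
  have : Nonempty (Set.Icc (0 : ℝ) τ) := ⟨⟨0, le_rfl, hτ⟩⟩
  exact ciSup_le h

theorem IsScalingLimit.exists_boundaryJump_le (hΘ : IsScalingLimit hτ α A Θ) (hα : 0 ≤ α)
    (hA : IsSmoothKernel A K) : ∃ L : ℝ, 0 ≤ L ∧ ∀ d : ℕ, 1 ≤ d → boundaryJump d Θ ≤ L / d := by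
  obtain ⟨L, hL, h⟩ := hΘ.exists_space_lip hα hA
  refine ⟨L, hL, fun d hd => boundaryJump_le hτ fun s => (h s _ _).trans (le_of_eq ?_)⟩
  have hd' : (0 : ℝ) < d := by positivity
  have hg : (gridPoint d 1 : ℝ) = 1 / d := by simpa using coe_gridPoint hd hd
  rw [hg, Set.Icc.coe_zero, sub_zero, abs_of_pos (by positivity), mul_one_div]

/-- The hypothesis concerns `d` and `T` large together, whereas smallness is needed for `d` large
and every `T`. For `T ≤ T₀` the bound `γ ≤ C √T₀` and the jump bound `L / d` fill the gap. -/
theorem exists_isCompact_gridError (hΘ : IsScalingLimit hτ α A Θ) (hα : 0 ≤ α)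
    (hA : IsSmoothKernel A K) {γ : ℕ+ → ℕ+ → ℝ} {C : ℝ} (hγ0 : ∀ d T, 0 ≤ γ d T)
    (hγd : ∀ d T : ℕ+, γ d T ≤ C * (d : ℕ)) (hγT : ∀ d T : ℕ+, γ d T ≤ C * √(T : ℝ))
    (h : Tendsto (fun p : ℕ+ × ℕ+ => γ p.1 p.2 * boundaryJump p.1 Θ) atTop (𝓝 0)) :
    ∃ S : Set (PathSpace τ), IsCompact S ∧ ∀ p : ℕ+ × ℕ+, γ p.1 p.2 • gridError p.1 Θ ∈ S := by
  refine exists_isCompact_of_smul (c := fun p : ℕ+ × ℕ+ => γ p.1 p.2) (n := fun p => (p.1 : ℕ))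
    (b := fun n => C * n) (g := fun n => gridError n Θ)
    (fun p => by rw [abs_of_nonneg (hγ0 _ _)]; exact hγd _ _) fun ε hε => ?_
  have hδ : 0 < ε / 2 / (|C| + 1) := by positivity
  obtain ⟨N, hN⟩ := eventually_atTop.1 (hΘ.eventually_interpErr_le hα hA hδ)
  obtain ⟨⟨d₀, T₀⟩, h₀⟩ := eventually_atTop.1 (h.eventually (ge_mem_nhds (half_pos hε)))
  obtain ⟨L, hL, hjump⟩ := hΘ.exists_boundaryJump_le hα hA
  obtain ⟨N', hN'⟩ := exists_nat_ge (|C| * √(T₀ : ℝ) * L / (ε / 2))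
  refine ⟨max N (max d₀ N'), fun p hp => norm_path_le hε.le fun s x => ?_⟩
  obtain ⟨d, T⟩ := p
  simp only [max_le_iff] at hp
  have hd1 : 1 ≤ (d : ℕ) := d.2
  have hd' : (0 : ℝ) < (d : ℕ) := by positivity
  have hb : γ d T * boundaryJump d Θ ≤ ε / 2 := by
    rcases le_total T₀ T with hT | hT
    · exact h₀ (d, T) ⟨hp.2.1, hT⟩
    · have h1 : γ d T ≤ |C| * √(T₀ : ℝ) := by
        refine (hγT d T).trans (mul_le_mul (le_abs_self C) ?_ (Real.sqrt_nonneg _) (abs_nonneg C))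
        exact Real.sqrt_le_sqrt (by exact_mod_cast hT)
      have h2 : |C| * √(T₀ : ℝ) * L / (ε / 2) ≤ (d : ℕ) := hN'.trans (by exact_mod_cast hp.2.2)
      rw [div_le_iff₀ (half_pos hε)] at h2
      calc _ ≤ |C| * √(T₀ : ℝ) * (L / (d : ℕ)) :=
            mul_le_mul h1 (hjump d hd1) (boundaryJump_nonneg _ _) (by positivity)
        _ = |C| * √(T₀ : ℝ) * L / (d : ℕ) := by ring
        _ ≤ ε / 2 := by rw [div_le_iff₀ hd']; linarith
  have hi : γ d T * |interpErr d (Θ s) x| ≤ ε / 2 := by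
    calc _ ≤ (C * (d : ℕ)) * |interpErr d (Θ s) x| := by gcongr; exact hγd d T
      _ = C * ((d : ℕ) * |interpErr d (Θ s) x|) := by ring
      _ ≤ |C| * (ε / 2 / (|C| + 1)) :=
          mul_le_mul (le_abs_self C) (hN d hp.1 s x) (by positivity) (abs_nonneg C)
      _ ≤ (|C| + 1) * (ε / 2 / (|C| + 1)) := by gcongr; linarith
      _ = ε / 2 := by field_simp
  change |γ d T * (gridInterp d (Θ s) x - Θ s x)| ≤ ε
  rw [abs_mul, abs_of_nonneg (hγ0 d T)]
  have h3 := (abs_gridInterp_sub_le hd1 (Θ s) x).trans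
    (add_le_add_right (abs_le_boundaryJump d Θ s) _)
  have h4 := mul_le_mul_of_nonneg_left h3 (hγ0 d T)
  linarith

/-- Joint evaluation is continuous on the compact product of `S`, time and space, hence uniformly
continuous. -/
theorem exists_modulus_of_isCompact {S : Set (PathSpace τ)} (hS : IsCompact S) {ε : ℝ}
    (hε : 0 < ε) : ∃ δ > 0, ∀ u ∈ S, ∀ (s : Set.Icc (0 : ℝ) τ) (x y : unitInterval), dist x y < δ →
      |u s x - u s y| < ε := by
  have : CompactSpace S := isCompact_iff_compactSpace.1 hS
  have hc : Continuous fun q : S × Set.Icc (0 : ℝ) τ × unitInterval => (q.1 : PathSpace τ) q.2.1 q.2.2 := by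
    fun_prop
  have huc : UniformContinuous fun q : S × Set.Icc (0 : ℝ) τ × unitInterval =>
      (q.1 : PathSpace τ) q.2.1 q.2.2 := CompactSpace.uniformContinuous_of_continuous hc
  obtain ⟨δ, hδ, h⟩ := (Metric.uniformContinuous_iff (α := S × Set.Icc (0 : ℝ) τ × unitInterval)
    (β := ℝ)).1 huc ε hε
  refine ⟨δ, hδ, fun u hu s x y hxy => ?_⟩
  refine h (a := (⟨u, hu⟩, s, x)) (b := (⟨u, hu⟩, s, y)) ?_
  simpa [Prod.dist_eq] using hxy

/-- The grid error vanishes at `1/d` and equals the jump at `0`. A common modulus of continuity over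
the distance `1/d` forces `γ` times the jump to be small, whatever `T` is. -/
theorem tendsto_boundaryJump_of_isCompact (hτ : 0 ≤ τ) {γ : ℕ+ → ℕ+ → ℝ} (hγ0 : ∀ d T, 0 ≤ γ d T)
    {S : Set (PathSpace τ)} (hS : IsCompact S)
    (h : ∀ p : ℕ+ × ℕ+, γ p.1 p.2 • gridError p.1 Θ ∈ S) :
    Tendsto (fun p : ℕ+ × ℕ+ => γ p.1 p.2 * boundaryJump p.1 Θ) atTop (𝓝 0) := by
  rw [Metric.tendsto_atTop]
  intro ε hε
  obtain ⟨δ, hδ, hmod⟩ := exists_modulus_of_isCompact hS (half_pos hε)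
  obtain ⟨n, hn⟩ := exists_nat_one_div_lt hδ
  refine ⟨(n.succPNat, 1), fun ⟨d, T⟩ hp => ?_⟩
  have hdn : n.succPNat ≤ d := hp.1
  have hd1 : 1 ≤ (d : ℕ) := d.2
  have hd' : (0 : ℝ) < (d : ℕ) := by positivity
  have hg : (gridPoint d 1 : ℝ) = 1 / (d : ℕ) := by simpa using coe_gridPoint hd1 hd1
  rw [Real.dist_eq, sub_zero, abs_of_nonneg (mul_nonneg (hγ0 _ _) (boundaryJump_nonneg _ _))]
  refine lt_of_le_of_lt ?_ (half_lt_self hε)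
  rcases (hγ0 d T).eq_or_lt with h0 | h0
  · simp only [← h0, zero_mul]; exact (half_pos hε).le
  rw [← le_div_iff₀' h0]
  refine boundaryJump_le hτ fun s => ?_
  rw [le_div_iff₀' h0]
  have hdist : dist (0 : unitInterval) (gridPoint d 1) < δ := by
    rw [Subtype.dist_eq, Real.dist_eq, hg, Set.Icc.coe_zero, zero_sub, abs_neg,
      abs_of_pos (by positivity)]
    refine lt_of_le_of_lt ?_ hn
    have : ((n.succPNat : ℕ) : ℝ) ≤ (d : ℕ) := by exact_mod_cast hdn
    rw [Nat.succPNat_coe, Nat.succ_eq_add_one] at this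
    push_cast at this
    exact one_div_le_one_div_of_le (by positivity) this
  have h1 := hmod _ (h (d, T)) s 0 (gridPoint d 1) hdist
  have e1 : gridError d Θ s (gridPoint d 1) = 0 := by
    rw [gridError_apply, gridInterp_gridPoint _ (Finset.mem_Icc.2 ⟨le_rfl, hd1⟩), sub_self]
  have e0 : gridError d Θ s 0 = Θ s (gridPoint d 1) - Θ s 0 := by
    rw [gridError_apply, gridInterp_apply, spaceInterp_boundary hd1 _ (by simp)]
  simp only [ContinuousMap.smul_apply, e1, e0, smul_eq_mul, mul_zero, sub_zero] at h1
  rw [abs_mul, abs_of_pos h0] at h1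
  exact h1.le

end Decomposition

/-! ### Tightness of the interpolated fluctuations -/

theorem isTightFamily_gridInterp_fluctuation {Ω : Type*} [MeasurableSpace Ω] {P : Measure Ω}
    [IsProbabilityMeasure P] {W : ℝ≥0 → unitInterval → Ω → ℝ} {A : unitInterval → unitInterval → ℝ}
    {B : (Fin 4 → unitInterval) → ℝ} {E : (Fin 8 → unitInterval) → ℝ} {α τ : ℝ} {Θ : PathSpace τ}
    (hW : IsDataProcess P W A B E) (hABE : SmoothMoments A B E) (hα : 0 ≤ α) (hτ : 0 < τ)
    (hΘ : IsScalingLimit hτ.le α A Θ) {C₁ C Q : ℝ} {ι : Type*} {d T : ι → ℕ} {γ σ : ι → ℝ}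
    {ε Δ₀ : ι → ℕ → Ω → ℝ} (hd : ∀ p, 1 ≤ d p) (hT : ∀ p, 1 ≤ T p) (hγ : ∀ p, 0 ≤ γ p)
    (hσ : ∀ p, 0 ≤ σ p) (hγT : ∀ p, γ p / √(T p : ℝ) ≤ C) (hγd : ∀ p, γ p / d p ≤ C)
    (hγσ : ∀ p, γ p * σ p / (d p * √(T p : ℝ)) ≤ C) (hε : ∀ p, IsNoise P C₁ (σ p) (ε p))
    (hΔ : ∀ p, ∀ i ∈ Finset.Icc 1 (d p), Measurable (Δ₀ p i))
    (hΔ4 : ∀ p, ∀ i ∈ Finset.Icc 1 (d p), MemLp (Δ₀ p i) 4 P)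
    (hind : ∀ p, IndepFun (fun (ω : Ω) (q : ℝ≥0 × unitInterval) => W q.1 q.2 ω)
      (dataSource (d p) (Δ₀ p) (ε p)) P)
    (hQ : ∀ p, ∀ i ∈ Finset.Icc 1 (d p),
      ∫ ω, discFluct hτ.le W Θ α (d p) (T p) (γ p) (ε p) (Δ₀ p) 0 i ω ^ 4 ∂P ≤ Q) :
    (∀ p, Measurable (fluctuation W Θ α (d p) (T p) (γ p) (ε p) (Δ₀ p))) ∧
    IsTightFamily P fun p ω => (gridInterp (d p)).comp
      (fluctuation W Θ α (d p) (T p) (γ p) (ε p) (Δ₀ p) ω) := by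
  obtain ⟨K, hK, hscheme⟩ := exists_isIncrementScheme hW hABE hα hΘ C₁ C Q
  obtain ⟨K', hK', hbound⟩ := IsIncrementScheme.exists_moment_bound (P := P) τ K hK
  have hs : ∀ p, IsIncrementScheme P τ K (T p) (Finset.Icc 1 (d p)) _ _ _ _ := fun p =>
    hscheme (d p) (T p) (γ p) (σ p) (ε p) (Δ₀ p) (hd p) (hT p) (hγ p) (hσ p) (hγT p) (hγd p)
      (hγσ p) (hε p) (hΔ p) (hΔ4 p) (hind p) (hQ p)
  have hmeas : ∀ p, Measurable (fluctuation W Θ α (d p) (T p) (γ p) (ε p) (Δ₀ p)) := fun p => by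
    have hZ : Measurable (dataSource (d p) (Δ₀ p) (ε p)) :=
      (measurable_pi_lambda _ fun i : Set.Icc 1 (d p) => hΔ p i (Finset.mem_Icc.2 i.2)).prodMk
        (measurable_pi_lambda _ fun t => (hε p).measurable t)
    exact measurable_fluctuation (hd p) fun t j hj =>
      (measurable_past_iterates t j hj).mono (hW.past_le hZ (T p) t) le_rfl
  refine ⟨hmeas, isTightFamily_of_sob_moments hτ
    (fun p => (ContinuousMap.continuous_postcomp (gridInterp (d p))).measurable.comp (hmeas p)) hd
    (v := fun p s ω j => fluctuation W Θ α (d p) (T p) (γ p) (ε p) (Δ₀ p) ω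
      (Set.projIcc 0 τ hτ.le s) (gridPoint (d p) j)) (K := 4 * max Q K')
    (fun p ω s => ?_) (fun p ω => ?_) (by positivity) (fun p => ?_) fun p s h_s s' h_s' => ?_⟩
  · rw [Set.projIcc_val]; rfl
  · have hc : ∀ j, Continuous fun s : ℝ => fluctuation W Θ α (d p) (T p) (γ p) (ε p) (Δ₀ p) ω
        (Set.projIcc 0 τ hτ.le s) (gridPoint (d p) j) := fun j => by
      have := continuous_projIcc (h := hτ.le)
      fun_prop
    refine (PiLp.continuous_toLp 2 _).comp (continuous_pi fun i => ?_)
    split_ifs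
    · exact hc 1
    · exact ((hc _).sub (hc _)).const_mul _
  · obtain ⟨h1, h2⟩ := integral_sob_pow_four_le (P := P) (hd p) (b := Q)
      (v := fun ω j => fluctuation W Θ α (d p) (T p) (γ p) (ε p) (Δ₀ p) ω
        (Set.projIcc 0 τ hτ.le 0) (gridPoint (d p) j)) fun i hi => ⟨((hs p).init i hi).1, hQ p i hi⟩
    exact ⟨h1, h2.trans (by gcongr; exact le_max_left _ _)⟩
  · simp only [← map_sub]
    have hi4 := fun i hi => hbound (T p) _ _ _ _ _ (hT p) (hs p) i hi
    obtain ⟨h1, h2⟩ := integral_sob_pow_four_le (P := P) (hd p) (b := K' * |s - s'| ^ 2)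
      (v := fun ω => (fun j => fluctuation W Θ α (d p) (T p) (γ p) (ε p) (Δ₀ p) ω
        (Set.projIcc 0 τ hτ.le s) (gridPoint (d p) j)) - fun j => fluctuation W Θ α (d p) (T p)
        (γ p) (ε p) (Δ₀ p) ω (Set.projIcc 0 τ hτ.le s') (gridPoint (d p) j)) fun i hi => by
      have e : ∀ ω, disc (d p) ((fun j => fluctuation W Θ α (d p) (T p) (γ p) (ε p) (Δ₀ p) ω
        (Set.projIcc 0 τ hτ.le s) (gridPoint (d p) j)) - fun j => fluctuation W Θ α (d p) (T p)
        (γ p) (ε p) (Δ₀ p) ω (Set.projIcc 0 τ hτ.le s') (gridPoint (d p) j)) i =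
        discFluct hτ.le W Θ α (d p) (T p) (γ p) (ε p) (Δ₀ p) s i ω -
        discFluct hτ.le W Θ α (d p) (T p) (γ p) (ε p) (Δ₀ p) s' i ω := fun ω => disc_sub _ _ _ _
      simp only [e]
      exact ⟨((hi4 i hi s h_s).1).sub (hi4 i hi s' h_s').1, (hi4 i hi s h_s).2 s' h_s'⟩
    refine ⟨h1, h2.trans ?_⟩
    rw [mul_assoc]
    gcongr
    exact le_max_right _ _

end SGDFluctuation

/-! ### Tightness of the fluctuations and its criterion at the boundary -/

theorem mainTheorem6 {Ω : Type*} [MeasurableSpace Ω] (P : Measure Ω) [IsProbabilityMeasure P]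
    -- the data process and its moment functions
    (W : ℝ≥0 → unitInterval → Ω → ℝ) (A : unitInterval → unitInterval → ℝ)
    (B : (Fin 4 → unitInterval) → ℝ) (E : (Fin 8 → unitInterval) → ℝ)
    (hW : SGDFluctuation.IsDataProcess P W A B E) (hABE : SGDFluctuation.SmoothMoments A B E)
    -- the noises and the initial values, for each dimension `d` and time resolution `T`
    (σ : ℕ+ → ℕ+ → ℝ) (hσ : ∀ d T, 0 ≤ σ d T) (ε : ℕ+ → ℕ+ → ℕ → Ω → ℝ)
    (C₁ : ℝ) (hε : ∀ d T, SGDFluctuation.IsNoise P C₁ (σ d T) (ε d T))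
    (Δ₀ : ℕ+ → ℕ+ → ℕ → Ω → ℝ)
    (hΔ₀_meas : ∀ (d T : ℕ+) (i : ℕ), i ∈ Finset.Icc 1 (d : ℕ) → Measurable (Δ₀ d T i))
    (hΔ₀_memLp : ∀ (d T : ℕ+) (i : ℕ), i ∈ Finset.Icc 1 (d : ℕ) → MemLp (Δ₀ d T i) 4 P)
    (hindep : ∀ d T : ℕ+,
      IndepFun (fun (ω : Ω) (p : ℝ≥0 × unitInterval) => W p.1 p.2 ω)
        (fun ω : Ω => ((fun i : Set.Icc 1 (d : ℕ) => Δ₀ d T i ω), fun t : ℕ => ε d T t ω)) P)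
    -- the scaling limit
    (τ : ℝ) (hτ : 0 < τ) (α : ℝ) (hα : 0 < α)
    (Θ : SGDFluctuation.PathSpace τ) (hΘ : SGDFluctuation.IsScalingLimit hτ.le α A Θ)
    -- the fluctuation processes
    (γ : ℕ+ → ℕ+ → ℝ) (hγ : ∀ d T, 0 ≤ γ d T)
    (U : ℕ+ × ℕ+ → Ω → SGDFluctuation.PathSpace τ)
    (hU : ∀ d T : ℕ+, U (d, T) = SGDFluctuation.fluctuation W Θ α d T (γ d T) (ε d T) (Δ₀ d T))
    -- initial conditions for the iterates
    (R L : ℝ)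
    (hR : ∀ (d T : ℕ+) (i : ℕ), i ∈ Finset.Icc 1 (d : ℕ) → ∫ ω, |Δ₀ d T i ω| ^ 4 ∂P ≤ R ^ 4)
    (hL : ∀ (d T : ℕ+) (i : ℕ), i ∈ Finset.Icc 2 (d : ℕ) →
      ∫ ω, |Δ₀ d T i ω - Δ₀ d T (i - 1) ω| ^ 4 ∂P ≤ L ^ 4 * (1 / (d : ℝ)) ^ 4)
    -- initial conditions for the fluctuations
    (D M : ℝ)
    (hD : ∀ (d T : ℕ+) (i : ℕ), i ∈ Finset.Icc 1 (d : ℕ) →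
      ∫ ω, |U (d, T) ω ⟨0, le_rfl, hτ.le⟩ (SGDFluctuation.gridPoint d i)| ^ 4 ∂P ≤ D ^ 4)
    (hM : ∀ (d T : ℕ+) (i : ℕ), i ∈ Finset.Icc 2 (d : ℕ) →
      ∫ ω, |U (d, T) ω ⟨0, le_rfl, hτ.le⟩ (SGDFluctuation.gridPoint d i)
        - U (d, T) ω ⟨0, le_rfl, hτ.le⟩ (SGDFluctuation.gridPoint d (i - 1))| ^ 4 ∂P
        ≤ M ^ 4 * (1 / (d : ℝ)) ^ 4)
    -- the scaling regime
    (hσ_small : Tendsto (fun p : ℕ+ × ℕ+ => σ p.1 p.2 / ((p.1 : ℝ) * √(p.2 : ℝ))) atTop (𝓝 0))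
    (C : ℝ)
    (hγ_bound : ∀ d T : ℕ+,
      max (max (γ d T / √(T : ℝ)) (γ d T / (d : ℝ)))
        (γ d T * σ d T / ((d : ℝ) * √(T : ℝ))) ≤ C) :
    -- the processes frozen on the boundary cell are tight
    (SGDFluctuation.IsTightFamily P
        (fun (p : ℕ+ × ℕ+) ω => SGDFluctuation.freezeBoundary p.1 (U p ω)) ∧
      SGDFluctuation.HasWeakSubsequentialLimits P
        (fun (p : ℕ+ × ℕ+) ω => SGDFluctuation.freezeBoundary p.1 (U p ω))) ∧
    -- the processes themselves are tight exactly when the limit does not feel the boundary cell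
    (SGDFluctuation.IsTightFamily P U ↔
      Tendsto (fun p : ℕ+ × ℕ+ => γ p.1 p.2 *
        ⨆ s : Set.Icc (0 : ℝ) τ, |Θ s (SGDFluctuation.gridPoint p.1 1) - Θ s 0|) atTop (𝓝 0)) ∧
    (SGDFluctuation.IsTightFamily P U → SGDFluctuation.HasWeakSubsequentialLimits P U) ∧
    -- in particular they are tight when `γ = o(d)`
    (Tendsto (fun p : ℕ+ × ℕ+ => γ p.1 p.2 / (p.1 : ℝ)) atTop (𝓝 0) →
      SGDFluctuation.IsTightFamily P U ∧ SGDFluctuation.HasWeakSubsequentialLimits P U) := by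
  have hUe : U = fun p => SGDFluctuation.fluctuation W Θ α p.1 p.2 (γ p.1 p.2) (ε p.1 p.2)
      (Δ₀ p.1 p.2) := funext fun p => hU p.1 p.2
  obtain ⟨K, hA⟩ := hW.exists_isSmoothKernel hABE
  have hTpos : ∀ T : ℕ+, 0 < √(T : ℝ) := fun T => Real.sqrt_pos.2 (by exact_mod_cast T.pos)
  have hdpos : ∀ d : ℕ+, (0 : ℝ) < d := fun d => by exact_mod_cast d.pos
  have hC1 : ∀ d T : ℕ+, γ d T / √(T : ℝ) ≤ C := fun d T =>
    ((le_max_left _ _).trans (le_max_left _ _)).trans (hγ_bound d T)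
  have hC2 : ∀ d T : ℕ+, γ d T / (d : ℝ) ≤ C := fun d T =>
    ((le_max_right _ _).trans (le_max_left _ _)).trans (hγ_bound d T)
  have hC3 : ∀ d T : ℕ+, γ d T * σ d T / ((d : ℝ) * √(T : ℝ)) ≤ C := fun d T =>
    (le_max_right _ _).trans (hγ_bound d T)
  have hγT : ∀ d T : ℕ+, γ d T ≤ C * √(T : ℝ) := fun d T => (div_le_iff₀ (hTpos T)).1 (hC1 d T)
  have hγd : ∀ d T : ℕ+, γ d T ≤ C * (d : ℕ) := fun d T => (div_le_iff₀ (hdpos d)).1 (hC2 d T)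
  -- The first discrete derivative is a value, bounded through `D`; the others are differences
  -- scaled by `d`, bounded through `M`.
  have hQ : ∀ p : ℕ+ × ℕ+, ∀ i ∈ Finset.Icc 1 (p.1 : ℕ),
      ∫ ω, SGDFluctuation.discFluct hτ.le W Θ α p.1 p.2 (γ p.1 p.2) (ε p.1 p.2) (Δ₀ p.1 p.2) 0 i ω
        ^ 4 ∂P ≤ D ^ 4 + M ^ 4 := by
    rintro ⟨d, T⟩ i hi
    have hi' := Finset.mem_Icc.1 hi
    simp only [SGDFluctuation.discFluct, Set.projIcc_left]
    have h1 := hD d T i hi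
    simp only [hU, Even.pow_abs (show Even 4 by decide)] at h1
    have hD4 : 0 ≤ D ^ 4 := by positivity
    have hM4 : 0 ≤ M ^ 4 := by positivity
    by_cases h : i ≤ 1
    · obtain rfl : i = 1 := by omega
      simp only [SGDFluctuation.disc_one]
      linarith
    · have h2 := hM d T i (Finset.mem_Icc.2 ⟨by omega, hi'.2⟩)
      simp only [hU, Even.pow_abs (show Even 4 by decide)] at h2
      simp only [SGDFluctuation.disc, h, if_false]
      rw [SGDFluctuation.integral_const_mul_pow_four]
      have hd' : (0 : ℝ) < (d : ℕ) := hdpos d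
      calc _ ≤ ((d : ℕ) : ℝ) ^ 4 * (M ^ 4 * (1 / (d : ℕ)) ^ 4) := by gcongr
        _ = M ^ 4 := by field_simp
        _ ≤ _ := by linarith
  obtain ⟨hmeas, htight⟩ := SGDFluctuation.isTightFamily_gridInterp_fluctuation hW hABE hα.le hτ hΘ
    (ι := ℕ+ × ℕ+) (d := fun p => p.1) (T := fun p => p.2) (γ := fun p => γ p.1 p.2)
    (σ := fun p => σ p.1 p.2) (ε := fun p => ε p.1 p.2) (Δ₀ := fun p => Δ₀ p.1 p.2)
    (fun p => p.1.pos) (fun p => p.2.pos) (fun p => hγ _ _) (fun p => hσ _ _) (fun p => hC1 _ _)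
    (fun p => hC2 _ _) (fun p => hC3 _ _) (fun p => hε _ _) (fun p => hΔ₀_meas _ _)
    (fun p => hΔ₀_memLp _ _) (fun p => hindep _ _) hQ
  have hdec : ∀ p ω, U p ω = (SGDFluctuation.gridInterp p.1).comp (U p ω) +
      γ p.1 p.2 • SGDFluctuation.gridError p.1 Θ := fun p ω => by
    rw [hUe]
    exact SGDFluctuation.fluctuation_eq_add p.1.pos ω
  have htight' : SGDFluctuation.IsTightFamily P
      fun (p : ℕ+ × ℕ+) ω => (SGDFluctuation.gridInterp p.1).comp (U p ω) := by
    rw [hUe]; exact htight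
  have hfreeze : SGDFluctuation.IsTightFamily P
      fun (p : ℕ+ × ℕ+) ω => SGDFluctuation.freezeBoundary p.1 (U p ω) := by
    obtain ⟨S, hS, h⟩ := SGDFluctuation.exists_isCompact_freezeBoundary hΘ hα.le hA
      (ι := ℕ+ × ℕ+) (d := fun p => p.1) (γ := fun p => γ p.1 p.2) (fun p => p.1.pos)
      (fun p => hγ _ _) fun p => hγd _ _
    have e : (fun (p : ℕ+ × ℕ+) ω => SGDFluctuation.freezeBoundary p.1 (U p ω)) = fun p ω =>
        (SGDFluctuation.gridInterp p.1).comp (U p ω) +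
          γ p.1 p.2 • SGDFluctuation.freezeBoundary p.1 (SGDFluctuation.gridError p.1 Θ) := by
      funext p ω
      -- Grid interpolations are already constant on the boundary cell, so freezing acts on the
      -- deterministic part only.
      have hp := congrArg (SGDFluctuation.freezeBoundary p.1) (hdec p ω)
      rwa [SGDFluctuation.freezeBoundary_add_smul,
        SGDFluctuation.freezeBoundary_gridInterp p.1.pos] at hp
    rw [e]
    exact htight'.add_const (z := fun p =>
      γ p.1 p.2 • SGDFluctuation.freezeBoundary p.1 (SGDFluctuation.gridError p.1 Θ)) hS h
  have hiff : SGDFluctuation.IsTightFamily P U ↔ Tendsto (fun p : ℕ+ × ℕ+ => γ p.1 p.2 *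
      SGDFluctuation.boundaryJump p.1 Θ) atTop (𝓝 0) := by
    refine ⟨fun h => ?_, fun h => ?_⟩
    · obtain ⟨S, hS, hmem⟩ := htight'.exists_isCompact_sub h hdec
      exact SGDFluctuation.tendsto_boundaryJump_of_isCompact hτ.le hγ hS hmem
    · obtain ⟨S, hS, hmem⟩ := SGDFluctuation.exists_isCompact_gridError hΘ hα.le hA hγ hγd hγT h
      have e : U = fun p ω => (SGDFluctuation.gridInterp p.1).comp (U p ω) +
          γ p.1 p.2 • SGDFluctuation.gridError p.1 Θ := funext fun p => funext fun ω => hdec p ω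
      rw [e]
      exact htight'.add_const (z := fun p => γ p.1 p.2 • SGDFluctuation.gridError p.1 Θ) hS hmem
  refine ⟨⟨hfreeze, SGDFluctuation.hasWeakSubsequentialLimits_of_isTightFamily hfreeze⟩, hiff,
    SGDFluctuation.hasWeakSubsequentialLimits_of_isTightFamily, fun h => ?_⟩
  have hUt : SGDFluctuation.IsTightFamily P U := by
    -- The jump is at most `K' / d` by the Lipschitz bound in space, so `γ / d → 0` implies the
    -- boundary criterion.
    obtain ⟨K', hK', hjump⟩ := hΘ.exists_boundaryJump_le hα.le hA
    refine hiff.2 (squeeze_zero (fun p => mul_nonneg (hγ _ _)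
      (SGDFluctuation.boundaryJump_nonneg _ _)) (fun p => ?_) (by simpa using h.const_mul K'))
    calc _ ≤ γ p.1 p.2 * (K' / (p.1 : ℕ)) :=
          mul_le_mul_of_nonneg_left (hjump p.1 p.1.pos) (hγ _ _)
      _ = _ := by ring
  exact ⟨hUt, SGDFluctuation.hasWeakSubsequentialLimits_of_isTightFamily hUt⟩
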